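/- Let $(M,g)$ be a connected smooth four-dimensional Lorentzian manifold of signature $(-,+,+,+)$, with Levi-Civita connection $\nabla$, curvature tensor $R_{hijk}$, Ricci tensor $R_{ik}=R^{l}{}_{ilk}$ and Ricci scalar $R$. Let $u$ be a smooth vector field with $u^iu_i=-1$, put $h_{ij}=g_{ij}+u_iu_j$, and let $p,\rho$ be smooth functions on $M$. Let $F$ be a real function that is $C^3$ on an open set containing all values of $R$, write $F_R=dF/dR$, and let $\kappa\neq0$ be a constant. Suppose that $(M,g)$ is a perfect-fluid solution of $F(R)$ gravity, $$F_R(R)R_{ij}-\tfrac12F(R)g_{ij}+(g_{ij}\Box-\nabla_i\nabla_j)F_R(R)=\kappa^2\,(p\,h_{ij}+\rho\,u_iu_j),$$ and that it is projectively harmonic: $\nabla^hP_{hijk}=0$, where $$P_{hijk}=R_{hijk}+\tfrac13\,(R_{ij}g_{hk}-R_{ik}g_{jh}).$$ Then either $p+\rho=0$ on all of $M$, or there is a constant $A$ such that $A/\big(RF_R(R)-2F(R)+4\kappa^2\rho\big)>0$ on $M$ and, with $$a=\left(\frac{A}{RF_R(R)-2F(R)+4\kappa^2\rho}\right)^{1/4},$$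 the following hold. (1) $(M,g)$ is (locally) a generalized Robertson–Walker spacetime with velocity $u$ and scale factor $a$: every point of $M$ has a neighbourhood with coordinates $(t,y^1,y^2,y^3)$ ranging over a product $I\times V$ of an open interval $I$ and a connected open set $V\subseteq\mathbb R^3$, in which $u=\partial_t$, $a=a(t)$ is a smooth positive function of $t$ alone, and $$ds^2=-dt^2+a(t)^2\,\gamma_{\alpha\beta}(y)\,dy^\alpha dy^\beta$$ with a smooth Riemannian metric $\gamma$ on $V$. (2) The shear, the vorticity and the acceleration $u^k\nabla_ku_i$ of $u$ vanish, and $$\nabla_ju_i=\frac{\dot a}{a}\,h_{ji},\qquad \dot a=u^k\partial_ka .$$ -/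

import Mathlib

open Set Bundle
open scoped Manifold ContDiff Matrix

noncomputable section

namespace Spacetime

/-- The model space `ℝ⁴`. The coordinates of a point are `z 0`, `z 1`, `z 2`, `z 3`. -/
abbrev R4 := EuclideanSpace ℝ (Fin 4)

/-- A field of components `g_ij` on the coordinate space. -/
abbrev Comp := R4 → Matrix (Fin 4) (Fin 4) ℝ

/-! ### Tensor calculus in coordinates

Below `g : Comp` holds the components of a metric in a coordinate system, and all conventions are
those of a torsion-free metric connection `∇_j ∂_k = Γ^l_jk ∂_l` with Ricci tensor
`R_ik = R^l_ilk`. -/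

/-- The partial derivative `∂_i f`. -/
def pd (i : Fin 4) (f : R4 → ℝ) (z : R4) : ℝ :=
  fderiv ℝ f z (EuclideanSpace.single i 1)

/-- Christoffel symbols `Γ^l_jk = ½ g^{lm} (∂_j g_mk + ∂_k g_mj - ∂_m g_jk)`. -/
def christoffel (g : Comp) (l j k : Fin 4) (z : R4) : ℝ :=
  1 / 2 * ∑ m, (g z)⁻¹ l m *
    (pd j (fun y => g y m k) z + pd k (fun y => g y m j) z - pd m (fun y => g y j k) z)

/-- The curvature tensor
`R^l_ijk = ∂_j Γ^l_ki - ∂_k Γ^l_ji + Γ^l_jm Γ^m_ki - Γ^l_km Γ^m_ji`. -/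
def riemannUp (g : Comp) (l i j k : Fin 4) (z : R4) : ℝ :=
  pd j (christoffel g l k i) z - pd k (christoffel g l j i) z +
    ∑ m, (christoffel g l j m z * christoffel g m k i z -
      christoffel g l k m z * christoffel g m j i z)

/-- The covariant curvature tensor `R_hijk = g_hl R^l_ijk`. -/
def riemann (g : Comp) (h i j k : Fin 4) (z : R4) : ℝ :=
  ∑ l, g z h l * riemannUp g l i j k z

/-- The Ricci tensor `R_ik = R^l_ilk`. -/
def ricci (g : Comp) (i k : Fin 4) (z : R4) : ℝ :=
  ∑ l, riemannUp g l i l k z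

/-- The Ricci scalar `R = g^{ik} R_ik`. -/
def scalar (g : Comp) (z : R4) : ℝ :=
  ∑ i, ∑ k, (g z)⁻¹ i k * ricci g i k z

/-- The projective curvature tensor of a four-dimensional metric,
`P_hijk = R_hijk + (R_ij g_hk - R_ik g_jh) / 3`. -/
def projCurv (g : Comp) (h i j k : Fin 4) (z : R4) : ℝ :=
  riemann g h i j k z + (ricci g i j z * g z h k - ricci g i k z * g z j h) / 3

/-- The covariant derivative `∇_m T_hijk` of a covariant tensor of rank four. -/
def covDeriv4 (g : Comp) (T : Fin 4 → Fin 4 → Fin 4 → Fin 4 → R4 → ℝ)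
    (m h i j k : Fin 4) (z : R4) : ℝ :=
  pd m (T h i j k) z - ∑ l, (christoffel g l m h z * T l i j k z +
    christoffel g l m i z * T h l j k z + christoffel g l m j z * T h i l k z +
    christoffel g l m k z * T h i j l z)

/-- The divergence `∇^h P_hijk` of the projective curvature tensor. -/
def divProjCurv (g : Comp) (i j k : Fin 4) (z : R4) : ℝ :=
  ∑ m, ∑ h, (g z)⁻¹ m h * covDeriv4 g (projCurv g) m h i j k z

/-- The second covariant derivative `∇_i ∇_j f` of a scalar. -/
def hess (g : Comp) (f : R4 → ℝ) (i j : Fin 4) (z : R4) : ℝ :=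
  pd i (pd j f) z - ∑ l, christoffel g l i j z * pd l f z

/-- The d'Alembertian `□ f = g^{ij} ∇_i ∇_j f`. -/
def box (g : Comp) (f : R4 → ℝ) (z : R4) : ℝ :=
  ∑ i, ∑ j, (g z)⁻¹ i j * hess g f i j z

/-! #### Kinematics of a vector field `v = v^i ∂_i` with `v^i v_i = -1` -/

/-- The lowered components `v_i = g_ik v^k`. -/
def lower (g : Comp) (v : R4 → R4) (i : Fin 4) (z : R4) : ℝ :=
  ∑ k, g z i k * v z k

/-- The covariant derivative `∇_j v_i` of the lowered vector field. -/
def nabla (g : Comp) (v : R4 → R4) (j i : Fin 4) (z : R4) : ℝ :=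
  pd j (lower g v i) z - ∑ l, christoffel g l j i z * lower g v l z

/-- The orthogonal projector `h_ij = g_ij + v_i v_j`. -/
def proj (g : Comp) (v : R4 → R4) (i j : Fin 4) (z : R4) : ℝ :=
  g z i j + lower g v i z * lower g v j z

/-- The mixed projector `h_i^k = δ_i^k + v_i v^k`. -/
def projMixed (g : Comp) (v : R4 → R4) (i k : Fin 4) (z : R4) : ℝ :=
  (if i = k then 1 else 0) + lower g v i z * v z k

/-- The acceleration `v^k ∇_k v_i`. -/
def acceleration (g : Comp) (v : R4 → R4) (i : Fin 4) (z : R4) : ℝ :=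
  ∑ k, v z k * nabla g v k i z

/-- The expansion scalar `θ = ∇^k v_k`. -/
def expansion (g : Comp) (v : R4 → R4) (z : R4) : ℝ :=
  ∑ k, ∑ l, (g z)⁻¹ k l * nabla g v k l z

/-- The shear `h_i^k h_j^l ∇_(k v_l) - (θ / 3) h_ij`. -/
def shear (g : Comp) (v : R4 → R4) (i j : Fin 4) (z : R4) : ℝ :=
  (∑ k, ∑ l, projMixed g v i k z * projMixed g v j l z *
    ((nabla g v k l z + nabla g v l k z) / 2)) - expansion g v z / 3 * proj g v i j z

/-- The vorticity `h_i^k h_j^l ∇_[k v_l]`. -/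
def vorticity (g : Comp) (v : R4 → R4) (i j : Fin 4) (z : R4) : ℝ :=
  ∑ k, ∑ l, projMixed g v i k z * projMixed g v j l z *
    ((nabla g v k l z - nabla g v l k z) / 2)

/-! ### Lorentzian four-manifolds -/

/-- The Minkowski matrix `diag(-1, 1, 1, 1)`. -/
def minkowski : Matrix (Fin 4) (Fin 4) ℝ := Matrix.diagonal ![-1, 1, 1, 1]

variable (M : Type*) [TopologicalSpace M] [ChartedSpace R4 M] [IsManifold 𝓘(ℝ, R4) ∞ M]

/-- A smooth Lorentzian metric of signature `(-, +, +, +)`. -/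
structure LorentzMetric where
  /-- The bilinear form on each tangent space. -/
  val (x : M) : TangentSpace 𝓘(ℝ, R4) x →L[ℝ] TangentSpace 𝓘(ℝ, R4) x →L[ℝ] ℝ
  symm (x : M) (v w : TangentSpace 𝓘(ℝ, R4) x) : val x v w = val x w v
  signature (x : M) : ∃ b : Module.Basis (Fin 4) ℝ (TangentSpace 𝓘(ℝ, R4) x),
    ∀ i j, val x (b i) (b j) = minkowski i j
  smooth : ContMDiff 𝓘(ℝ, R4) (𝓘(ℝ, R4).prod 𝓘(ℝ, R4 →L[ℝ] R4 →L[ℝ] ℝ)) ∞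
    (fun x => TotalSpace.mk' (R4 →L[ℝ] R4 →L[ℝ] ℝ)
      (E := fun x : M => TangentSpace 𝓘(ℝ, R4) x →L[ℝ] TangentSpace 𝓘(ℝ, R4) x →L[ℝ] ℝ)
      x (val x))

variable {M}

/-- A smooth coordinate chart of `M`. -/
def IsChart (e : OpenPartialHomeomorph M R4) : Prop :=
  e ∈ IsManifold.maximalAtlas 𝓘(ℝ, R4) ∞ M

/-- The coordinate vector field `∂_i` of the chart `e`, at the point with coordinates `z`. -/
def frame (e : OpenPartialHomeomorph M R4) (i : Fin 4) (z : R4) :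
    TangentSpace 𝓘(ℝ, R4) (e.symm z) :=
  mfderiv 𝓘(ℝ, R4) 𝓘(ℝ, R4) e.symm z (EuclideanSpace.single i (1 : ℝ) : R4)

/-- The components `g_ij = g(∂_i, ∂_j)` in the chart `e`. -/
def LorentzMetric.coord (g : LorentzMetric M) (e : OpenPartialHomeomorph M R4) : Comp :=
  fun z => Matrix.of fun i j => g.val (e.symm z) (frame e i z) (frame e j z)

/-- The components `u^i = dx^i(u)` of a vector field in the chart `e`. -/
def vecCoord (u : (x : M) → TangentSpace 𝓘(ℝ, R4) x) (e : OpenPartialHomeomorph M R4) :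
    R4 → R4 :=
  fun z => mfderiv 𝓘(ℝ, R4) 𝓘(ℝ, R4) e (e.symm z) (u (e.symm z))

/-- The Ricci scalar of `g` as a function on `M`, computed at `x` in the preferred chart at `x`. -/
def LorentzMetric.ricciScalar (g : LorentzMetric M) (x : M) : ℝ :=
  scalar (g.coord (chartAt R4 x)) (chartAt R4 x x)

/-- The metric is projectively harmonic: `∇^h P_hijk = 0`. -/
def LorentzMetric.ProjectivelyHarmonic (g : LorentzMetric M) : Prop :=
  ∀ e : OpenPartialHomeomorph M R4, IsChart e → ∀ z ∈ e.target, ∀ i j k,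
    divProjCurv (g.coord e) i j k z = 0

/-- `u` is a smooth unit timelike vector field. -/
def LorentzMetric.UnitTimelike (g : LorentzMetric M)
    (u : (x : M) → TangentSpace 𝓘(ℝ, R4) x) : Prop :=
  ContMDiff 𝓘(ℝ, R4) 𝓘(ℝ, R4).tangent ∞ (fun x => (⟨x, u x⟩ : TangentBundle 𝓘(ℝ, R4) M)) ∧
    ∀ x, g.val x (u x) (u x) = -1

/-- The field equations of `F(R)` gravity,
`F_R R_ij - ½ F g_ij + (g_ij □ - ∇_i ∇_j) F_R = κ² T_ij`, with the perfect-fluid source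
`T_ij = p h_ij + ρ u_i u_j`, where `F_R = dF/dR`. -/
def LorentzMetric.FieldEquations (g : LorentzMetric M) (F : ℝ → ℝ) (κ : ℝ)
    (u : (x : M) → TangentSpace 𝓘(ℝ, R4) x) (p ρ : M → ℝ) : Prop :=
  ∀ e : OpenPartialHomeomorph M R4, IsChart e → ∀ z ∈ e.target, ∀ i j,
    deriv F (scalar (g.coord e) z) * ricci (g.coord e) i j z
      - 1 / 2 * F (scalar (g.coord e) z) * g.coord e z i j
      + (g.coord e z i j * box (g.coord e) (fun y => deriv F (scalar (g.coord e) y)) z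
        - hess (g.coord e) (fun y => deriv F (scalar (g.coord e) y)) i j z)
    = κ ^ 2 * (p (e.symm z) * proj (g.coord e) (vecCoord u e) i j z
        + ρ (e.symm z) * lower (g.coord e) (vecCoord u e) i z
          * lower (g.coord e) (vecCoord u e) j z)

/-- The spatial part `(z¹, z², z³)` of `z = (z⁰, z¹, z², z³)`. -/
def spatial (z : R4) : EuclideanSpace ℝ (Fin 3) := WithLp.toLp 2 fun α => z α.succ

/-- The chart `e` identifies its domain with a generalized Robertson–Walker spacetime
`(t₀, t₁) ×_s V`, that is, with the product of an open interval and a connected open set `V` of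
`ℝ³` carrying a Riemannian metric `γ`, with the warped product metric
`-dt² + s(t)² γ_αβ(y) dy^α dy^β`, in such a way that `u = ∂_t` and that the scale factor `s`
is the function `a`, that is `a = s ∘ t`. -/
def LorentzMetric.IsGRWChart (g : LorentzMetric M) (u : (x : M) → TangentSpace 𝓘(ℝ, R4) x)
    (a : M → ℝ) (e : OpenPartialHomeomorph M R4) : Prop :=
  IsChart e ∧
  ∃ (t₀ t₁ : ℝ) (V : Set (EuclideanSpace ℝ (Fin 3))) (s : ℝ → ℝ)
    (γ : EuclideanSpace ℝ (Fin 3) → Matrix (Fin 3) (Fin 3) ℝ),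
    IsOpen V ∧ IsConnected V ∧
    ContDiffOn ℝ ∞ s (Ioo t₀ t₁) ∧ (∀ t ∈ Ioo t₀ t₁, 0 < s t) ∧
    (∀ α β, ContDiffOn ℝ ∞ (fun y => γ y α β) V) ∧ (∀ y ∈ V, (γ y).PosDef) ∧
    e.target = {z | z 0 ∈ Ioo t₀ t₁ ∧ spatial z ∈ V} ∧
    ∀ z ∈ e.target,
      g.coord e z 0 0 = -1 ∧
      (∀ α : Fin 3, g.coord e z 0 α.succ = 0 ∧ g.coord e z α.succ 0 = 0) ∧
      (∀ α β : Fin 3, g.coord e z α.succ β.succ = s (z 0) ^ 2 * γ (spatial z) α β) ∧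
      vecCoord u e z = EuclideanSpace.single 0 1 ∧
      a (e.symm z) = s (z 0)

/-- The spacetime is (locally) a generalized Robertson–Walker spacetime with comoving velocity
`u` and scale factor `a`. -/
def LorentzMetric.IsGRW (g : LorentzMetric M) (u : (x : M) → TangentSpace 𝓘(ℝ, R4) x)
    (a : M → ℝ) : Prop :=
  ∀ x : M, ∃ e : OpenPartialHomeomorph M R4, x ∈ e.source ∧ g.IsGRWChart u a e

/-- The quantity `R F_R(R) - 2 F(R) + 4 κ² ρ`. -/
def LorentzMetric.fluidTerm (g : LorentzMetric M) (F : ℝ → ℝ) (κ : ℝ) (ρ : M → ℝ) (x : M) : ℝ :=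
  g.ricciScalar x * deriv F (g.ricciScalar x) - 2 * F (g.ricciScalar x) + 4 * κ ^ 2 * ρ x

/-- The derivative `u^k ∂_k a` of a function `a` along `u`, in the chart `e`. -/
def dotCoord (u : (x : M) → TangentSpace 𝓘(ℝ, R4) x) (a : M → ℝ)
    (e : OpenPartialHomeomorph M R4) (z : R4) : ℝ :=
  ∑ k, vecCoord u e z k * pd k (fun y => a (e.symm y)) z

end Spacetime

end

set_option linter.unusedSectionVars false

/-! Contracting the second Bianchi identity gives `∇^h P_hijk = (2/3)(∇_j R_ik - ∇_k R_ij)`, so a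
projectively harmonic metric is one whose Ricci tensor is Codazzi (`divProjCurv_eq`). Contracting
once more, the Ricci scalar is locally constant (`pd_scalar_eq_zero`), hence constant on the
connected manifold, say equal to `K`. Patching the values computed in different charts needs the
invariance of the Ricci scalar under coordinate changes (`scalar_comp`). With `R = K` the
derivatives of `F_R` disappear and the field equations become algebraic: `F_R(K) R_ij = (F(K)/2 + κ²
p) g_ij + κ² (p + ρ) u_i u_j`.

If `F_R(K) = 0`, then `p + ρ = 0`. Otherwise `R_ij = α g_ij + β u_i u_j` with `β` a nonzero constant
times `q = p + ρ`, and constancy of the trace `4α - β` gives `dα = dβ/4`. The contractions of the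
Codazzi equation with `u` and with the metric (`codazzi_fluid_algebra`) then force, with `θ` the
expansion, `∂_k q = (4/3) θ q u_k` and `q ∇_j u_i = q (θ/3) h_ji`. The first equation is linear in
`q`, so by Grönwall's inequality and connectedness `q` vanishes everywhere as soon as it vanishes at
one point. In the remaining case `q` has a constant sign and `∇_j u_i = (θ/3) h_ji`, which kills
shear, vorticity and acceleration.

The trace of the field equations identifies `R F_R - 2F + 4κ²ρ` with `3κ² q`. Thus `a⁴` is a
constant multiple of `1/q`, and the equation for `q` turns into `∂_k a = -(θ/3) a u_k`: the function
`a` varies only along `u`, and `θ/3` is its logarithmic derivative there.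

For the warped product, symmetry of `∇_j u_i` makes `u_i` a closed one-form, locally `-dt`. Flowing
along `u` from a transversal, with the flow time corrected so that it agrees with `t`, yields
coordinates with `u = ∂_t` and `u_i dx^i = -dt` (`exists_flowBox`, `exists_adapted_chart`). There
`g_00 = -1`, `g_0α = 0` and `∂_t g_αβ = 2(θ/3) g_αβ`, so `g_αβ / a²` does not depend on `t`. It is
positive definite because the orthogonal complement of a timelike vector is spacelike. The smooth
flow comes from the inverse function theorem on a space of continuous curves (`exists_smooth_flow`).
-/

namespace Spacetime

/-! ### Partial derivatives -/

section PartialDerivatives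

variable {U : Set R4} {f f' : R4 → ℝ} {z : R4}

theorem differentiableAt_of_smooth (hU : IsOpen U) (hf : ContDiffOn ℝ ∞ f U) (hz : z ∈ U) :
    DifferentiableAt ℝ f z :=
  (hf.contDiffAt (hU.mem_nhds hz)).differentiableAt (by simp)

theorem smooth_pd (hU : IsOpen U) (hf : ContDiffOn ℝ ∞ f U) (i : Fin 4) :
    ContDiffOn ℝ ∞ (pd i f) U := by
  have h : ContDiffOn ℝ ∞ (fderiv ℝ f) U := hf.fderiv_of_isOpen hU (by simp)
  exact h.clm_apply contDiffOn_const

theorem pd_congr (hU : IsOpen U) (h : EqOn f f' U) (hz : z ∈ U) (i : Fin 4) :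
    pd i f z = pd i f' z := by
  unfold pd
  rw [(h.eventuallyEq_of_mem (hU.mem_nhds hz)).fderiv_eq]

theorem pd_const (c : ℝ) (i : Fin 4) : pd i (fun _ => c) z = 0 := by
  simp [pd]

theorem pd_add (hf : DifferentiableAt ℝ f z) (hf' : DifferentiableAt ℝ f' z) (i : Fin 4) :
    pd i (fun y => f y + f' y) z = pd i f z + pd i f' z := by
  simp [pd, fderiv_fun_add hf hf']

theorem pd_sub (hf : DifferentiableAt ℝ f z) (hf' : DifferentiableAt ℝ f' z) (i : Fin 4) :
    pd i (fun y => f y - f' y) z = pd i f z - pd i f' z := by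
  simp [pd, fderiv_fun_sub hf hf']

theorem pd_mul (hf : DifferentiableAt ℝ f z) (hf' : DifferentiableAt ℝ f' z) (i : Fin 4) :
    pd i (fun y => f y * f' y) z = pd i f z * f' z + f z * pd i f' z := by
  simp [pd, fderiv_fun_mul hf hf']; ring

theorem pd_const_mul (hf : DifferentiableAt ℝ f z) (c : ℝ) (i : Fin 4) :
    pd i (fun y => c * f y) z = c * pd i f z := by
  simp [pd, fderiv_const_mul hf]

theorem pd_sum {ι : Type*} {s : Finset ι} {F : ι → R4 → ℝ}
    (hF : ∀ a ∈ s, DifferentiableAt ℝ (F a) z) (i : Fin 4) :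
    pd i (fun y => ∑ a ∈ s, F a y) z = ∑ a ∈ s, pd i (F a) z := by
  simp [pd, fderiv_fun_sum hF]

theorem pd_comm (hU : IsOpen U) (hf : ContDiffOn ℝ ∞ f U) (hz : z ∈ U) (i j : Fin 4) :
    pd i (pd j f) z = pd j (pd i f) z := by
  have hc : ContDiffAt ℝ ∞ f z := hf.contDiffAt (hU.mem_nhds hz)
  have hd : DifferentiableAt ℝ (fderiv ℝ f) z :=
    (hc.fderiv_right (m := ∞) (by simp)).differentiableAt (by simp)
  have key : ∀ a b : Fin 4, pd a (pd b f) z =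
      fderiv ℝ (fderiv ℝ f) z (EuclideanSpace.single a 1) (EuclideanSpace.single b 1) := by
    intro a b
    have : pd b f = fun y => fderiv ℝ f y (EuclideanSpace.single b 1) := rfl
    rw [this, pd, fderiv_clm_apply hd (by fun_prop)]
    simp
  rw [key, key]
  have := hc.isSymmSndFDerivAt (by
    simpa using WithTop.coe_le_coe.2 (le_top : (2 : ℕ∞) ≤ ⊤))
  exact this _ _

/-- The derivative in terms of partial derivatives. -/
theorem fderiv_apply_eq_sum (f : R4 → ℝ) (z w : R4) :
    fderiv ℝ f z w = ∑ i, w i * pd i f z := by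
  have hw : w = ∑ i, w i • EuclideanSpace.single i (1 : ℝ) := by
    ext k
    simp [Finset.sum_apply, Pi.single_apply]
  conv_lhs => rw [hw]
  simp [pd]

end PartialDerivatives

/-! ### Matrix fields -/

section MatrixFields

variable {U : Set R4} {A B : Comp} {z : R4}

/-- A matrix field with smooth entries. -/
def SmoothComp (U : Set R4) (A : Comp) : Prop :=
  ∀ i j, ContDiffOn ℝ ∞ (fun z => A z i j) U

/-- The entrywise partial derivative of a matrix field. -/
noncomputable def mpd (m : Fin 4) (A : Comp) : Comp :=
  fun z => Matrix.of fun i j => pd m (fun y => A y i j) z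

theorem SmoothComp.diff (hA : SmoothComp U A) (hU : IsOpen U) (hz : z ∈ U) (i j : Fin 4) :
    DifferentiableAt ℝ (fun y => A y i j) z :=
  differentiableAt_of_smooth hU (hA i j) hz

theorem SmoothComp.add (hA : SmoothComp U A) (hB : SmoothComp U B) :
    SmoothComp U (fun z => A z + B z) := fun i j => (hA i j).add (hB i j)

theorem SmoothComp.sub (hA : SmoothComp U A) (hB : SmoothComp U B) :
    SmoothComp U (fun z => A z - B z) := fun i j => (hA i j).sub (hB i j)

theorem SmoothComp.mul (hA : SmoothComp U A) (hB : SmoothComp U B) :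
    SmoothComp U (fun z => A z * B z) := fun i j => by
  simp only [Matrix.mul_apply]
  exact ContDiffOn.sum fun l _ => (hA i l).mul (hB l j)

theorem SmoothComp.transpose (hA : SmoothComp U A) : SmoothComp U (fun z => (A z)ᵀ) :=
  fun i j => hA j i

theorem SmoothComp.smul {f : R4 → ℝ} (hf : ContDiffOn ℝ ∞ f U) (hA : SmoothComp U A) :
    SmoothComp U (fun z => f z • A z) := fun i j => hf.mul (hA i j)

theorem SmoothComp.sum {ι : Type*} {s : Finset ι} {F : ι → Comp}
    (hF : ∀ a ∈ s, SmoothComp U (F a)) : SmoothComp U (fun z => ∑ a ∈ s, F a z) := fun i j => by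
  simp only [Matrix.sum_apply]
  exact ContDiffOn.sum fun l hl => hF l hl i j

theorem SmoothComp.mpd (hA : SmoothComp U A) (hU : IsOpen U) (m : Fin 4) :
    SmoothComp U (mpd m A) := fun i j => smooth_pd hU (hA i j) m

theorem SmoothComp.det (hA : SmoothComp U A) : ContDiffOn ℝ ∞ (fun z => (A z).det) U := by
  simp only [Matrix.det_apply']
  exact ContDiffOn.sum fun σ _ => contDiffOn_const.mul (contDiffOn_prod fun i _ => hA _ _)

/-- Cramer's rule: the inverse is the adjugate divided by the determinant, and each entry of the
adjugate is the determinant of the matrix with one row replaced by a basis vector. -/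
theorem SmoothComp.inv (hA : SmoothComp U A) (h : ∀ z ∈ U, IsUnit (A z).det) :
    SmoothComp U (fun z => (A z)⁻¹) := fun i j => by
  simp only [Matrix.inv_def, Matrix.smul_apply, Ring.inverse_eq_inv', smul_eq_mul,
    Matrix.adjugate_apply]
  refine (hA.det.inv fun z hz => (h z hz).ne_zero).mul ?_
  refine SmoothComp.det (A := fun z => (A z).updateRow j (Pi.single i 1)) fun k l => ?_
  by_cases hk : k = j
  · subst hk
    simp only [Matrix.updateRow_self]
    exact contDiffOn_const
  · simp only [Matrix.updateRow_ne hk]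
    exact hA k l

theorem mpd_congr (hU : IsOpen U) (h : EqOn A B U) (hz : z ∈ U) (m : Fin 4) :
    mpd m A z = mpd m B z := by
  ext i j
  exact pd_congr hU (fun y hy => by simp only [h hy]) hz m

theorem mpd_add (hU : IsOpen U) (hA : SmoothComp U A) (hB : SmoothComp U B) (hz : z ∈ U)
    (m : Fin 4) : mpd m (fun y => A y + B y) z = mpd m A z + mpd m B z := by
  ext i j
  exact pd_add (hA.diff hU hz i j) (hB.diff hU hz i j) m

theorem mpd_sub (hU : IsOpen U) (hA : SmoothComp U A) (hB : SmoothComp U B) (hz : z ∈ U)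
    (m : Fin 4) : mpd m (fun y => A y - B y) z = mpd m A z - mpd m B z := by
  ext i j
  exact pd_sub (hA.diff hU hz i j) (hB.diff hU hz i j) m

theorem mpd_mul (hU : IsOpen U) (hA : SmoothComp U A) (hB : SmoothComp U B) (hz : z ∈ U)
    (m : Fin 4) : mpd m (fun y => A y * B y) z = mpd m A z * B z + A z * mpd m B z := by
  ext i j
  simp only [mpd, Matrix.of_apply, Matrix.mul_apply, Matrix.add_apply]
  rw [pd_sum (F := fun l y => A y i l * B y l j)
    fun l _ => (hA.diff hU hz i l).mul (hB.diff hU hz l j), ← Finset.sum_add_distrib]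
  exact Finset.sum_congr rfl fun l _ => pd_mul (hA.diff hU hz i l) (hB.diff hU hz l j) m

theorem mpd_smul {f : R4 → ℝ} (hU : IsOpen U) (hf : ContDiffOn ℝ ∞ f U) (hA : SmoothComp U A)
    (hz : z ∈ U) (m : Fin 4) :
    mpd m (fun y => f y • A y) z = pd m f z • A z + f z • mpd m A z := by
  ext i j
  exact pd_mul (differentiableAt_of_smooth hU hf hz) (hA.diff hU hz i j) m

theorem mpd_sum {ι : Type*} {s : Finset ι} {F : ι → Comp} (hU : IsOpen U)
    (hF : ∀ a ∈ s, SmoothComp U (F a)) (hz : z ∈ U) (m : Fin 4) :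
    mpd m (fun y => ∑ a ∈ s, F a y) z = ∑ a ∈ s, mpd m (F a) z := by
  ext i j
  simp only [mpd, Matrix.of_apply, Matrix.sum_apply]
  exact pd_sum (fun a ha => (hF a ha).diff hU hz i j) m

theorem mpd_transpose (A : Comp) (z : R4) (m : Fin 4) :
    mpd m (fun y => (A y)ᵀ) z = (mpd m A z)ᵀ := rfl

theorem mpd_const (M : Matrix (Fin 4) (Fin 4) ℝ) (z : R4) (m : Fin 4) :
    mpd m (fun _ => M) z = 0 := by
  ext i j
  exact pd_const _ m

theorem mpd_comm (hU : IsOpen U) (hA : SmoothComp U A) (hz : z ∈ U) (m n : Fin 4) :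
    mpd m (mpd n A) z = mpd n (mpd m A) z := by
  ext i j
  exact pd_comm hU (hA i j) hz m n

theorem mpd_inv (hU : IsOpen U) (hA : SmoothComp U A) (h : ∀ z ∈ U, IsUnit (A z).det)
    (hz : z ∈ U) (m : Fin 4) :
    mpd m (fun y => (A y)⁻¹) z = -((A z)⁻¹ * mpd m A z * (A z)⁻¹) := by
  have h1 := mpd_mul hU hA (hA.inv h) hz m
  have h2 : mpd m (fun y => A y * (A y)⁻¹) z = mpd m (fun _ => 1) z :=
    mpd_congr hU (fun y hy => Matrix.mul_nonsing_inv _ (h y hy)) hz m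
  rw [h2, mpd_const] at h1
  have h3 := congrArg ((A z)⁻¹ * ·) h1
  simp only [mul_zero, mul_add, ← mul_assoc, Matrix.nonsing_inv_mul _ (h z hz), one_mul] at h3
  exact (neg_eq_of_add_eq_zero_right h3.symm).symm

end MatrixFields

/-! ### The Levi-Civita connection -/

/-- A smooth field of nondegenerate symmetric matrices on an open set. -/
structure IsMetricOn (g : Comp) (U : Set R4) : Prop where
  isOpen : IsOpen U
  smooth : SmoothComp U g
  symm : ∀ z ∈ U, (g z)ᵀ = g z
  unit : ∀ z ∈ U, IsUnit (g z).det

/-- The connection matrices `(Γ_j)^l_k`. -/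
noncomputable def conn (g : Comp) (j : Fin 4) : Comp :=
  fun z => Matrix.of fun l k => christoffel g l j k z

/-- The curvature matrices `(R_jk)^l_i` of a family of connection matrices. -/
noncomputable def curvOf (A : Fin 4 → Comp) (j k : Fin 4) : Comp :=
  fun z => mpd j (A k) z - mpd k (A j) z + (A j z * A k z - A k z * A j z)

/-- With the two form indices kept as labels and the other two as matrix indices, curvature
identities become identities in the noncommutative ring of matrices. -/
theorem riemannUp_eq (g : Comp) (l i j k : Fin 4) (z : R4) :
    riemannUp g l i j k z = curvOf (conn g) j k z l i := by
  simp only [riemannUp, curvOf, conn, mpd, Matrix.add_apply, Matrix.sub_apply, Matrix.mul_apply,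
    Matrix.of_apply, Finset.sum_sub_distrib]

theorem curvOf_antisymm (A : Fin 4 → Comp) (j k : Fin 4) (z : R4) :
    curvOf A j k z = -curvOf A k j z := by
  simp only [curvOf]; abel

theorem SmoothComp.curvOf {A : Fin 4 → Comp} {U : Set R4} (hU : IsOpen U)
    (hA : ∀ j, SmoothComp U (A j)) (j k : Fin 4) : SmoothComp U (curvOf A j k) :=
  (((hA k).mpd hU j).sub ((hA j).mpd hU k)).add
    (((hA j).mul (hA k)).sub ((hA k).mul (hA j)))

/-- The Bianchi identity before the lower indices are covariantly differentiated. -/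
theorem bianchi_curvOf {A : Fin 4 → Comp} {U : Set R4} {z : R4} (hU : IsOpen U)
    (hA : ∀ j, SmoothComp U (A j)) (hz : z ∈ U) (m j k : Fin 4) :
    (mpd m (curvOf A j k) z + (A m z * curvOf A j k z - curvOf A j k z * A m z)) +
    (mpd j (curvOf A k m) z + (A j z * curvOf A k m z - curvOf A k m z * A j z)) +
    (mpd k (curvOf A m j) z + (A k z * curvOf A m j z - curvOf A m j z * A k z)) = 0 := by
  have key : ∀ a b c : Fin 4, mpd a (curvOf A b c) z =
      mpd a (mpd b (A c)) z - mpd a (mpd c (A b)) z +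
      ((mpd a (A b) z * A c z + A b z * mpd a (A c) z) -
        (mpd a (A c) z * A b z + A c z * mpd a (A b) z)) := by
    intro a b c
    have e1 := mpd_add hU (((hA c).mpd hU b).sub ((hA b).mpd hU c))
      (((hA b).mul (hA c)).sub ((hA c).mul (hA b))) hz a
    rw [mpd_sub hU ((hA c).mpd hU b) ((hA b).mpd hU c) hz,
      mpd_sub hU ((hA b).mul (hA c)) ((hA c).mul (hA b)) hz,
      mpd_mul hU (hA b) (hA c) hz, mpd_mul hU (hA c) (hA b) hz] at e1
    exact e1
  -- In the cyclic sum the second derivatives cancel by symmetry of mixed partials. The remaining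
  -- terms cancel identically in a noncommutative ring, as in the Jacobi identity.
  rw [key, key, key, mpd_comm hU (hA k) hz m j, mpd_comm hU (hA j) hz m k,
    mpd_comm hU (hA m) hz j k]
  simp only [curvOf]
  noncomm_ring

/-! ### Metric compatibility, uniqueness of the connection, antisymmetry of the curvature -/

namespace IsMetricOn

variable {g : Comp} {U : Set R4} {z : R4}

theorem apply_symm (hg : IsMetricOn g U) (hz : z ∈ U) (i j : Fin 4) : g z i j = g z j i :=
  congrFun (congrFun (hg.symm z hz) j) i

theorem inv_symm (hg : IsMetricOn g U) (hz : z ∈ U) : ((g z)⁻¹)ᵀ = (g z)⁻¹ := by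
  rw [Matrix.transpose_nonsing_inv, hg.symm z hz]

theorem inv_apply_symm (hg : IsMetricOn g U) (hz : z ∈ U) (i j : Fin 4) :
    (g z)⁻¹ i j = (g z)⁻¹ j i :=
  congrFun (congrFun (hg.inv_symm hz) j) i

theorem smooth_inv (hg : IsMetricOn g U) : SmoothComp U (fun z => (g z)⁻¹) :=
  hg.smooth.inv hg.unit

theorem smooth_conn (hg : IsMetricOn g U) (j : Fin 4) : SmoothComp U (conn g j) := fun l k => by
  simp only [conn, Matrix.of_apply, christoffel]
  refine contDiffOn_const.mul (ContDiffOn.sum fun m _ => (hg.smooth_inv l m).mul ?_)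
  exact ((smooth_pd hg.isOpen (hg.smooth m k) j).add (smooth_pd hg.isOpen (hg.smooth m j) k)).sub
    (smooth_pd hg.isOpen (hg.smooth j k) m)

theorem pd_symm (hg : IsMetricOn g U) (hz : z ∈ U) (m i j : Fin 4) :
    pd m (fun y => g y i j) z = pd m (fun y => g y j i) z :=
  pd_congr hg.isOpen (fun _ hy => hg.apply_symm hy i j) hz m

theorem christoffel_symm (hg : IsMetricOn g U) (hz : z ∈ U) (l j k : Fin 4) :
    christoffel g l j k z = christoffel g l k j z := by
  simp only [christoffel]
  congr 1
  refine Finset.sum_congr rfl fun m _ => ?_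
  rw [hg.pd_symm hz m j k]
  ring

/-- Christoffel symbols of the first kind. -/
theorem mul_conn_apply (hg : IsMetricOn g U) (hz : z ∈ U) (m h k : Fin 4) :
    (g z * conn g m z) h k = 1 / 2 * (pd m (fun y => g y h k) z + pd k (fun y => g y h m) z
      - pd h (fun y => g y m k) z) := by
  have : conn g m z = (g z)⁻¹ * Matrix.of fun h k => 1 / 2 * (pd m (fun y => g y h k) z +
      pd k (fun y => g y h m) z - pd h (fun y => g y m k) z) := by
    ext l k
    simp only [conn, christoffel, Matrix.of_apply, Matrix.mul_apply, Finset.mul_sum]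
    exact Finset.sum_congr rfl fun _ _ => by ring
  rw [this, Matrix.mul_nonsing_inv_cancel_left _ _ (hg.unit z hz), Matrix.of_apply]

/-- The connection is metric. -/
theorem mpd_metric (hg : IsMetricOn g U) (hz : z ∈ U) (m : Fin 4) :
    mpd m g z = (conn g m z)ᵀ * g z + g z * conn g m z := by
  have h : (conn g m z)ᵀ * g z = (g z * conn g m z)ᵀ := by
    rw [Matrix.transpose_mul, hg.symm z hz]
  ext h' k
  rw [h, Matrix.add_apply, Matrix.transpose_apply, hg.mul_conn_apply hz, hg.mul_conn_apply hz,
    hg.pd_symm hz m k h', hg.pd_symm hz h' k m, hg.pd_symm hz k h' m]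
  simp only [mpd, Matrix.of_apply]
  ring

/-- A torsion-free metric connection is the Levi-Civita connection. -/
theorem conn_unique (hg : IsMetricOn g U) (hz : z ∈ U)
    {C : Fin 4 → Matrix (Fin 4) (Fin 4) ℝ} (hs : ∀ l j k, C j l k = C k l j)
    (hm : ∀ m, mpd m g z = (C m)ᵀ * g z + g z * C m) (j : Fin 4) : conn g j z = C j := by
  suffices h : g z * conn g j z = g z * C j by
    have := congrArg ((g z)⁻¹ * ·) h
    simpa only [← mul_assoc, Matrix.nonsing_inv_mul _ (hg.unit z hz), one_mul] using this
  -- Koszul's argument: `hs'` is torsion-freeness with the index lowered and `hm'` is metricity.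
  -- Inserted in the formula for the Christoffel symbols of the first kind, the six terms collapse
  -- to a single one.
  have hs' : ∀ h j k, (g z * C j) h k = (g z * C k) h j := fun h j k => by
    simp only [Matrix.mul_apply, hs _ j k]
  have hm' : ∀ m h k, pd m (fun y => g y h k) z = (g z * C m) k h + (g z * C m) h k := by
    intro m h k
    have e := congrFun (congrFun (hm m) h) k
    have h' : (C m)ᵀ * g z = (g z * C m)ᵀ := by rw [Matrix.transpose_mul, hg.symm z hz]
    rw [h'] at e
    exact e
  ext h k
  rw [hg.mul_conn_apply hz, hm', hm', hm', hs' k j h, hs' h k j, hs' k h j, hs' j h k]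
  rw [hs' j k h, hs' k j h]
  ring

/-- `R_hijk` is antisymmetric in the first pair of indices. -/
theorem curv_antisymm (hg : IsMetricOn g U) (hz : z ∈ U) (j k : Fin 4) :
    (curvOf (conn g) j k z)ᵀ * g z + g z * curvOf (conn g) j k z = 0 := by
  -- Two derivatives of `g`, each expressed through the connection. In the commutator, which is
  -- zero, the terms mixing two connection matrices on opposite sides of `g` cancel and the
  -- curvature remains.
  have key : ∀ a b : Fin 4, mpd a (mpd b g) z =
      ((mpd a (conn g b) z)ᵀ * g z + (conn g b z)ᵀ * ((conn g a z)ᵀ * g z + g z * conn g a z)) +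
      (((conn g a z)ᵀ * g z + g z * conn g a z) * conn g b z + g z * mpd a (conn g b) z) := by
    intro a b
    have hb := hg.smooth_conn b
    rw [mpd_congr hg.isOpen (fun y hy => hg.mpd_metric hy b) hz,
      mpd_add hg.isOpen (hb.transpose.mul hg.smooth) (hg.smooth.mul hb) hz,
      mpd_mul hg.isOpen hb.transpose hg.smooth hz, mpd_mul hg.isOpen hg.smooth hb hz,
      mpd_transpose, hg.mpd_metric hz a]
  have h := mpd_comm hg.isOpen hg.smooth hz j k
  rw [key, key, ← sub_eq_zero] at h
  rw [← h]
  simp only [curvOf, Matrix.transpose_add, Matrix.transpose_sub, Matrix.transpose_mul]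
  noncomm_ring

end IsMetricOn

/-- The covariant derivative `∇_m R^h_ijk` of the curvature, as a matrix with indices `h`, `i`. -/
noncomputable def covCurv (g : Comp) (m j k : Fin 4) : Comp := fun z =>
  mpd m (curvOf (conn g) j k) z +
    (conn g m z * curvOf (conn g) j k z - curvOf (conn g) j k z * conn g m z) -
    ∑ l, (christoffel g l m j z • curvOf (conn g) l k z +
      christoffel g l m k z • curvOf (conn g) j l z)

/-- The covariant derivative `∇_j R_ik` of the Ricci tensor. -/
noncomputable def covRicci (g : Comp) (j i k : Fin 4) (z : R4) : ℝ :=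
  pd j (ricci g i k) z - ∑ l, (christoffel g l j i z * ricci g l k z +
    christoffel g l j k z * ricci g i l z)

theorem ricci_eq (g : Comp) (i k : Fin 4) (z : R4) :
    ricci g i k z = ∑ l, curvOf (conn g) l k z l i := by
  simp only [ricci, riemannUp_eq]

theorem ricci_fun_eq (g : Comp) (i k : Fin 4) :
    ricci g i k = fun z => ∑ l, curvOf (conn g) l k z l i :=
  funext fun z => ricci_eq g i k z

theorem riemann_eq (g : Comp) (h i j k : Fin 4) (z : R4) :
    riemann g h i j k z = (g z * curvOf (conn g) j k z) h i := by
  simp only [riemann, riemannUp_eq, Matrix.mul_apply]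

theorem covCurv_antisymm (g : Comp) (m j k : Fin 4) (z : R4) :
    covCurv g m j k z = -covCurv g m k j z := by
  have h : curvOf (conn g) j k = fun z => -curvOf (conn g) k j z :=
    funext fun z => curvOf_antisymm _ j k z
  have hm : mpd m (curvOf (conn g) j k) z = -mpd m (curvOf (conn g) k j) z := by
    rw [h]
    ext a b
    simp [mpd, pd, Matrix.neg_apply]
  have hl : ∀ l, curvOf (conn g) j l z = -curvOf (conn g) l j z := fun l => curvOf_antisymm _ j l z
  have hl' : ∀ l, curvOf (conn g) l k z = -curvOf (conn g) k l z :=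
    fun l => curvOf_antisymm _ l k z
  simp only [covCurv, hm, hl, hl', smul_neg, Finset.sum_add_distrib, Finset.sum_neg_distrib]
  noncomm_ring

/-! ### Bianchi identities, Codazzi Ricci tensors and the divergence of the projective curvature -/

namespace IsMetricOn

variable {g : Comp} {U : Set R4} {z : R4}

theorem smooth_curv (hg : IsMetricOn g U) (j k : Fin 4) : SmoothComp U (curvOf (conn g) j k) :=
  SmoothComp.curvOf hg.isOpen hg.smooth_conn j k

theorem smooth_ricci (hg : IsMetricOn g U) (i k : Fin 4) : ContDiffOn ℝ ∞ (ricci g i k) U := by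
  rw [ricci_fun_eq]
  exact ContDiffOn.sum fun l _ => hg.smooth_curv l k l i

theorem smooth_scalar (hg : IsMetricOn g U) : ContDiffOn ℝ ∞ (scalar g) U := by
  unfold scalar
  exact ContDiffOn.sum fun i _ => ContDiffOn.sum fun k _ =>
    (hg.smooth_inv i k).mul (hg.smooth_ricci i k)

/-- The second Bianchi identity. -/
theorem bianchi (hg : IsMetricOn g U) (hz : z ∈ U) (m j k : Fin 4) :
    covCurv g m j k z + covCurv g j k m z + covCurv g k m j z = 0 := by
  have h := bianchi_curvOf hg.isOpen hg.smooth_conn hz m j k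
  have hs : ∀ l a b, christoffel g l a b z = christoffel g l b a z :=
    fun l a b => hg.christoffel_symm hz l a b
  -- The Christoffel corrections for the two form indices cancel in the cyclic sum, since `Γ` is
  -- symmetric and the curvature antisymmetric. What is left is `bianchi_curvOf`.
  have hsum : ∑ l, (christoffel g l m j z • curvOf (conn g) l k z +
      christoffel g l m k z • curvOf (conn g) j l z) +
      ∑ l, (christoffel g l j k z • curvOf (conn g) l m z +
      christoffel g l j m z • curvOf (conn g) k l z) +
      ∑ l, (christoffel g l k m z • curvOf (conn g) l j z +
      christoffel g l k j z • curvOf (conn g) m l z) = 0 := by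
    rw [← Finset.sum_add_distrib, ← Finset.sum_add_distrib]
    refine Finset.sum_eq_zero fun l _ => ?_
    rw [hs l j m, hs l k m, hs l k j, curvOf_antisymm _ l k, curvOf_antisymm _ j l,
      curvOf_antisymm _ l m]
    simp only [smul_neg]
    abel
  have h0 := congrArg₂ (· - ·) h hsum
  rw [sub_zero] at h0
  refine Eq.trans ?_ h0
  simp only [covCurv]
  abel

/-- `∇_m R_hijk` is antisymmetric in `h` and `i`. -/
theorem covCurv_mul_inv_antisymm (hg : IsMetricOn g U) (hz : z ∈ U) (m j k : Fin 4) :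
    covCurv g m j k z * (g z)⁻¹ = -(covCurv g m j k z * (g z)⁻¹)ᵀ := by
  have hA : ∀ a b, (curvOf (conn g) a b z)ᵀ * g z = -(g z * curvOf (conn g) a b z) :=
    fun a b => eq_neg_of_add_eq_zero_left (hg.curv_antisymm hz a b)
  -- The derivative of the antisymmetry relation for the curvature. Because the metric is parallel,
  -- it becomes the same relation for the covariant derivative (`hlow`). Multiplying by the inverse
  -- metric on both sides then raises the index.
  have hd : (mpd m (curvOf (conn g) j k) z)ᵀ * g z +
      (curvOf (conn g) j k z)ᵀ * ((conn g m z)ᵀ * g z + g z * conn g m z) +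
      (((conn g m z)ᵀ * g z + g z * conn g m z) * curvOf (conn g) j k z +
        g z * mpd m (curvOf (conn g) j k) z) = 0 := by
    have hc := hg.smooth_curv j k
    have := mpd_congr hg.isOpen (B := fun _ => 0) (fun y hy => hg.curv_antisymm hy j k) hz m
    rw [mpd_add hg.isOpen (hc.transpose.mul hg.smooth) (hg.smooth.mul hc) hz,
      mpd_mul hg.isOpen hc.transpose hg.smooth hz, mpd_mul hg.isOpen hg.smooth hc hz,
      mpd_transpose, hg.mpd_metric hz m, mpd_const] at this
    exact this
  have hlow : (covCurv g m j k z)ᵀ * g z = -(g z * covCurv g m j k z) := by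
    have hsum : (∑ l, (christoffel g l m j z • curvOf (conn g) l k z +
        christoffel g l m k z • curvOf (conn g) j l z))ᵀ * g z =
        -(g z * ∑ l, (christoffel g l m j z • curvOf (conn g) l k z +
        christoffel g l m k z • curvOf (conn g) j l z)) := by
      simp only [Matrix.transpose_sum, Matrix.transpose_add, Matrix.transpose_smul,
        Finset.sum_mul, Finset.mul_sum, add_mul, mul_add, smul_mul_assoc, mul_smul_comm, hA,
        ← Finset.sum_neg_distrib, smul_neg, neg_add]
    rw [← sub_eq_zero, sub_neg_eq_add]
    simp only [covCurv, Matrix.transpose_sub, Matrix.transpose_add, Matrix.transpose_mul]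
    rw [sub_mul, hsum, ← hd]
    noncomm_ring
    have e2 : (conn g m z)ᵀ * ((curvOf (conn g) j k z)ᵀ * g z) =
      -((conn g m z)ᵀ * (g z * curvOf (conn g) j k z)) := by rw [hA, mul_neg]
    have e3 : (curvOf (conn g) j k z)ᵀ * (g z * conn g m z) =
      -(g z * (curvOf (conn g) j k z * conn g m z)) := by
        rw [← mul_assoc, hA, neg_mul, mul_assoc]
    rw [e2, e3]
    abel
  have hu := hg.unit z hz
  rw [Matrix.transpose_mul, hg.inv_symm hz]
  have h1 : (g z)⁻¹ * ((covCurv g m j k z)ᵀ * g z) * (g z)⁻¹ =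
      (g z)⁻¹ * -(g z * covCurv g m j k z) * (g z)⁻¹ := by rw [hlow]
  rw [← mul_assoc, mul_assoc _ (g z), Matrix.mul_nonsing_inv _ hu, mul_one, mul_neg,
    ← mul_assoc, Matrix.nonsing_inv_mul _ hu, one_mul, neg_mul] at h1
  rw [h1, neg_neg]

theorem pd_ricci (hg : IsMetricOn g U) (hz : z ∈ U) (j i k : Fin 4) :
    pd j (ricci g i k) z = ∑ l, mpd j (curvOf (conn g) l k) z l i := by
  rw [ricci_fun_eq, pd_sum fun l _ => (hg.smooth_curv l k).diff hg.isOpen hz l i]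
  rfl

/-- Covariant differentiation commutes with contraction: the corrections for the contracted upper
and lower index cancel after renaming the summation variables (`e1`). -/
theorem sum_covCurv (hg : IsMetricOn g U) (hz : z ∈ U) (j i k : Fin 4) :
    ∑ m, covCurv g j m k z m i = covRicci g j i k z := by
  simp only [covRicci, hg.pd_ricci hz, ricci_eq, covCurv, Matrix.sub_apply, Matrix.add_apply,
    Matrix.sum_apply, Matrix.smul_apply, smul_eq_mul, Matrix.mul_apply, conn, Matrix.of_apply,
    Finset.sum_sub_distrib, Finset.sum_add_distrib, Finset.mul_sum]
  have e1 : ∑ m, ∑ l, christoffel g m j l z * curvOf (conn g) m k z l i =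
    ∑ m, ∑ l, christoffel g l j m z * curvOf (conn g) l k z m i := Finset.sum_comm
  have e2 : ∑ m, ∑ l, curvOf (conn g) m k z m l * christoffel g l j i z =
    ∑ l, ∑ m, christoffel g l j i z * curvOf (conn g) m k z m l := by
    rw [Finset.sum_comm]
    simp only [mul_comm]
  have e3 : ∑ m, ∑ l, christoffel g l j k z * curvOf (conn g) m l z m i =
    ∑ l, ∑ m, christoffel g l j k z * curvOf (conn g) m l z m i := Finset.sum_comm
  rw [e1, e2, e3]
  ring

/-- The contracted Bianchi identity `∇_h R^h_ijk = ∇_j R_ik - ∇_k R_ij`. -/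
theorem div_curv (hg : IsMetricOn g U) (hz : z ∈ U) (i j k : Fin 4) :
    ∑ m, covCurv g m j k z m i = covRicci g j i k z - covRicci g k i j z := by
  rw [← hg.sum_covCurv hz, ← hg.sum_covCurv hz, ← Finset.sum_sub_distrib]
  refine Finset.sum_congr rfl fun m _ => ?_
  have h := congrFun (congrFun (hg.bianchi hz m j k) m) i
  rw [covCurv_antisymm g j k m] at h
  simp only [Matrix.add_apply, Matrix.neg_apply, Matrix.zero_apply] at h
  linarith

/-- The covariant derivative of the lowered curvature. -/
theorem covDeriv4_riemann (hg : IsMetricOn g U) (hz : z ∈ U) (m h i j k : Fin 4) :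
    covDeriv4 g (riemann g) m h i j k z = (g z * covCurv g m j k z) h i := by
  have e1 : pd m (riemann g h i j k) z = mpd m (fun y => g y * curvOf (conn g) j k y) z h i := by
    have : riemann g h i j k = fun y => (g y * curvOf (conn g) j k y) h i :=
      funext fun y => riemann_eq g h i j k y
    rw [this]
    rfl
  have e2 : mpd m (fun y => g y * curvOf (conn g) j k y) z =
      (conn g m z)ᵀ * (g z * curvOf (conn g) j k z) + (g z * curvOf (conn g) j k z) * conn g m z +
      g z * (mpd m (curvOf (conn g) j k) z +
        (conn g m z * curvOf (conn g) j k z - curvOf (conn g) j k z * conn g m z)) := by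
    rw [mpd_mul hg.isOpen hg.smooth (hg.smooth_curv j k) hz, hg.mpd_metric hz]
    noncomm_ring
  rw [covDeriv4, e1, e2, covCurv, mul_sub, Matrix.sub_apply, Matrix.add_apply, Matrix.add_apply,
    Finset.mul_sum, Matrix.sum_apply, Matrix.mul_apply (M := (conn g m z)ᵀ),
    Matrix.mul_apply (N := conn g m z)]
  simp only [riemann_eq, mul_add, Matrix.mul_smul, Matrix.add_apply, Matrix.smul_apply,
    smul_eq_mul, Finset.sum_add_distrib, Matrix.transpose_apply, conn, Matrix.of_apply,
    mul_comm _ (christoffel g _ m i z)]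
  ring

theorem pd_metric (hg : IsMetricOn g U) (hz : z ∈ U) (m h k : Fin 4) :
    pd m (fun y => g y h k) z =
      ∑ l, (christoffel g l m h z * g z l k + christoffel g l m k z * g z h l) := by
  have h' := congrFun (congrFun (hg.mpd_metric hz m) h) k
  simp only [Matrix.add_apply, Matrix.mul_apply, Matrix.transpose_apply, conn,
    Matrix.of_apply, mpd] at h'
  rw [h', Finset.sum_add_distrib]
  simp only [mul_comm]

/-- The divergence of the projective curvature tensor in terms of the Ricci tensor. -/
theorem divProjCurv_eq (hg : IsMetricOn g U) (hz : z ∈ U) (i j k : Fin 4) :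
    divProjCurv g i j k z = 2 / 3 * (covRicci g j i k z - covRicci g k i j z) := by
  -- Since the metric is parallel, `∇_m` passes through the factors `g_hk` and `g_jh` and
  -- differentiates only the curvature and the Ricci tensor.
  have hc : ∀ m h, covDeriv4 g (projCurv g) m h i j k z = (g z * covCurv g m j k z) h i +
      (covRicci g m i j z * g z h k - covRicci g m i k z * g z h j) / 3 := by
    intro m h
    rw [← hg.covDeriv4_riemann hz]
    have hR : ∀ a b, DifferentiableAt ℝ (ricci g a b) z :=
      fun a b => differentiableAt_of_smooth hg.isOpen (hg.smooth_ricci a b) hz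
    have hG : ∀ a b, DifferentiableAt ℝ (fun y => g y a b) z :=
      fun a b => hg.smooth.diff hg.isOpen hz a b
    have hRm : DifferentiableAt ℝ (riemann g h i j k) z := by
      have : riemann g h i j k = fun y => (g y * curvOf (conn g) j k y) h i :=
        funext fun y => riemann_eq g h i j k y
      rw [this]
      exact (hg.smooth.mul (hg.smooth_curv j k)).diff hg.isOpen hz h i
    have e : pd m (projCurv g h i j k) z = pd m (riemann g h i j k) z +
        1 / 3 * ((pd m (ricci g i j) z * g z h k + ricci g i j z * pd m (fun y => g y h k) z) -
          (pd m (ricci g i k) z * g z j h + ricci g i k z * pd m (fun y => g y j h) z)) := by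
      have : projCurv g h i j k = fun y => riemann g h i j k y +
          1 / 3 * (ricci g i j y * g y h k - ricci g i k y * g y j h) := by
        funext y; simp only [projCurv]; ring
      rw [this, pd_add hRm ((((hR i j).fun_mul (hG h k)).fun_sub ((hR i k).fun_mul (hG j h))).const_mul _),
        pd_const_mul (((hR i j).fun_mul (hG h k)).fun_sub ((hR i k).fun_mul (hG j h))),
        pd_sub ((hR i j).fun_mul (hG h k)) ((hR i k).fun_mul (hG j h)), pd_mul (hR i j) (hG h k),
        pd_mul (hR i k) (hG j h)]
    simp only [covDeriv4, covRicci]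
    rw [e, hg.pd_metric hz, hg.pd_metric hz, hg.apply_symm hz h j]
    simp only [projCurv, Fin.sum_univ_four]
    rw [hg.apply_symm hz 0 h, hg.apply_symm hz 1 h, hg.apply_symm hz 2 h, hg.apply_symm hz 3 h]
    ring
  have hgi : ∀ m b, ∑ h, (g z)⁻¹ m h * g z h b = if m = b then 1 else 0 := by
    intro m b
    rw [← Matrix.mul_apply, Matrix.nonsing_inv_mul _ (hg.unit z hz), Matrix.one_apply]
  have h1 : ∀ m, ∑ h, (g z)⁻¹ m h * (g z * covCurv g m j k z) h i = covCurv g m j k z m i := by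
    intro m
    rw [← Matrix.mul_apply, Matrix.nonsing_inv_mul_cancel_left _ _ (hg.unit z hz)]
  have h2 : ∀ m, ∑ h, (g z)⁻¹ m h * covDeriv4 g (projCurv g) m h i j k z =
      covCurv g m j k z m i + 1 / 3 * (covRicci g m i j z * (if m = k then 1 else 0) -
        covRicci g m i k z * (if m = j then 1 else 0)) := by
    intro m
    rw [← h1, ← hgi, ← hgi, Finset.mul_sum, Finset.mul_sum, ← Finset.sum_sub_distrib,
      Finset.mul_sum, ← Finset.sum_add_distrib]
    exact Finset.sum_congr rfl fun h _ => by rw [hc]; ring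
  -- The curvature contributes `∇_j R_ik - ∇_k R_ij` once and the Ricci part contributes `-1/3` of
  -- it, whence the factor `2/3`.
  simp only [divProjCurv, h2, Finset.sum_add_distrib, hg.div_curv hz, ← Finset.mul_sum,
    Finset.sum_sub_distrib, mul_ite, mul_one, mul_zero, Finset.sum_ite_eq', Finset.mem_univ,
    if_true]
  ring

theorem mpd_inv_metric (hg : IsMetricOn g U) (hz : z ∈ U) (m : Fin 4) :
    mpd m (fun y => (g y)⁻¹) z = -((g z)⁻¹ * (conn g m z)ᵀ + conn g m z * (g z)⁻¹) := by
  have hu := hg.unit z hz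
  rw [mpd_inv hg.isOpen hg.smooth hg.unit hz, hg.mpd_metric hz, mul_add, add_mul, ← mul_assoc,
    mul_assoc _ (g z), Matrix.mul_nonsing_inv _ hu, mul_one, ← mul_assoc,
    Matrix.nonsing_inv_mul _ hu, one_mul]

/-- The inverse metric is parallel, so only the Ricci tensor is differentiated in the trace; the
Christoffel corrections cancel. -/
theorem pd_scalar (hg : IsMetricOn g U) (hz : z ∈ U) (j : Fin 4) :
    pd j (scalar g) z = ∑ i, ∑ k, (g z)⁻¹ i k * covRicci g j i k z := by
  have hR : ∀ a b, DifferentiableAt ℝ (ricci g a b) z :=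
    fun a b => differentiableAt_of_smooth hg.isOpen (hg.smooth_ricci a b) hz
  have hG : ∀ a b, DifferentiableAt ℝ (fun y => (g y)⁻¹ a b) z :=
    fun a b => hg.smooth_inv.diff hg.isOpen hz a b
  have h1 : pd j (scalar g) z = ∑ i, ∑ k, (pd j (fun y => (g y)⁻¹ i k) z * ricci g i k z +
      (g z)⁻¹ i k * pd j (ricci g i k) z) := by
    have : scalar g = fun y => ∑ i, ∑ k, (g y)⁻¹ i k * ricci g i k y := rfl
    rw [this, pd_sum (F := fun i y => ∑ k, (g y)⁻¹ i k * ricci g i k y)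
      fun i _ => DifferentiableAt.fun_sum fun k _ => (hG i k).mul (hR i k)]
    refine Finset.sum_congr rfl fun i _ => ?_
    rw [pd_sum (F := fun k y => (g y)⁻¹ i k * ricci g i k y)
      fun k _ => (hG i k).mul (hR i k)]
    exact Finset.sum_congr rfl fun k _ => pd_mul (hG i k) (hR i k) j
  have h2 : ∀ a b, pd j (fun y => (g y)⁻¹ a b) z = -∑ l, ((g z)⁻¹ a l * christoffel g b j l z +
      christoffel g a j l z * (g z)⁻¹ l b) := by
    intro a b
    have := congrFun (congrFun (hg.mpd_inv_metric hz j) a) b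
    simpa only [Matrix.neg_apply, Matrix.add_apply, Matrix.mul_apply, Matrix.transpose_apply, conn,
      Matrix.of_apply, mpd, ← Finset.sum_add_distrib] using this
  rw [h1]
  simp only [h2, covRicci, Fin.sum_univ_four]
  ring

/-- If the Ricci tensor is a Codazzi tensor then the Ricci scalar is locally constant. -/
theorem pd_scalar_eq_zero (hg : IsMetricOn g U) (hz : z ∈ U)
    (hC : ∀ i j k, covRicci g j i k z = covRicci g k i j z) (j : Fin 4) :
    pd j (scalar g) z = 0 := by
  -- The double contraction `∇_m R^{mk}_{jk}` is computed in two orders. Summing over `m` first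
  -- gives a trace of the divergence, which vanishes by the Codazzi equation (`h1`, `h3`). Summing
  -- over `k` first and using antisymmetry in both index pairs gives the divergence of the Ricci
  -- tensor (`h2`), which for a Codazzi tensor equals the gradient of its trace.
  have h1 : ∀ k, ∑ m, (covCurv g m j k z * (g z)⁻¹) m k = ∑ i, (g z)⁻¹ i k *
      ∑ m, covCurv g m j k z m i := by
    intro k
    simp only [Matrix.mul_apply, Finset.mul_sum]
    rw [Finset.sum_comm]
    simp only [mul_comm]
  have h2 : ∀ m, ∑ k, (covCurv g m j k z * (g z)⁻¹) m k =
      ∑ i, (g z)⁻¹ i m * covRicci g m i j z := by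
    intro m
    have : ∀ k, (covCurv g m j k z * (g z)⁻¹) m k = ∑ i, (g z)⁻¹ i m * covCurv g m k j z k i := by
      intro k
      rw [hg.covCurv_mul_inv_antisymm hz, Matrix.neg_apply, Matrix.transpose_apply,
        covCurv_antisymm, neg_mul, Matrix.neg_apply, neg_neg, Matrix.mul_apply]
      simp only [mul_comm]
    simp only [this]
    rw [Finset.sum_comm]
    simp only [← Finset.mul_sum, hg.sum_covCurv hz]
  have h3 : ∀ k i, ∑ m, covCurv g m j k z m i = 0 := fun k i => by
    rw [hg.div_curv hz, hC, sub_self]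
  calc pd j (scalar g) z = ∑ m, ∑ i, (g z)⁻¹ i m * covRicci g m i j z := by
        rw [hg.pd_scalar hz, Finset.sum_comm]
        exact Finset.sum_congr rfl fun m _ => Finset.sum_congr rfl fun i _ => by rw [hC]
    _ = ∑ m, ∑ k, (covCurv g m j k z * (g z)⁻¹) m k :=
        Finset.sum_congr rfl fun m _ => (h2 m).symm
    _ = ∑ k, ∑ m, (covCurv g m j k z * (g z)⁻¹) m k := Finset.sum_comm
    _ = 0 := by simp only [h1, h3, mul_zero, Finset.sum_const_zero]

end IsMetricOn

/-! ### Change of coordinates -/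

/-- The Jacobian matrix `∂ψ^a / ∂z^i`. -/
noncomputable def jac (ψ : R4 → R4) : Comp :=
  fun z => Matrix.of fun a i => pd i (fun y => ψ y a) z

/-- The change of coordinates `ψ` carries the metric components `g` to `g'`. -/
structure IsCoordChange (ψ : R4 → R4) (g g' : Comp) (U U' : Set R4) : Prop where
  source : IsMetricOn g U
  target : IsMetricOn g' U'
  mapsTo : MapsTo ψ U U'
  smooth : ContDiffOn ℝ ∞ ψ U
  pullback : ∀ z ∈ U, g z = (jac ψ z)ᵀ * g' (ψ z) * jac ψ z

section ChainRule

variable {ψ : R4 → R4} {U U' : Set R4} {z : R4}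

theorem smooth_apply (hψ : ContDiffOn ℝ ∞ ψ U) (a : Fin 4) :
    ContDiffOn ℝ ∞ (fun y => ψ y a) U :=
  (contDiffOn_euclidean.1 hψ) a

theorem fderiv_apply_comp (hψ : DifferentiableAt ℝ ψ z) (w : R4) (a : Fin 4) :
    fderiv ℝ ψ z w a = fderiv ℝ (fun y => ψ y a) z w := by
  have h : HasFDerivAt (fun y => ψ y a)
      ((EuclideanSpace.proj a : R4 →L[ℝ] ℝ).comp (fderiv ℝ ψ z)) z :=
    (EuclideanSpace.proj a : R4 →L[ℝ] ℝ).hasFDerivAt.comp z hψ.hasFDerivAt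
  rw [h.fderiv]
  rfl

theorem jac_apply (hψ : DifferentiableAt ℝ ψ z) (a i : Fin 4) :
    jac ψ z a i = fderiv ℝ ψ z (EuclideanSpace.single i 1) a := by
  rw [fderiv_apply_comp hψ]
  rfl

theorem pd_comp {f : R4 → ℝ} (hf : DifferentiableAt ℝ f (ψ z)) (hψ : DifferentiableAt ℝ ψ z)
    (i : Fin 4) : pd i (fun y => f (ψ y)) z = ∑ a, jac ψ z a i * pd a f (ψ z) := by
  have : fderiv ℝ (fun y => f (ψ y)) z = (fderiv ℝ f (ψ z)).comp (fderiv ℝ ψ z) :=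
    fderiv_comp z hf hψ
  rw [pd, this, ContinuousLinearMap.comp_apply, fderiv_apply_eq_sum]
  simp only [jac_apply hψ]

theorem mpd_comp {A : Comp} (hU' : IsOpen U') (hA : SmoothComp U' A) (hz : ψ z ∈ U')
    (hψ : DifferentiableAt ℝ ψ z) (i : Fin 4) :
    mpd i (fun y => A (ψ y)) z = ∑ a, jac ψ z a i • mpd a A (ψ z) := by
  ext k l
  simp only [mpd, Matrix.of_apply, Matrix.sum_apply, Matrix.smul_apply, smul_eq_mul]
  exact pd_comp (hA.diff hU' hz k l) hψ i

end ChainRule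

namespace IsCoordChange

variable {ψ : R4 → R4} {g g' : Comp} {U U' : Set R4} {z : R4}

theorem differentiableAt (h : IsCoordChange ψ g g' U U') (hz : z ∈ U) : DifferentiableAt ℝ ψ z :=
  (h.smooth.contDiffAt (h.source.isOpen.mem_nhds hz)).differentiableAt (by simp)

theorem smooth_jac (h : IsCoordChange ψ g g' U U') : SmoothComp U (jac ψ) :=
  fun a i => smooth_pd h.source.isOpen (smooth_apply h.smooth a) i

theorem smooth_comp (h : IsCoordChange ψ g g' U U') {A : Comp} (hA : SmoothComp U' A) :
    SmoothComp U (fun y => A (ψ y)) :=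
  fun i j => (hA i j).comp h.smooth h.mapsTo

/-- Taking determinants in the pullback formula: the left-hand side is nonzero and the Jacobian is
one of the factors. Hence the definition of `IsCoordChange` need not require an inverse map. -/
theorem isUnit_jac (h : IsCoordChange ψ g g' U U') (hz : z ∈ U) : IsUnit (jac ψ z).det := by
  have hu := h.source.unit z hz
  rw [h.pullback z hz, Matrix.det_mul] at hu
  exact isUnit_of_mul_isUnit_right hu

theorem mpd_jac_symm (h : IsCoordChange ψ g g' U U') (hz : z ∈ U) (a i j : Fin 4) :
    mpd i (jac ψ) z a j = mpd j (jac ψ) z a i :=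
  pd_comm h.source.isOpen (smooth_apply h.smooth a) hz i j

/-- The pulled back connection matrices. -/
noncomputable def pullConn (ψ : R4 → R4) (g' : Comp) (k : Fin 4) : Comp :=
  fun z => ∑ b, jac ψ z b k • conn g' b (ψ z)

theorem smooth_pullConn (h : IsCoordChange ψ g g' U U') (k : Fin 4) :
    SmoothComp U (pullConn ψ g' k) :=
  SmoothComp.sum fun b _ => SmoothComp.smul (h.smooth_jac b k)
    (h.smooth_comp (h.target.smooth_conn b))

/-- The transformation law of the Christoffel symbols. -/
theorem jac_mul_conn (h : IsCoordChange ψ g g' U U') (hz : z ∈ U) (k : Fin 4) :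
    jac ψ z * conn g k z = mpd k (jac ψ) z + pullConn ψ g' k z * jac ψ z := by
  have hJ := h.isUnit_jac hz
  have hO := h.source.isOpen
  -- The candidate obtained by solving the transformation law for the connection is checked to be
  -- torsion-free and metric, so it is the Levi-Civita connection of `g`.
  have key := h.source.conn_unique hz
    (C := fun k => (jac ψ z)⁻¹ * (mpd k (jac ψ) z + pullConn ψ g' k z * jac ψ z)) ?_ ?_ k
  · rw [key, Matrix.mul_nonsing_inv_cancel_left _ _ hJ]
  · intro l j k
    simp only [Matrix.mul_apply]
    refine Finset.sum_congr rfl fun m _ => ?_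
    congr 1
    rw [Matrix.add_apply, Matrix.add_apply, h.mpd_jac_symm hz]
    congr 1
    simp only [pullConn, Finset.sum_mul, Matrix.sum_apply, Matrix.smul_apply, smul_eq_mul,
      Matrix.mul_apply, conn, Matrix.of_apply]
    rw [Finset.sum_comm]
    refine Finset.sum_congr rfl fun b _ => Finset.sum_congr rfl fun c _ => ?_
    rw [h.target.christoffel_symm (h.mapsTo hz)]
    ring
  · intro m
    have hg' := h.smooth_comp h.target.smooth
    have e1 : mpd m g z = (mpd m (jac ψ) z)ᵀ * g' (ψ z) * jac ψ z +
        (jac ψ z)ᵀ * ((pullConn ψ g' m z)ᵀ * g' (ψ z) + g' (ψ z) * pullConn ψ g' m z) * jac ψ z +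
        (jac ψ z)ᵀ * g' (ψ z) * mpd m (jac ψ) z := by
      rw [mpd_congr hO (fun y hy => h.pullback y hy) hz,
        mpd_mul hO (h.smooth_jac.transpose.mul hg') h.smooth_jac hz,
        mpd_mul hO h.smooth_jac.transpose hg' hz, mpd_transpose,
        mpd_comp h.target.isOpen h.target.smooth (h.mapsTo hz) (h.differentiableAt hz)]
      have : ∑ a, jac ψ z a m • mpd a g' (ψ z) =
          (pullConn ψ g' m z)ᵀ * g' (ψ z) + g' (ψ z) * pullConn ψ g' m z := by
        simp only [pullConn, Matrix.transpose_sum, Matrix.transpose_smul, Finset.sum_mul,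
          Finset.mul_sum, smul_mul_assoc, mul_smul_comm, ← Finset.sum_add_distrib, ← smul_add,
          h.target.mpd_metric (h.mapsTo hz)]
      rw [this]
      noncomm_ring
    have e2 : g z * ((jac ψ z)⁻¹ * (mpd m (jac ψ) z + pullConn ψ g' m z * jac ψ z)) =
        (jac ψ z)ᵀ * g' (ψ z) * (mpd m (jac ψ) z + pullConn ψ g' m z * jac ψ z) := by
      rw [h.pullback z hz, mul_assoc, Matrix.mul_nonsing_inv_cancel_left _ _ hJ]
    have e3 : ((jac ψ z)⁻¹ * (mpd m (jac ψ) z + pullConn ψ g' m z * jac ψ z))ᵀ * g z =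
        (mpd m (jac ψ) z + pullConn ψ g' m z * jac ψ z)ᵀ * g' (ψ z) * jac ψ z := by
      have := congrArg Matrix.transpose e2
      rw [Matrix.transpose_mul (g z), h.source.symm z hz] at this
      rw [this]
      simp only [Matrix.transpose_mul, Matrix.transpose_transpose,
        h.target.symm _ (h.mapsTo hz), mul_assoc]
    rw [e1, e2, e3, Matrix.transpose_add, Matrix.transpose_mul]
    noncomm_ring

/-- The terms containing second derivatives of `ψ` are symmetric in `j` and `k` (`hs`) and drop out
of the antisymmetrised expression. -/
theorem curvOf_pullConn (h : IsCoordChange ψ g g' U U') (hz : z ∈ U) (j k : Fin 4) :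
    curvOf (pullConn ψ g') j k z =
      ∑ a, ∑ b, (jac ψ z a j * jac ψ z b k) • curvOf (conn g') a b (ψ z) := by
  have hO := h.source.isOpen
  have hm : ∀ j k, mpd j (pullConn ψ g' k) z = ∑ b, mpd j (jac ψ) z b k • conn g' b (ψ z) +
      ∑ b, ∑ a, (jac ψ z b k * jac ψ z a j) • mpd a (conn g' b) (ψ z) := by
    intro j k
    have hs : ∀ b, SmoothComp U (fun y => conn g' b (ψ y)) :=
      fun b => h.smooth_comp (h.target.smooth_conn b)
    unfold pullConn
    rw [mpd_sum hO fun b _ => SmoothComp.smul (h.smooth_jac b k) (hs b)]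
    · rw [← Finset.sum_add_distrib]
      refine Finset.sum_congr rfl fun b _ => ?_
      rw [mpd_smul hO (h.smooth_jac b k) (hs b) hz, mpd_comp h.target.isOpen
        (h.target.smooth_conn b) (h.mapsTo hz) (h.differentiableAt hz), Finset.smul_sum]
      simp only [smul_smul]
      rfl
    · exact hz
  have hp : ∀ j k, pullConn ψ g' j z * pullConn ψ g' k z =
      ∑ a, ∑ b, (jac ψ z a j * jac ψ z b k) • (conn g' a (ψ z) * conn g' b (ψ z)) := by
    intro j k
    simp only [pullConn, Finset.sum_mul, Finset.mul_sum, smul_mul_assoc, mul_smul_comm, smul_smul,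
      Finset.smul_sum]
    rw [Finset.sum_comm]
    exact Finset.sum_congr rfl fun a _ => Finset.sum_congr rfl fun b _ => by rw [mul_comm]
  have hs : ∑ b, mpd j (jac ψ) z b k • conn g' b (ψ z) =
      ∑ b, mpd k (jac ψ) z b j • conn g' b (ψ z) :=
    Finset.sum_congr rfl fun b _ => by rw [h.mpd_jac_symm hz]
  have hc : ∑ b, ∑ a, (jac ψ z b k * jac ψ z a j) • mpd a (conn g' b) (ψ z) =
      ∑ a, ∑ b, (jac ψ z a j * jac ψ z b k) • mpd a (conn g' b) (ψ z) := by
    rw [Finset.sum_comm]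
    simp only [mul_comm]
  have hc' : ∑ b, ∑ a, (jac ψ z b j * jac ψ z a k) • mpd a (conn g' b) (ψ z) =
      ∑ a, ∑ b, (jac ψ z a j * jac ψ z b k) • mpd b (conn g' a) (ψ z) := rfl
  have hc'' : pullConn ψ g' k z * pullConn ψ g' j z =
      ∑ a, ∑ b, (jac ψ z a j * jac ψ z b k) • (conn g' b (ψ z) * conn g' a (ψ z)) := by
    rw [hp, Finset.sum_comm]
    simp only [mul_comm (jac ψ z _ k)]
  simp only [curvOf, smul_add, smul_sub, Finset.sum_add_distrib, Finset.sum_sub_distrib]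
  rw [hm, hm, hs, hc, hc', hc'', hp]
  abel

/-- The transformation law of the curvature. -/
theorem jac_mul_curv (h : IsCoordChange ψ g g' U U') (hz : z ∈ U) (j k : Fin 4) :
    jac ψ z * curvOf (conn g) j k z = curvOf (pullConn ψ g') j k z * jac ψ z := by
  have hO := h.source.isOpen
  have hJ := h.smooth_jac
  -- `hd` is the differentiated transformation law of the connection and `hp` the law applied twice.
  -- After antisymmetrisation the second derivatives of the Jacobian matrix cancel by symmetry, and
  -- its first derivatives cancel between `hd` and `hp`.
  have hd : ∀ j k, jac ψ z * mpd j (conn g k) z = mpd j (mpd k (jac ψ)) z +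
      (mpd j (pullConn ψ g' k) z * jac ψ z + pullConn ψ g' k z * mpd j (jac ψ) z) -
      mpd j (jac ψ) z * conn g k z := by
    intro j k
    have := mpd_congr hO (fun y hy => h.jac_mul_conn hy k) hz j
    rw [mpd_mul hO hJ (h.source.smooth_conn k) hz, mpd_add hO (hJ.mpd hO k)
      ((h.smooth_pullConn k).mul hJ) hz, mpd_mul hO (h.smooth_pullConn k) hJ hz] at this
    rw [← this]
    abel
  have hp : ∀ j k, jac ψ z * (conn g j z * conn g k z) = mpd j (jac ψ) z * conn g k z +
      pullConn ψ g' j z * (mpd k (jac ψ) z + pullConn ψ g' k z * jac ψ z) := by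
    intro j k
    rw [← mul_assoc, h.jac_mul_conn hz, add_mul, mul_assoc (pullConn ψ g' j z),
      h.jac_mul_conn hz]
  simp only [curvOf, mul_add, mul_sub]
  rw [hd, hd, hp, hp, mpd_comm hO hJ hz j k]
  noncomm_ring

/-- The Ricci tensor is a tensor. -/
theorem ricci_pullback (h : IsCoordChange ψ g g' U U') (hz : z ∈ U) (i k : Fin 4) :
    ricci g i k z = ∑ d, ∑ b, jac ψ z d i * jac ψ z b k * ricci g' d b (ψ z) := by
  have hJ := h.isUnit_jac hz
  have hF : ∀ l, curvOf (conn g) l k z l i = ∑ c, (jac ψ z)⁻¹ l c * ∑ a, ∑ b,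
      (jac ψ z a l * jac ψ z b k) * ∑ d, curvOf (conn g') a b (ψ z) c d * jac ψ z d i := by
    intro l
    have : curvOf (conn g) l k z = (jac ψ z)⁻¹ * ∑ a, ∑ b,
        (jac ψ z a l * jac ψ z b k) • (curvOf (conn g') a b (ψ z) * jac ψ z) := by
      have e : ∑ a, ∑ b, (jac ψ z a l * jac ψ z b k) • (curvOf (conn g') a b (ψ z) * jac ψ z) =
          curvOf (pullConn ψ g') l k z * jac ψ z := by
        rw [h.curvOf_pullConn hz]
        simp only [Finset.sum_mul, smul_mul_assoc]
      rw [e, ← h.jac_mul_curv hz, Matrix.nonsing_inv_mul_cancel_left _ _ hJ]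
    rw [this, Matrix.mul_apply]
    simp only [Matrix.sum_apply, Matrix.smul_apply, smul_eq_mul, Matrix.mul_apply]
  have hd : ∀ a c, ∑ l, jac ψ z a l * (jac ψ z)⁻¹ l c = if a = c then 1 else 0 := by
    intro a c
    rw [← Matrix.mul_apply, Matrix.mul_nonsing_inv _ hJ, Matrix.one_apply]
  calc ricci g i k z
      = ∑ c, ∑ a, (∑ l, jac ψ z a l * (jac ψ z)⁻¹ l c) * ∑ b, jac ψ z b k *
          ∑ d, curvOf (conn g') a b (ψ z) c d * jac ψ z d i := by
        rw [ricci_eq]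
        simp only [hF]
        rw [Finset.sum_comm]
        refine Finset.sum_congr rfl fun c _ => ?_
        simp only [Finset.mul_sum, Finset.sum_mul]
        rw [Finset.sum_comm]
        refine Finset.sum_congr rfl fun a _ => ?_
        rw [Finset.sum_comm]
        refine Finset.sum_congr rfl fun b _ => ?_
        rw [Finset.sum_comm]
        refine Finset.sum_congr rfl fun d _ => Finset.sum_congr rfl fun l _ => ?_
        ring
    _ = ∑ a, ∑ b, jac ψ z b k * ∑ d, curvOf (conn g') a b (ψ z) a d * jac ψ z d i := by
        simp only [hd, ite_mul, one_mul, zero_mul, Finset.sum_ite_eq', Finset.mem_univ, if_true]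
    _ = _ := by
        simp only [ricci_eq, Finset.mul_sum]
        rw [Finset.sum_comm]
        conv_rhs => rw [Finset.sum_comm]
        refine Finset.sum_congr rfl fun b _ => ?_
        rw [Finset.sum_comm]
        exact Finset.sum_congr rfl fun d _ => Finset.sum_congr rfl fun a _ => by ring

/-- In this form the invariance of the Ricci scalar is the cyclicity of the trace. -/
theorem scalar_eq_trace (g : Comp) (z : R4) :
    scalar g z = ((g z)⁻¹ * (Matrix.of fun i k => ricci g i k z)ᵀ).trace := by
  simp [scalar, Matrix.trace, Matrix.mul_apply]

/-- The Ricci scalar is a scalar. -/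
theorem scalar_comp (h : IsCoordChange ψ g g' U U') (hz : z ∈ U) :
    scalar g z = scalar g' (ψ z) := by
  have hJ := h.isUnit_jac hz
  have hJt : IsUnit (jac ψ z)ᵀ.det := by rwa [Matrix.det_transpose]
  have hR : (Matrix.of fun i k => ricci g i k z) =
      (jac ψ z)ᵀ * (Matrix.of fun i k => ricci g' i k (ψ z)) * jac ψ z := by
    ext i k
    simp only [Matrix.of_apply, h.ricci_pullback hz, Matrix.mul_apply, Matrix.transpose_apply,
      Finset.sum_mul]
    rw [Finset.sum_comm]
    exact Finset.sum_congr rfl fun d _ => Finset.sum_congr rfl fun b _ => by ring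
  rw [scalar_eq_trace, scalar_eq_trace, hR, h.pullback z hz, Matrix.mul_inv_rev,
    Matrix.mul_inv_rev, Matrix.transpose_mul, Matrix.transpose_mul, Matrix.transpose_transpose,
    mul_assoc, mul_assoc, Matrix.nonsing_inv_mul_cancel_left _ _ hJt, ← mul_assoc,
    Matrix.trace_mul_comm, ← mul_assoc, Matrix.mul_nonsing_inv_cancel_right _ _ hJ,
    Matrix.trace_mul_comm]

end IsCoordChange

/-! ### Perfect fluids whose Ricci tensor is a Codazzi tensor -/

/-- The algebraic consequences of the Codazzi equation for a tensor `α g_ij + β w_i w_j` of constant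
trace; `b` is the gradient of `β` and `N` is the covariant derivative of `w`. -/
theorem codazzi_fluid_algebra {G Gi N : Matrix (Fin 4) (Fin 4) ℝ} {v w b : Fin 4 → ℝ} {β θ : ℝ}
    (hG : ∀ i k, G i k = G k i) (hGi : ∀ i k, Gi i k = Gi k i)
    (hGv : ∀ i, ∑ k, G i k * v k = w i)
    (hid : ∀ k j, ∑ i, Gi k i * G i j = if k = j then 1 else 0) (hv : ∑ k, w k * v k = -1)
    (hN : ∀ j, ∑ i, v i * N j i = 0) (hθ : ∑ k, ∑ l, Gi k l * N k l = θ)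
    (hE : ∀ i j k, (b j / 4 * G i k + b j * (w i * w k) + β * (N j i * w k + w i * N j k)) -
      (b k / 4 * G i j + b k * (w i * w j) + β * (N k i * w j + w i * N k j)) = 0) :
    (∀ k, b k = 4 / 3 * θ * β * w k) ∧
      ∀ j i, β * N j i = β * (θ / 3 * (G j i + w j * w i)) := by
  have hGw : ∀ i, ∑ k, Gi i k * w k = v i := fun i => by
    simp only [← hGv, Finset.mul_sum]
    rw [Finset.sum_comm]
    simp only [← mul_assoc, ← Finset.sum_mul, hid, ite_mul, one_mul, zero_mul, Finset.sum_ite_eq,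
      Finset.mem_univ, if_true]
  have htr : ∑ i, ∑ k, Gi i k * G i k = 4 := by
    have : ∀ i, ∑ k, Gi i k * G i k = 1 := fun i => by
      have h := hid i i
      rw [if_pos rfl] at h
      rw [← h]
      exact Finset.sum_congr rfl fun k _ => by rw [hG]
    simp [this]
  have hGv' : ∀ i, ∑ k, v k * G k i = w i := fun i => by
    rw [← hGv i]; exact Finset.sum_congr rfl fun k _ => by rw [hG k i, mul_comm]
  obtain ⟨db, hdb⟩ : ∃ x, ∑ k, v k * b k = x := ⟨_, rfl⟩
  -- `hE` contracted with `v^i`. The coefficient `-3/4` is `1/4` from the metric term plus `w_i v^i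
  -- = -1`.
  have h1 : ∀ j k, -(3 / 4) * (b j * w k - b k * w j) - β * (N j k - N k j) = 0 := by
    intro j k
    have e : ∑ i, v i * ((b j / 4 * G i k + b j * (w i * w k) +
      β * (N j i * w k + w i * N j k)) - (b k / 4 * G i j + b k * (w i * w j) +
      β * (N k i * w j + w i * N k j))) = 0 := by simp only [hE, mul_zero, Finset.sum_const_zero]
    have a1 := hGv' k
    have a2 := hGv' j
    have a3 := hN j
    have a4 := hN k
    simp only [Fin.sum_univ_four] at e a1 a2 a3 a4 hv
    linear_combination e - b j / 4 * a1 + b k / 4 * a2 - β * w k * a3 + β * w j * a4 -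
      (b j * w k - b k * w j + β * (N j k - N k j)) * hv
  -- `h1` contracted with `v^k`: a first expression for `β` times the acceleration.
  have h2 : ∀ j, β * ∑ k, v k * N k j = -(3 / 4) * (b j + db * w j) := by
    intro j
    have e : ∑ k, v k * (-(3 / 4) * (b j * w k - b k * w j) - β * (N j k - N k j)) = 0 := by
      simp only [h1, mul_zero, Finset.sum_const_zero]
    have a1 := hN j
    simp only [Fin.sum_univ_four] at e a1 hv hdb ⊢
    linear_combination e + β * a1 + 3 / 4 * b j * hv - 3 / 4 * w j * hdb
  -- The trace of `hE` over `i` and `k`: a second relation between `b`, the acceleration and `θ`.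
  have h3 : ∀ j, -(1 / 4) * b j - db * w j - β * (θ * w j + ∑ k, v k * N k j) = 0 := by
    intro j
    have e : ∑ i, ∑ k, Gi i k * ((b j / 4 * G i k + b j * (w i * w k) +
      β * (N j i * w k + w i * N j k)) - (b k / 4 * G i j + b k * (w i * w j) +
      β * (N k i * w j + w i * N k j))) = 0 := by simp only [hE, mul_zero, Finset.sum_const_zero]
    have c1 : ∑ i, ∑ k, Gi i k * (w i * w k) = -1 := by
      rw [← hv]
      refine Finset.sum_congr rfl fun i _ => ?_
      rw [← hGw i, Finset.mul_sum]
      exact Finset.sum_congr rfl fun k _ => by ring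
    have c2 : ∑ i, ∑ k, Gi i k * (N j i * w k) = 0 := by
      rw [← hN j]
      refine Finset.sum_congr rfl fun i _ => ?_
      rw [← hGw i, Finset.sum_mul]
      exact Finset.sum_congr rfl fun k _ => by ring
    have c3 : ∀ f : Fin 4 → ℝ, ∑ i, ∑ k, Gi i k * (w i * f k) = ∑ k, v k * f k := by
      intro f
      rw [Finset.sum_comm]
      refine Finset.sum_congr rfl fun k _ => ?_
      rw [← hGw k, Finset.sum_mul]
      exact Finset.sum_congr rfl fun i _ => by rw [hGi]; ring
    have c4 : ∑ i, ∑ k, Gi i k * (b k * G i j) = b j := by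
      rw [Finset.sum_comm]
      have : ∀ k, ∑ i, Gi i k * (b k * G i j) = b k * (if k = j then 1 else 0) := by
        intro k
        rw [← hid, Finset.mul_sum]
        exact Finset.sum_congr rfl fun i _ => by rw [hGi]; ring
      simp only [this, mul_ite, mul_one, mul_zero, Finset.sum_ite_eq', Finset.mem_univ, if_true]
    have c5 : ∑ i, ∑ k, Gi i k * N k i = θ := by
      rw [← hθ, Finset.sum_comm]
      exact Finset.sum_congr rfl fun i _ => Finset.sum_congr rfl fun k _ => by rw [hGi]
    have c6 := c3 fun k => N j k
    have c7 := c3 fun k => N k j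
    have c8 := c3 b
    rw [hN j] at c6
    rw [hdb] at c8
    have e' : b j / 4 * (∑ i, ∑ k, Gi i k * G i k) + b j * (∑ i, ∑ k, Gi i k * (w i * w k)) +
        β * (∑ i, ∑ k, Gi i k * (N j i * w k) + ∑ i, ∑ k, Gi i k * (w i * N j k)) -
        (1 / 4 * (∑ i, ∑ k, Gi i k * (b k * G i j)) +
          (∑ i, ∑ k, Gi i k * (w i * b k)) * w j +
          β * ((∑ i, ∑ k, Gi i k * N k i) * w j + ∑ i, ∑ k, Gi i k * (w i * N k j))) = 0 := by
      rw [← e]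
      simp only [Finset.mul_sum, Finset.sum_mul, ← Finset.sum_add_distrib,
        ← Finset.sum_sub_distrib]
      exact Finset.sum_congr rfl fun i _ => Finset.sum_congr rfl fun k _ => by ring
    rw [htr, c1, c2, c4, c5, c6, c7, c8] at e'
    linear_combination e'
  -- `h3` contracted with `v^j`. The acceleration drops out, being orthogonal to `v`.
  have h4 : db = -(4 / 3) * β * θ := by
    have e : ∑ j, v j * (-(1 / 4) * b j - db * w j - β * (θ * w j + ∑ k, v k * N k j)) = 0 := by
      simp only [h3, mul_zero, Finset.sum_const_zero]
    have e0 : ∑ j, v j * ∑ k, v k * N k j = 0 := by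
      simp only [Finset.mul_sum]
      rw [Finset.sum_comm]
      refine Finset.sum_eq_zero fun k _ => ?_
      have := congrArg (v k * ·) (hN k)
      simp only [Finset.mul_sum, mul_zero] at this
      rw [← this]
      exact Finset.sum_congr rfl fun j _ => by ring
    have e' : -(1 / 4) * (∑ k, v k * b k) - db * (∑ k, w k * v k) -
        β * (θ * (∑ k, w k * v k) + ∑ j, v j * ∑ k, v k * N k j) = 0 := by
      rw [← e]
      simp only [Finset.mul_sum (s := Finset.univ) (a := db), Finset.mul_sum (a := θ),
        Finset.mul_sum (a := β), Finset.mul_sum (a := -(1 / 4 : ℝ)), ← Finset.sum_add_distrib,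
        ← Finset.sum_sub_distrib]
      exact Finset.sum_congr rfl fun i _ => by ring
    rw [hdb, hv, e0] at e'
    linarith
  -- With `db` known, `h2` and `h3` are two linear relations between `b` and the acceleration;
  -- eliminating the acceleration leaves `b` as a multiple of `w`.
  have h5 : ∀ k, b k = 4 / 3 * θ * β * w k := by
    intro k
    have e2 := h2 k
    have e3 := h3 k
    rw [h4] at e2 e3
    linarith
  refine ⟨h5, fun j i => ?_⟩
  -- `hE` contracted with `v^k` isolates `β N_ji`; every other term is now known, and `h2` with `h5`
  -- makes the acceleration terms vanish.
  have e : ∑ k, v k * ((b j / 4 * G i k + b j * (w i * w k) +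
      β * (N j i * w k + w i * N j k)) - (b k / 4 * G i j + b k * (w i * w j) +
      β * (N k i * w j + w i * N k j))) = 0 := by simp only [hE, mul_zero, Finset.sum_const_zero]
  have a0 := h2 i
  have a0' := h2 j
  have a1 := hGv i
  have a2 := hN j
  have hi := h5 i
  have hj := h5 j
  rw [h4] at a0 a0' hdb
  rw [hG j i]
  simp only [Fin.sum_univ_four] at e a0 a0' a1 a2 hv hdb
  linear_combination -e + b j / 4 * a1 + (b j * w i + β * N j i) * hv + β * w i * a2
    - (G i j / 4 + w i * w j) * hdb - w j * a0 - w i * a0' + 3 / 4 * w j * hi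

/-! ### Covariant calculus of tensors of perfect-fluid form -/

namespace IsMetricOn

variable {g : Comp} {U : Set R4} {z : R4} {v : R4 → R4}

theorem inv_mul_apply (hg : IsMetricOn g U) (hz : z ∈ U) (k j : Fin 4) :
    ∑ i, (g z)⁻¹ k i * g z i j = if k = j then 1 else 0 := by
  rw [← Matrix.mul_apply, Matrix.nonsing_inv_mul _ (hg.unit z hz), Matrix.one_apply]

theorem sum_inv_mul_self (hg : IsMetricOn g U) (hz : z ∈ U) (i : Fin 4) :
    ∑ k, (g z)⁻¹ i k * g z i k = 1 := by
  have h := hg.inv_mul_apply hz i i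
  rw [if_pos rfl] at h
  rw [← h]
  exact Finset.sum_congr rfl fun k _ => by rw [hg.apply_symm hz]

theorem sum_inv_mul_lower (hg : IsMetricOn g U) (hz : z ∈ U) (v : R4 → R4) (i : Fin 4) :
    ∑ k, (g z)⁻¹ i k * lower g v k z = v z i := by
  simp only [lower, Finset.mul_sum]
  rw [Finset.sum_comm]
  simp only [← mul_assoc, ← Finset.sum_mul, hg.inv_mul_apply hz, ite_mul, one_mul, zero_mul,
    Finset.sum_ite_eq, Finset.mem_univ, if_true]

theorem smooth_lower (hg : IsMetricOn g U) (hv : ContDiffOn ℝ ∞ v U) (i : Fin 4) :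
    ContDiffOn ℝ ∞ (lower g v i) U := by
  unfold lower
  exact ContDiffOn.sum fun k _ => (hg.smooth i k).mul (smooth_apply hv k)

/-- `v^i ∇_j v_i = 0` for a unit vector field. -/
theorem sum_mul_nabla (hg : IsMetricOn g U) (hz : z ∈ U) (hv : ContDiffOn ℝ ∞ v U)
    (hunit : ∀ z ∈ U, ∑ k, lower g v k z * v z k = -1) (j : Fin 4) :
    ∑ i, v z i * nabla g v j i z = 0 := by
  have hvd : ∀ k, DifferentiableAt ℝ (fun y => v y k) z :=
    fun k => differentiableAt_of_smooth hg.isOpen (smooth_apply hv k) hz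
  have hwd : ∀ k, DifferentiableAt ℝ (lower g v k) z :=
    fun k => differentiableAt_of_smooth hg.isOpen (hg.smooth_lower hv k) hz
  have h1 : ∑ k, (pd j (lower g v k) z * v z k + lower g v k z * pd j (fun y => v y k) z) = 0 := by
    rw [← pd_const (z := z) (-1) j, ← pd_congr hg.isOpen hunit hz j,
      pd_sum (F := fun k y => lower g v k y * v y k) fun k _ => (hwd k).mul (hvd k)]
    exact Finset.sum_congr rfl fun k _ => (pd_mul (hwd k) (hvd k) j).symm
  have h2 : ∀ i, pd j (lower g v i) z =
      ∑ k, (pd j (fun y => g y i k) z * v z k + g z i k * pd j (fun y => v y k) z) := by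
    intro i
    have hgd := fun k => hg.smooth.diff hg.isOpen hz i k
    have : lower g v i = fun y => ∑ k, g y i k * v y k := rfl
    rw [this, pd_sum (F := fun k y => g y i k * v y k) fun k _ => (hgd k).mul (hvd k)]
    exact Finset.sum_congr rfl fun k _ => pd_mul (hgd k) (hvd k) j
  have h3 : ∑ i, v z i * pd j (lower g v i) z = ∑ i, ∑ k, v z i * v z k *
      pd j (fun y => g y i k) z + ∑ k, lower g v k z * pd j (fun y => v y k) z := by
    simp only [h2, Finset.mul_sum, mul_add, Finset.sum_add_distrib]
    congr 1
    · exact Finset.sum_congr rfl fun i _ => Finset.sum_congr rfl fun k _ => by ring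
    · rw [Finset.sum_comm]
      simp only [lower, Finset.sum_mul]
      refine Finset.sum_congr rfl fun k _ => Finset.sum_congr rfl fun i _ => ?_
      rw [hg.apply_symm hz k i]
      ring
  have h4 : ∑ i, ∑ k, v z i * v z k * pd j (fun y => g y i k) z =
      2 * ∑ i, v z i * ∑ l, christoffel g l j i z * lower g v l z := by
    simp only [hg.pd_metric hz, lower, Fin.sum_univ_four]
    rw [hg.apply_symm hz 1 0, hg.apply_symm hz 2 0, hg.apply_symm hz 3 0, hg.apply_symm hz 2 1,
      hg.apply_symm hz 3 1, hg.apply_symm hz 3 2]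
    ring
  rw [Finset.sum_add_distrib] at h1
  have h5 : ∑ k, pd j (lower g v k) z * v z k = ∑ i, v z i * pd j (lower g v i) z := by
    simp only [mul_comm]
  simp only [nabla, mul_sub, Finset.sum_sub_distrib]
  rw [h4] at h3
  linarith

/-- The covariant derivative of a tensor of perfect-fluid form. -/
theorem covRicci_of_fluid (hg : IsMetricOn g U) (hz : z ∈ U) (hv : ContDiffOn ℝ ∞ v U)
    {α β : R4 → ℝ} (hα : ContDiffOn ℝ ∞ α U) (hβ : ContDiffOn ℝ ∞ β U)
    (hR : ∀ z ∈ U, ∀ i k, ricci g i k z = α z * g z i k + β z * (lower g v i z * lower g v k z))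
    (j i k : Fin 4) :
    covRicci g j i k z = pd j α z * g z i k + pd j β z * (lower g v i z * lower g v k z) +
      β z * (nabla g v j i z * lower g v k z + lower g v i z * nabla g v j k z) := by
  have hw : ∀ k, DifferentiableAt ℝ (lower g v k) z :=
    fun k => differentiableAt_of_smooth hg.isOpen (hg.smooth_lower hv k) hz
  have hα' := differentiableAt_of_smooth hg.isOpen hα hz
  have hβ' := differentiableAt_of_smooth hg.isOpen hβ hz
  have hG := hg.smooth.diff hg.isOpen hz i k
  have e : pd j (ricci g i k) z = (pd j α z * g z i k + α z * pd j (fun y => g y i k) z) +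
      (pd j β z * (lower g v i z * lower g v k z) + β z *
        (pd j (lower g v i) z * lower g v k z + lower g v i z * pd j (lower g v k) z)) := by
    rw [pd_congr hg.isOpen (fun y hy => hR y hy i k) hz,
      pd_add (hα'.fun_mul hG) (hβ'.fun_mul ((hw i).fun_mul (hw k))), pd_mul hα' hG,
      pd_mul hβ' ((hw i).fun_mul (hw k)), pd_mul (hw i) (hw k)]
  rw [covRicci, e, hg.pd_metric hz]
  simp only [hR z hz, nabla, Fin.sum_univ_four]
  ring

/-- The trace of a tensor of perfect-fluid form. -/
theorem trace_of_fluid (hg : IsMetricOn g U) (hz : z ∈ U)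
    (hunit : ∑ k, lower g v k z * v z k = -1) {S : Fin 4 → Fin 4 → ℝ} {α β : ℝ}
    (hS : ∀ i k, S i k = α * g z i k + β * (lower g v i z * lower g v k z)) :
    ∑ i, ∑ k, (g z)⁻¹ i k * S i k = 4 * α - β := by
  have h1 := hg.sum_inv_mul_self hz
  have h2 := hg.sum_inv_mul_lower hz v
  have h3 : ∀ i, ∑ k, (g z)⁻¹ i k * S i k = α + β * (lower g v i z * v z i) := fun i => by
    rw [← h2, ← mul_one α, ← h1 i, Finset.mul_sum, Finset.mul_sum, Finset.mul_sum,
      ← Finset.sum_add_distrib]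
    exact Finset.sum_congr rfl fun k _ => by rw [hS]; ring
  simp only [h3, Finset.sum_add_distrib, ← Finset.mul_sum, hunit]
  simp
  ring

/-- The coefficients of a vanishing tensor of perfect-fluid form. -/
theorem coeff_eq_zero_of_fluid (hg : IsMetricOn g U) (hz : z ∈ U)
    (hunit : ∑ k, lower g v k z * v z k = -1) {α β : ℝ}
    (hS : ∀ i k, α * g z i k + β * (lower g v i z * lower g v k z) = 0) : β = 0 := by
  -- The trace gives `4α = β`, while contracting with the vector gives `α = β`; hence both vanish.
  have h1 := hg.trace_of_fluid hz hunit (S := fun _ _ => 0) fun i k => (hS i k).symm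
  have h2 : ∀ i, (α - β) * lower g v i z = 0 := fun i => by
    have h : ∑ k, (α * g z i k + β * (lower g v i z * lower g v k z)) * v z k =
        α * lower g v i z + β * lower g v i z * ∑ k, lower g v k z * v z k := by
      rw [lower, Finset.mul_sum, Finset.mul_sum, ← Finset.sum_add_distrib]
      exact Finset.sum_congr rfl fun k _ => by ring
    simp only [hS, zero_mul, Finset.sum_const_zero, hunit] at h
    linarith
  have h3 : α - β = 0 := by
    have h : ∑ i, (α - β) * lower g v i z * v z i = 0 := by simp [h2]
    simp only [mul_assoc, ← Finset.mul_sum, hunit] at h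
    linarith
  simp only [mul_zero, Finset.sum_const_zero] at h1
  linarith

/-- The trace of a Ricci tensor of perfect-fluid form. -/
theorem scalar_of_fluid (hg : IsMetricOn g U) (hz : z ∈ U)
    (hunit : ∑ k, lower g v k z * v z k = -1) {α β : ℝ}
    (hR : ∀ i k, ricci g i k z = α * g z i k + β * (lower g v i z * lower g v k z)) :
    scalar g z = 4 * α - β :=
  hg.trace_of_fluid hz hunit hR

/-- A perfect fluid with constant Ricci scalar and Codazzi Ricci tensor: the gradient of the
coefficient `β` and the covariant derivative of the velocity. -/
theorem codazzi_fluid (hg : IsMetricOn g U) (hz : z ∈ U) (hv : ContDiffOn ℝ ∞ v U)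
    (hunit : ∀ z ∈ U, ∑ k, lower g v k z * v z k = -1)
    (hC : ∀ z ∈ U, ∀ i j k, covRicci g j i k z = covRicci g k i j z)
    {α β : R4 → ℝ} (hα : ContDiffOn ℝ ∞ α U) (hβ : ContDiffOn ℝ ∞ β U)
    (hR : ∀ z ∈ U, ∀ i k, ricci g i k z = α z * g z i k + β z * (lower g v i z * lower g v k z)) :
    (∀ k, pd k β z = 4 / 3 * expansion g v z * β z * lower g v k z) ∧
      ∀ j i, β z * nabla g v j i z = β z * (expansion g v z / 3 * proj g v j i z) := by
  -- The Ricci scalar `4α - β` has zero gradient.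
  have hαβ : ∀ j, pd j α z = pd j β z / 4 := by
    intro j
    have hα' := differentiableAt_of_smooth hg.isOpen hα hz
    have hβ' := differentiableAt_of_smooth hg.isOpen hβ hz
    have h0 := hg.pd_scalar_eq_zero hz (hC z hz) j
    rw [pd_congr hg.isOpen (fun y hy => hg.scalar_of_fluid hy (hunit y hy) (hR y hy)) hz,
      pd_sub (hα'.const_mul _) hβ', pd_const_mul hα'] at h0
    linarith
  refine codazzi_fluid_algebra (Gi := (g z)⁻¹) (v := fun i => v z i) (fun i k => hg.apply_symm hz i k)
    (fun i k => hg.inv_apply_symm hz i k) (fun i => rfl) (fun k j => hg.inv_mul_apply hz k j)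
    (hunit z hz) (hg.sum_mul_nabla hz hv hunit) (N := Matrix.of fun j i => nabla g v j i z) rfl ?_
  intro i j k
  have := hC z hz i j k
  rw [hg.covRicci_of_fluid hz hv hα hβ hR, hg.covRicci_of_fluid hz hv hα hβ hR, hαβ, hαβ] at this
  simp only [Matrix.of_apply]
  linarith

/-- Shear, vorticity and acceleration vanish when `∇_j v_i` is a multiple of `h_ji`. -/
theorem kinematics_of_nabla (hg : IsMetricOn g U) (hz : z ∈ U)
    (hunit : ∑ k, lower g v k z * v z k = -1) {φ : ℝ}
    (hN : ∀ j i, nabla g v j i z = φ * proj g v j i z) :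
    (∀ i j, shear g v i j z = 0) ∧ (∀ i j, vorticity g v i j z = 0) ∧
      ∀ i, acceleration g v i z = 0 := by
  have hs : ∀ i j, proj g v i j z = proj g v j i z := fun i j => by
    simp only [proj, hg.apply_symm hz i j]; ring
  have hv : ∀ i, ∑ k, v z k * proj g v k i z = 0 := fun i => by
    have h1 : ∑ k, v z k * g z k i = lower g v i z := Finset.sum_congr rfl fun k _ => by
      rw [hg.apply_symm hz, mul_comm]
    have h2 : ∑ k, v z k * proj g v k i z =
        ∑ k, v z k * g z k i + (∑ k, lower g v k z * v z k) * lower g v i z := by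
      rw [Finset.sum_mul, ← Finset.sum_add_distrib]
      exact Finset.sum_congr rfl fun k _ => by rw [proj]; ring
    rw [h2, h1, hunit]
    ring
  have hp : ∀ i l, ∑ k, projMixed g v i k z * proj g v k l z = proj g v i l z := fun i l => by
    have : ∀ k, projMixed g v i k z * proj g v k l z =
        (if i = k then proj g v k l z else 0) + lower g v i z * (v z k * proj g v k l z) := by
      intro k
      rw [projMixed]
      split_ifs <;> ring
    simp only [this, Finset.sum_add_distrib, ← Finset.mul_sum, hv]
    simp
  have hθ : expansion g v z = 3 * φ := by
    have h3 : ∀ i, ∑ k, (g z)⁻¹ i k * nabla g v i k z = φ + φ * (lower g v i z * v z i) := by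
      intro i
      have : ∀ k, (g z)⁻¹ i k * nabla g v i k z = φ * ((g z)⁻¹ i k * g z i k) +
          φ * lower g v i z * ((g z)⁻¹ i k * lower g v k z) := fun k => by
        rw [hN, proj]; ring
      simp only [this, Finset.sum_add_distrib, ← Finset.mul_sum, hg.sum_inv_mul_self hz,
        hg.sum_inv_mul_lower hz]
      ring
    simp only [expansion, h3, Finset.sum_add_distrib, ← Finset.mul_sum, hunit]
    simp
    ring
  refine ⟨fun i j => ?_, fun i j => ?_, fun i => ?_⟩
  · have : ∀ k l, projMixed g v i k z * projMixed g v j l z *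
        ((nabla g v k l z + nabla g v l k z) / 2) =
        φ * (projMixed g v j l z * (projMixed g v i k z * proj g v k l z)) := by
      intro k l
      rw [hN, hN, hs l k]
      ring
    simp only [shear, this, hθ]
    rw [Finset.sum_comm]
    simp only [← Finset.mul_sum, hp, hs i]
    rw [hs]
    ring
  · refine Finset.sum_eq_zero fun k _ => Finset.sum_eq_zero fun l _ => ?_
    rw [hN, hN, hs l k]
    ring
  · have : ∀ k, v z k * nabla g v k i z = φ * (v z k * proj g v k i z) := fun k => by
      rw [hN]; ring
    simp only [acceleration, this, ← Finset.mul_sum, hv, mul_zero]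

end IsMetricOn

/-! ### The smooth inverse function theorem on an open set -/

/-- The inverse function theorem at `a` controls the inverse only near `f a`. Invertibility of the
derivative is an open condition, so the local inverse is restricted to the points where it holds,
and there smoothness of the inverse is checked point by point. -/
theorem exists_smooth_openPartialHomeomorph {E F : Type*} [NormedAddCommGroup E] [NormedSpace ℝ E]
    [NormedAddCommGroup F] [NormedSpace ℝ F] [CompleteSpace E] {f : E → F} {U : Set E} {a : E}
    (hU : IsOpen U) (ha : a ∈ U) (hf : ContDiffOn ℝ ∞ f U) (f' : E ≃L[ℝ] F)
    (hf' : HasFDerivAt f (f' : E →L[ℝ] F) a) :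
    ∃ e : OpenPartialHomeomorph E F, (∀ x, e x = f x) ∧ a ∈ e.source ∧ e.source ⊆ U ∧
      ContDiffOn ℝ ∞ e e.source ∧ ContDiffOn ℝ ∞ e.symm e.target := by
  have hfa : ContDiffAt ℝ ∞ f a := hf.contDiffAt (hU.mem_nhds ha)
  let e₀ := hfa.toOpenPartialHomeomorph f hf' (by simp)
  have he₀ : ∀ x, e₀ x = f x := fun x => rfl
  have hd : ContDiffOn ℝ ∞ (fderiv ℝ f) U := hf.fderiv_of_isOpen hU (by simp)
  let S : Set E := U ∩ fderiv ℝ f ⁻¹' range ((↑) : (E ≃L[ℝ] F) → E →L[ℝ] F)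
  have hS : IsOpen S := hd.continuousOn.isOpen_inter_preimage hU ContinuousLinearEquiv.isOpen
  have haS : a ∈ S := ⟨ha, f', by rw [hf'.fderiv]⟩
  have he : ∀ x, e₀.restrOpen S hS x = f x := fun x => rfl
  have hsrc : (e₀.restrOpen S hS).source = e₀.source ∩ S := rfl
  refine ⟨e₀.restrOpen S hS, he, ⟨hfa.mem_toOpenPartialHomeomorph_source hf' (by simp), haS⟩,
    fun x hx => hx.2.1, ?_, ?_⟩
  · exact (hf.mono fun x hx => hx.2.1).congr fun x _ => he x
  · intro y hy
    have hx := (e₀.restrOpen S hS).map_target hy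
    set x := (e₀.restrOpen S hS).symm y with hxdef
    obtain ⟨L, hL⟩ := hx.2.2
    have hfx : ContDiffAt ℝ ∞ f x := hf.contDiffAt (hU.mem_nhds hx.2.1)
    refine ((e₀.restrOpen S hS).contDiffAt_symm hy (f₀' := L) ?_ ?_).contDiffWithinAt
    · rw [hL]
      exact (hfx.differentiableAt (by simp)).hasFDerivAt
    · exact hfx

/-! ### The composition operator on spaces of continuous functions -/

section Composition

universe u

variable {K : Type*} [TopologicalSpace K] [CompactSpace K]
  {E F G : Type u} [NormedAddCommGroup E] [NormedSpace ℝ E] [NormedAddCommGroup F] [NormedSpace ℝ F]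
  [NormedAddCommGroup G] [NormedSpace ℝ G]

/-- Pointwise application of a bilinear map. -/
noncomputable def pointwiseApply (B : G →L[ℝ] E →L[ℝ] F) :
    C(K, G) →L[ℝ] C(K, E) →L[ℝ] C(K, F) :=
  LinearMap.mkContinuous₂
    (LinearMap.mk₂ ℝ (fun (A : C(K, G)) (h : C(K, E)) =>
      (⟨fun t => B (A t) (h t), by fun_prop⟩ : C(K, F)))
      (fun _ _ _ => by ext; simp) (fun _ _ _ => by ext; simp) (fun _ _ _ => by ext; simp)
      (fun _ _ _ => by ext; simp)) ‖B‖ (by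
    intro A h
    refine (ContinuousMap.norm_le _ (by positivity)).2 fun t => ?_
    refine (B.le_opNorm₂ _ _).trans ?_
    gcongr
    · exact A.norm_coe_le_norm t
    · exact h.norm_coe_le_norm t)

theorem pointwiseApply_apply (B : G →L[ℝ] E →L[ℝ] F) (A : C(K, G)) (h : C(K, E)) (t : K) :
    pointwiseApply B A h t = B (A t) (h t) := rfl

/-- The range of `α` is compact, so the derivative of `f` is uniformly continuous near it, and the
mean value inequality bounds the remainder uniformly in `t`. Writing the derivative as `B ∘ f'`
exhibits it as composition with `f'` followed by a bounded linear operation. -/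
theorem hasFDerivAt_comp_continuousMap (B : G →L[ℝ] E →L[ℝ] F) (f : C(E, F)) (f' : C(E, G))
    (hf : ∀ x, HasFDerivAt f (B (f' x)) x) (α : C(K, E)) :
    HasFDerivAt (fun α : C(K, E) => f.comp α) (pointwiseApply B (f'.comp α)) α := by
  rw [hasFDerivAt_iff_isLittleO_nhds_zero, Asymptotics.isLittleO_iff]
  intro c hc
  have hK : IsCompact (range α) := isCompact_range α.continuous
  have hu := hK.uniformContinuousAt_of_continuousAt (fun x => B (f' x))
    (fun a _ => (B.continuous.comp f'.continuous).continuousAt) (Metric.dist_mem_uniformity hc)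
  obtain ⟨δ, hδ, hδ'⟩ := Metric.mem_uniformity_dist.1 hu
  filter_upwards [Metric.ball_mem_nhds (0 : C(K, E)) hδ] with h hh
  rw [ContinuousMap.norm_le _ (by positivity)]
  intro t
  have hht : ‖h t‖ < δ := (h.norm_coe_le_norm t).trans_lt (by simpa using hh)
  have := (convex_ball (α t) δ).norm_image_sub_le_of_norm_hasFDerivWithin_le'
    (f := f) (f' := fun x => B (f' x)) (φ := B (f' (α t))) (C := c) (x := α t) (y := α t + h t)
    (fun x _ => (hf x).hasFDerivWithinAt) (fun x hx => ?_) (Metric.mem_ball_self hδ)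
    (by simpa using hht)
  · simp only [ContinuousMap.sub_apply, ContinuousMap.comp_apply, ContinuousMap.add_apply,
      pointwiseApply_apply]
    rw [add_sub_cancel_left] at this
    exact this.trans (by gcongr; exact h.norm_coe_le_norm t)
  · have := hδ' (a := α t) (b := x) (by rw [dist_comm]; exact hx) ⟨t, rfl⟩
    rw [← dist_eq_norm, dist_comm]
    exact this.le

/-- The derivative of composition with `f` is composition with `f'` followed by a continuous linear
map, so one order of smoothness is gained. -/
theorem contDiff_succ_comp_continuousMap {n : ℕ} (B : G →L[ℝ] E →L[ℝ] F) (f : C(E, F))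
    (f' : C(E, G)) (hf : ∀ x, HasFDerivAt f (B (f' x)) x)
    (hf' : ContDiff ℝ n (fun α : C(K, E) => f'.comp α)) :
    ContDiff ℝ (n + 1) (fun α : C(K, E) => f.comp α) := by
  have hp : ContDiff ℝ n (fun A : C(K, G) => pointwiseApply (E := E) B A) :=
    ContinuousLinearMap.contDiff _
  exact contDiff_succ_iff_hasFDerivAt.2 ⟨fun α => pointwiseApply B (f'.comp α), hp.comp hf',
    hasFDerivAt_comp_continuousMap B f f' hf⟩

/-- The target space is quantified inside the induction because the derivative takes values in `E
→L[ℝ] F` rather than `F`. -/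
theorem contDiff_comp_continuousMap_nat (n : ℕ) : ∀ {F : Type u} [NormedAddCommGroup F]
    [NormedSpace ℝ F] (f : C(E, F)), ContDiff ℝ n f →
    ContDiff ℝ n (fun α : C(K, E) => f.comp α) := by
  induction n with
  | zero =>
    intro F _ _ f _
    rw [Nat.cast_zero, contDiff_zero]
    exact f.continuous_postcomp
  | succ n ih =>
    intro F _ _ f hf
    rw [Nat.cast_succ, contDiff_succ_iff_hasFDerivAt] at hf
    obtain ⟨f', hf', hff'⟩ := hf
    rw [Nat.cast_succ]
    exact contDiff_succ_comp_continuousMap (ContinuousLinearMap.id ℝ (E →L[ℝ] F)) f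
      ⟨f', hf'.continuous⟩ hff' (ih _ hf')

theorem contDiff_comp_continuousMap (f : C(E, F)) (hf : ContDiff ℝ ∞ f) :
    ContDiff ℝ ∞ (fun α : C(K, E) => f.comp α) :=
  contDiff_infty.2 fun n => contDiff_comp_continuousMap_nat n f (contDiff_infty.1 hf n)

end Composition

/-! ### Smooth dependence of the flow of a vector field on the initial point -/

section Flow

open unitInterval

variable {E : Type*} [NormedAddCommGroup E] [NormedSpace ℝ E]

/-- The primitive `t ↦ ∫₀ᵗ α` of a curve on the unit interval. -/
noncomputable def primitive : C(I, E) →L[ℝ] C(I, E) :=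
  LinearMap.mkContinuous
    -- `projIcc` extends the curve by its end values, which makes the integrand a continuous
    -- function on the whole line.
    { toFun := fun α => ⟨fun t => ∫ s in (0 : ℝ)..t, α (projIcc 0 1 zero_le_one s),
        (intervalIntegral.continuous_primitive (fun a b => (Continuous.intervalIntegrable
          (by fun_prop) a b)) 0).comp continuous_subtype_val⟩
      map_add' := fun α β => by
        ext t
        exact intervalIntegral.integral_add (Continuous.intervalIntegrable (by fun_prop) _ _)
          (Continuous.intervalIntegrable (by fun_prop) _ _)
      map_smul' := fun c α => by
        ext t
        exact intervalIntegral.integral_smul c _ } 1 (by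
    intro α
    rw [one_mul, ContinuousMap.norm_le _ (norm_nonneg _)]
    intro t
    refine (intervalIntegral.norm_integral_le_of_norm_le_const
      (fun s _ => α.norm_coe_le_norm (projIcc 0 1 zero_le_one s))).trans ?_
    rw [sub_zero, abs_of_nonneg t.2.1]
    exact mul_le_of_le_one_right (norm_nonneg _) t.2.2)

/-- Constant curves. -/
noncomputable def constCurve : E →L[ℝ] C(I, E) :=
  LinearMap.mkContinuous
    { toFun := fun x => ContinuousMap.const I x
      map_add' := fun _ _ => rfl
      map_smul' := fun _ _ => rfl } 1 (by
    intro x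
    rw [one_mul, ContinuousMap.norm_le _ (norm_nonneg _)]
    intro t
    rfl)

theorem constCurve_apply (x : E) (t : I) : constCurve x t = x := rfl

/-- The integral equation `α(t) = x + ε ∫₀ᵗ v(α)`. -/
noncomputable def picardDefect (v : C(E, E)) (q : (E × ℝ) × C(I, E)) : C(I, E) :=
  q.2 - constCurve q.1.1 - q.1.2 • primitive (v.comp q.2)

theorem contDiff_picardDefect (v : C(E, E)) (hv : ContDiff ℝ ∞ v) :
    ContDiff ℝ ∞ (picardDefect v) := by
  have h := contDiff_comp_continuousMap (K := I) v hv
  have h1 : ContDiff ℝ ∞ (fun q : (E × ℝ) × C(I, E) => q.1) := contDiff_fst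
  have h2 : ContDiff ℝ ∞ (fun q : (E × ℝ) × C(I, E) => q.2) := contDiff_snd
  exact (h2.sub ((constCurve (E := E)).contDiff.comp h1.fst)).sub
    (h1.snd.smul ((primitive (E := E)).contDiff.comp (h.comp h2)))

/-- The derivative of `q ↦ (q.1, picardDefect v q)` at a constant curve and `ε = 0`. -/
noncomputable def picardDeriv (c : C(I, E)) : ((E × ℝ) × C(I, E)) ≃L[ℝ] ((E × ℝ) × C(I, E)) :=
  ContinuousLinearEquiv.equivOfInverse
    ((ContinuousLinearMap.fst ℝ (E × ℝ) C(I, E)).prod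
      (ContinuousLinearMap.snd ℝ (E × ℝ) C(I, E) -
        constCurve.comp ((ContinuousLinearMap.fst ℝ E ℝ).comp
          (ContinuousLinearMap.fst ℝ (E × ℝ) C(I, E))) -
        ((ContinuousLinearMap.snd ℝ E ℝ).comp
          (ContinuousLinearMap.fst ℝ (E × ℝ) C(I, E))).smulRight c))
    ((ContinuousLinearMap.fst ℝ (E × ℝ) C(I, E)).prod
      (ContinuousLinearMap.snd ℝ (E × ℝ) C(I, E) +
        constCurve.comp ((ContinuousLinearMap.fst ℝ E ℝ).comp
          (ContinuousLinearMap.fst ℝ (E × ℝ) C(I, E))) +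
        ((ContinuousLinearMap.snd ℝ E ℝ).comp
          (ContinuousLinearMap.fst ℝ (E × ℝ) C(I, E))).smulRight c))
    (fun q => by
      ext1
      · simp
      · simp; abel)
    (fun q => by
      ext1
      · simp
      · simp; abel)

/-- At `ε = 0` the derivative of `α ↦ v ∘ α` is multiplied by zero. Only its existence matters, and
the total derivative is triangular with explicit inverse. -/
theorem hasFDerivAt_picardDefect (v : C(E, E)) (hv : ContDiff ℝ ∞ v) (x : E) :
    HasFDerivAt (fun q : (E × ℝ) × C(I, E) => (q.1, picardDefect v q))
      (picardDeriv (primitive (v.comp (constCurve x))) :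
        ((E × ℝ) × C(I, E)) →L[ℝ] ((E × ℝ) × C(I, E))) ((x, 0), constCurve x) := by
  have h := (contDiff_comp_continuousMap (K := I) v hv).differentiable (by simp) (constCurve x)
  obtain ⟨L, h1⟩ : DifferentiableAt ℝ (fun q : (E × ℝ) × C(I, E) => primitive (v.comp q.2))
      ((x, 0), constCurve x) :=
    (primitive (E := E)).differentiableAt.comp ((x, (0 : ℝ)), constCurve x)
      (DifferentiableAt.comp (g := fun α : C(I, E) => v.comp α) ((x, (0 : ℝ)), constCurve x) h
        differentiableAt_snd)
  have h2 : HasFDerivAt (fun q : (E × ℝ) × C(I, E) => q.1.2)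
      ((ContinuousLinearMap.snd ℝ E ℝ).comp (ContinuousLinearMap.fst ℝ (E × ℝ) C(I, E)))
      ((x, 0), constCurve x) :=
    ((ContinuousLinearMap.snd ℝ E ℝ).comp
      (ContinuousLinearMap.fst ℝ (E × ℝ) C(I, E))).hasFDerivAt
  have h3 : HasFDerivAt (fun q : (E × ℝ) × C(I, E) => constCurve q.1.1)
      (constCurve.comp ((ContinuousLinearMap.fst ℝ E ℝ).comp
          (ContinuousLinearMap.fst ℝ (E × ℝ) C(I, E)))) ((x, 0), constCurve x) :=
    (constCurve.comp ((ContinuousLinearMap.fst ℝ E ℝ).comp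
          (ContinuousLinearMap.fst ℝ (E × ℝ) C(I, E)))).hasFDerivAt
  have h4 := (hasFDerivAt_fst (𝕜 := ℝ) (p := ((x, (0 : ℝ)), constCurve x))).prodMk
    (((hasFDerivAt_snd (𝕜 := ℝ) (p := ((x, (0 : ℝ)), constCurve x))).sub h3).sub (h2.smul h1))
  refine h4.congr_fderiv ?_
  refine ContinuousLinearMap.ext fun q => ?_
  simp [picardDeriv]

theorem picardDefect_eq_zero_iff (v : C(E, E)) (x : E) (ε : ℝ) (α : C(I, E)) :
    picardDefect v ((x, ε), α) = 0 ↔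
      ∀ t, α t = x + ε • ∫ s in (0 : ℝ)..t, v (α (projIcc 0 1 zero_le_one s)) := by
  rw [picardDefect, sub_sub, sub_eq_zero, ContinuousMap.ext_iff]
  rfl

/-- A smooth vector field has a smooth local flow. -/
theorem exists_smooth_flow [CompleteSpace E] {v : E → E} (hv : ContDiff ℝ ∞ v) (x₀ : E) :
    ∃ δ > 0, ∃ Φ : E × ℝ → E, ContDiffOn ℝ ∞ Φ (Metric.ball x₀ δ ×ˢ Ioo (-δ) δ) ∧
      (∀ x ∈ Metric.ball x₀ δ, Φ (x, 0) = x) ∧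
      ∀ x ∈ Metric.ball x₀ δ, ∀ s ∈ Ioo (-δ) δ,
        HasDerivAt (fun s => Φ (x, s)) (v (Φ (x, s))) s := by
  let w : C(E, E) := ⟨v, hv.continuous⟩
  have hH : ContDiffOn ℝ ∞ (fun q : (E × ℝ) × C(I, E) => (q.1, picardDefect w q)) univ :=
    (contDiff_fst.prodMk (contDiff_picardDefect w hv)).contDiffOn
  -- Solving the integral equation amounts to inverting `q ↦ (q.1, picardDefect w q)` at second
  -- component `0`. The parameter `ε` rescales time, so every solution lives on the unit interval
  -- and the starting point `ε = 0` is trivial.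
  obtain ⟨e, he, hu, -, -, hsymm⟩ := exists_smooth_openPartialHomeomorph isOpen_univ
    (mem_univ _) hH _ (hasFDerivAt_picardDefect w hv x₀)
  have hu0 : e ((x₀, 0), constCurve x₀) = ((x₀, 0), 0) := by
    rw [he, Prod.mk.injEq]
    refine ⟨rfl, (picardDefect_eq_zero_iff _ _ _ _).2 fun t => ?_⟩
    rw [zero_smul, add_zero, constCurve_apply]
  have htar : ((x₀, (0 : ℝ)), (0 : C(I, E))) ∈ e.target := hu0 ▸ e.map_source hu
  obtain ⟨r, hr, hrs⟩ := Metric.isOpen_iff.1 e.open_source _ hu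
  have hcont : ContinuousAt (fun p : E × ℝ => e.symm (p, (0 : C(I, E)))) (x₀, 0) :=
    ContinuousAt.comp (g := e.symm) (e.continuousAt_symm htar) (by fun_prop)
  have hW : ∀ᶠ p : E × ℝ in nhds (x₀, 0), (p, (0 : C(I, E))) ∈ e.target ∧
      e.symm (p, 0) ∈ Metric.ball ((x₀, (0 : ℝ)), constCurve x₀) r := by
    refine Filter.Eventually.and ?_ (hcont.eventually_mem ?_)
    · exact ContinuousAt.eventually_mem (f := fun p : E × ℝ => (p, (0 : C(I, E))))
        (by fun_prop) (e.open_target.mem_nhds htar)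
    · rw [← hu0, e.left_inv hu]
      exact Metric.ball_mem_nhds _ hr
  obtain ⟨δ, hδ, hδW⟩ := Metric.eventually_nhds_iff_ball.1 hW
  have hmem : ∀ x ∈ Metric.ball x₀ δ, ∀ s ∈ Ioo (-δ) δ, (x, s) ∈ Metric.ball (x₀, (0 : ℝ)) δ := by
    intro x hx s hs
    rw [← ball_prod_same]
    exact ⟨hx, by rw [Real.ball_eq_Ioo]; simpa using hs⟩
  let sol : E × ℝ → C(I, E) := fun p => (e.symm (p, 0)).2
  have hsol : ∀ p ∈ Metric.ball (x₀, (0 : ℝ)) δ, e.symm (p, 0) = (p, sol p) ∧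
      picardDefect w (p, sol p) = 0 := by
    intro p hp
    have h1 := e.right_inv (hδW p hp).1
    rw [he, Prod.mk.injEq] at h1
    have h2 : e.symm (p, 0) = (p, sol p) := Prod.ext h1.1 rfl
    exact ⟨h2, h2 ▸ h1.2⟩
  have hsr : ∀ p ∈ Metric.ball (x₀, (0 : ℝ)) δ, dist p (x₀, 0) < r ∧
      dist (sol p) (constCurve x₀) < r := by
    intro p hp
    have h := (hδW p hp).2
    rw [(hsol p hp).1, Metric.mem_ball, Prod.dist_eq, max_lt_iff] at h
    exact h
  -- Injectivity of `e` on its source is uniqueness of solutions close to the constant curve.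
  have huniq : ∀ p ∈ Metric.ball (x₀, (0 : ℝ)) δ, ∀ β : C(I, E),
      dist β (constCurve x₀) < r → picardDefect w (p, β) = 0 → β = sol p := by
    intro p hp β hβ hβ0
    have hs : (p, β) ∈ e.source := hrs (by
      rw [Metric.mem_ball, Prod.dist_eq, max_lt_iff]
      exact ⟨(hsr p hp).1, hβ⟩)
    have h1 := e.left_inv hs
    rw [he, hβ0, (hsol p hp).1, Prod.mk.injEq] at h1
    exact h1.2.symm
  have heq : ∀ p ∈ Metric.ball (x₀, (0 : ℝ)) δ, ∀ t : I,
      sol p t = p.1 + p.2 • ∫ s in (0 : ℝ)..t, v (sol p (projIcc 0 1 zero_le_one s)) :=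
    fun p hp => (picardDefect_eq_zero_iff w p.1 p.2 (sol p)).1 (hsol p hp).2
  -- The curve `t ↦ sol (x, ε) (τ t)` solves the equation with parameter `τ ε`, so by uniqueness it
  -- is `sol (x, τ ε)`. Thus the value at time `1`, as a function of `ε`, traces an entire solution
  -- curve.
  have hscale : ∀ x ∈ Metric.ball x₀ δ, ∀ ε ∈ Ioo (-δ) δ, ∀ τ : I,
      sol (x, τ * ε) 1 = sol (x, ε) τ := by
    intro x hx ε hε τ
    have hτ : τ * ε ∈ Ioo (-δ) δ := by
      rw [mem_Ioo, ← abs_lt] at hε ⊢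
      rw [abs_mul, abs_of_nonneg τ.2.1]
      exact (mul_le_of_le_one_left (abs_nonneg _) τ.2.2).trans_lt hε
    let β : C(I, E) := (sol (x, ε)).comp ⟨fun t => τ * t, by fun_prop⟩
    have hβ : β = sol (x, τ * ε) := by
      refine huniq _ (hmem x hx _ hτ) β ?_ ((picardDefect_eq_zero_iff _ _ _ _).2 fun t => ?_)
      · refine lt_of_le_of_lt ?_ (hsr _ (hmem x hx ε hε)).2
        rw [ContinuousMap.dist_le dist_nonneg]
        intro t
        exact ContinuousMap.dist_apply_le_dist (f := sol (x, ε)) (g := constCurve x₀) (τ * t)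
      · change sol (x, ε) (τ * t) = x + ((τ : ℝ) * ε) • ∫ s in (0 : ℝ)..t,
          v (sol (x, ε) (τ * projIcc 0 1 zero_le_one s))
        rw [heq _ (hmem x hx ε hε), mul_comm (τ : ℝ) ε, mul_smul]
        have h1 : ∫ s in (0 : ℝ)..t, v (sol (x, ε) (τ * projIcc 0 1 zero_le_one s)) =
            ∫ s in (0 : ℝ)..t, v (sol (x, ε) (projIcc 0 1 zero_le_one ((τ : ℝ) * s))) := by
          refine intervalIntegral.integral_congr fun s hs => ?_
          rw [uIcc_of_le t.2.1] at hs
          have hs' : s ∈ Icc (0 : ℝ) 1 := ⟨hs.1, hs.2.trans t.2.2⟩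
          have hτs : (τ : ℝ) * s ∈ Icc (0 : ℝ) 1 := unitInterval.mul_mem τ.2 hs'
          rw [projIcc_of_mem _ hs', projIcc_of_mem _ hτs]
          rfl
        rw [h1, intervalIntegral.smul_integral_comp_mul_left
          (fun s => v (sol (x, ε) (projIcc 0 1 zero_le_one s))), mul_zero]
        rfl
    rw [← hβ]
    change sol (x, ε) (τ * 1) = _
    rw [mul_one]
  have hsmooth : ContDiffOn ℝ ∞ (fun p => sol p 1) (Metric.ball x₀ δ ×ˢ Ioo (-δ) δ) := by
    have h1 : ContDiffOn ℝ ∞ (fun p : E × ℝ => e.symm (p, (0 : C(I, E))))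
        (Metric.ball x₀ δ ×ˢ Ioo (-δ) δ) :=
      hsymm.comp (contDiff_id.prodMk contDiff_const).contDiffOn
        fun p hp => (hδW p (hmem p.1 hp.1 p.2 hp.2)).1
    exact (ContinuousMap.evalCLM ℝ (1 : I)).contDiff.comp_contDiffOn h1.snd
  refine ⟨δ, hδ, fun p => sol p 1, hsmooth, fun x hx => ?_, fun x hx s hs => ?_⟩
  · have := heq (x, 0) (hmem x hx 0 ⟨by linarith, hδ⟩) 1
    simpa using this
  -- The midpoint between `s` and the end of the interval on its side is a nonzero admissible `ε` of
  -- which `s` is a fraction `τ ∈ [0, 1]`. This covers `s = 0` with `τ = 0`.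
  · obtain ⟨ε, hε, hε0, τ, rfl⟩ : ∃ ε ∈ Ioo (-δ) δ, ε ≠ 0 ∧ ∃ τ : I, τ * ε = s := by
      rcases le_or_gt 0 s with h | h
      · refine ⟨(s + δ) / 2, ⟨by linarith [hs.1], by linarith [hs.2]⟩, by linarith,
          ⟨s / ((s + δ) / 2), ⟨by positivity, ?_⟩⟩, ?_⟩
        · rw [div_le_one (by positivity)]
          linarith [hs.2]
        · exact div_mul_cancel₀ _ (by positivity)
      · have hne : (s - δ) / 2 < 0 := by linarith
        refine ⟨(s - δ) / 2, ⟨by linarith [hs.1], by linarith [hs.2]⟩, hne.ne,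
          ⟨s / ((s - δ) / 2), ⟨div_nonneg_of_nonpos h.le hne.le, ?_⟩⟩, ?_⟩
        · rw [div_le_one_of_neg hne]
          linarith [hs.1]
        · exact div_mul_cancel₀ _ hne.ne
    have hO : Metric.ball x₀ δ ×ˢ Ioo (-δ) δ ∈ nhds (x, τ * ε) :=
      (Metric.isOpen_ball.prod isOpen_Ioo).mem_nhds ⟨hx, hs⟩
    have hd : DifferentiableAt ℝ (fun s => sol (x, s) 1) (τ * ε) :=
      DifferentiableAt.comp (g := fun p => sol p 1) (τ * ε : ℝ)
        ((hsmooth.contDiffAt hO).differentiableAt (by simp)) (by fun_prop)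
    have hd1 : HasDerivWithinAt (fun t : ℝ => sol (x, t * ε) 1)
        (ε • deriv (fun s => sol (x, s) 1) (τ * ε)) (Icc 0 1) τ := by
      have : HasDerivAt (fun t : ℝ => t * ε) ε (τ : ℝ) := by
        simpa using (hasDerivAt_id (τ : ℝ)).mul_const ε
      exact (HasDerivAt.scomp (τ : ℝ) (g₁ := fun s => sol (x, s) 1) hd.hasDerivAt
        this).hasDerivWithinAt
    have hc : Continuous fun s => v (sol (x, ε) (projIcc 0 1 zero_le_one s)) :=
      hv.continuous.comp (by fun_prop)
    have hd2 : HasDerivWithinAt (fun t : ℝ => sol (x, t * ε) 1) (ε • v (sol (x, ε) τ))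
        (Icc 0 1) τ := by
      have h := (((hc.integral_hasStrictDerivAt 0 τ).hasDerivAt.const_smul ε).const_add
        x).hasDerivWithinAt (s := Icc 0 1)
      rw [projIcc_val] at h
      refine h.congr (fun t ht => ?_) ?_
      · exact (hscale x hx ε hε ⟨t, ht⟩).trans (heq _ (hmem x hx ε hε) ⟨t, ht⟩)
      · exact (hscale x hx ε hε τ).trans (heq _ (hmem x hx ε hε) τ)
    -- Differentiability in `s` is already known from smoothness, so comparing derivatives within
    -- `[0, 1]` identifies the derivative even when `τ` is an endpoint. Cancelling `ε ≠ 0` then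
    -- gives the flow equation.
    have h := (uniqueDiffOn_Icc zero_lt_one τ τ.2).eq_deriv _ hd1 hd2
    have h' := smul_right_injective E hε0 h
    change HasDerivAt (fun s => sol (x, s) 1) (v (sol (x, τ * ε) 1)) (τ * ε)
    rw [hscale x hx ε hε τ, ← h']
    exact hd.hasDerivAt

end Flow

variable {M : Type*} [TopologicalSpace M] [ChartedSpace R4 M] [IsManifold 𝓘(ℝ, R4) ∞ M]

/-! ### Charts -/

/-- The derivative of a chart, as a map of the model space. -/
noncomputable def toDeriv (e : OpenPartialHomeomorph M R4) (x : M) : R4 →L[ℝ] R4 :=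
  mfderiv 𝓘(ℝ, R4) 𝓘(ℝ, R4) e x

/-- The derivative of the inverse of a chart, as a map of the model space. -/
noncomputable def symmDeriv (e : OpenPartialHomeomorph M R4) (z : R4) : R4 →L[ℝ] R4 :=
  mfderiv 𝓘(ℝ, R4) 𝓘(ℝ, R4) e.symm z

/-- The coordinate vector field as a vector of the model space. -/
noncomputable def frameVec (e : OpenPartialHomeomorph M R4) (i : Fin 4) (z : R4) : R4 :=
  symmDeriv e z (EuclideanSpace.single i 1)

/-- A vector field as a map to the model space. -/
def toModel (u : (x : M) → TangentSpace 𝓘(ℝ, R4) x) (x : M) : R4 := u x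

theorem vecCoord_eq (u : (x : M) → TangentSpace 𝓘(ℝ, R4) x) (e : OpenPartialHomeomorph M R4)
    (z : R4) : vecCoord u e z = toDeriv e (e.symm z) (toModel u (e.symm z)) := rfl

theorem eq_sum_single (w : R4) : w = ∑ i, w i • EuclideanSpace.single i (1 : ℝ) := by
  ext k
  simp [Finset.sum_apply, Pi.single_apply]

theorem symmDeriv_apply (e : OpenPartialHomeomorph M R4) (z w : R4) :
    symmDeriv e z w = ∑ i, w i • frameVec e i z := by
  conv_lhs => rw [eq_sum_single w]
  simp [frameVec]

namespace IsChart

variable {e : OpenPartialHomeomorph M R4} {z : R4} {x : M}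

theorem contMDiffOn (he : IsChart e) : ContMDiffOn 𝓘(ℝ, R4) 𝓘(ℝ, R4) ∞ e e.source :=
  contMDiffOn_of_mem_maximalAtlas he

theorem contMDiffOn_symm (he : IsChart e) : ContMDiffOn 𝓘(ℝ, R4) 𝓘(ℝ, R4) ∞ e.symm e.target :=
  contMDiffOn_symm_of_mem_maximalAtlas he

theorem mdifferentiableAt (he : IsChart e) (hx : x ∈ e.source) :
    MDifferentiableAt 𝓘(ℝ, R4) 𝓘(ℝ, R4) e x :=
  (he.contMDiffOn.contMDiffAt (e.open_source.mem_nhds hx)).mdifferentiableAt (by simp)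

theorem mdifferentiableAt_symm (he : IsChart e) (hz : z ∈ e.target) :
    MDifferentiableAt 𝓘(ℝ, R4) 𝓘(ℝ, R4) e.symm z :=
  (he.contMDiffOn_symm.contMDiffAt (e.open_target.mem_nhds hz)).mdifferentiableAt (by simp)

theorem toDeriv_symmDeriv (he : IsChart e) (hz : z ∈ e.target) (w : R4) :
    toDeriv e (e.symm z) (symmDeriv e z w) = w := by
  have h1 : HasMFDerivAt 𝓘(ℝ, R4) 𝓘(ℝ, R4) (e ∘ e.symm) z _ :=
    (he.mdifferentiableAt (e.map_target hz)).hasMFDerivAt.comp z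
      (he.mdifferentiableAt_symm hz).hasMFDerivAt
  have h2 : HasMFDerivAt 𝓘(ℝ, R4) 𝓘(ℝ, R4) (e ∘ e.symm) z
      (ContinuousLinearMap.id ℝ (TangentSpace 𝓘(ℝ, R4) z)) := by
    refine (hasMFDerivAt_id z).congr_of_eventuallyEq ?_
    filter_upwards [e.open_target.mem_nhds hz] with y hy
    exact e.right_inv hy
  exact congrFun (congrArg DFunLike.coe (hasMFDerivAt_unique h1 h2)) w

/-- In finite dimension an injective endomorphism is surjective, so the one-sided inverse above is
two-sided. -/
theorem symmDeriv_toDeriv (he : IsChart e) (hz : z ∈ e.target) (w : R4) :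
    symmDeriv e z (toDeriv e (e.symm z) w) = w := by
  have hi : Function.Injective (symmDeriv e z) :=
    Function.LeftInverse.injective (he.toDeriv_symmDeriv hz)
  obtain ⟨y, rfl⟩ := (LinearMap.injective_iff_surjective (f := (symmDeriv e z).toLinearMap)).1 hi w
  exact congrArg (symmDeriv e z) (he.toDeriv_symmDeriv hz y)

/-- The coordinate field is the tangent map of the inverse chart applied to a constant field. -/
theorem frame_smooth (he : IsChart e) (i : Fin 4) :
    ContMDiffOn 𝓘(ℝ, R4) 𝓘(ℝ, R4).tangent ∞
      (fun z => (⟨e.symm z, frame e i z⟩ : TangentBundle 𝓘(ℝ, R4) M)) e.target := by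
  have h1 := he.contMDiffOn_symm.contMDiffOn_tangentMapWithin (m := ∞) (by simp)
    e.open_target.uniqueMDiffOn
  have h2 : ContMDiff 𝓘(ℝ, R4) 𝓘(ℝ, R4).tangent ∞ (fun z : R4 =>
      (⟨z, (EuclideanSpace.single i (1 : ℝ) : R4)⟩ : TangentBundle 𝓘(ℝ, R4) R4)) := fun z =>
    contMDiffAt_vectorSpace_iff_contDiffAt
      (V := fun _ => (EuclideanSpace.single i (1 : ℝ) : R4)).2 contDiffAt_const
  have h3 := h1.comp h2.contMDiffOn (s := e.target) (fun z hz => hz)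
  refine h3.congr fun z hz => ?_
  simp only [Function.comp_apply, tangentMapWithin]
  rw [mfderivWithin_of_isOpen e.open_target hz]
  rfl

theorem vecCoord_smooth (he : IsChart e) {u : (x : M) → TangentSpace 𝓘(ℝ, R4) x}
    (hu : ContMDiff 𝓘(ℝ, R4) 𝓘(ℝ, R4).tangent ∞
      (fun x => (⟨x, u x⟩ : TangentBundle 𝓘(ℝ, R4) M))) :
    ContDiffOn ℝ ∞ (vecCoord u e) e.target := by
  have h1 := he.contMDiffOn.contMDiffOn_tangentMapWithin (m := ∞) (by simp)
    e.open_source.uniqueMDiffOn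
  have h2 := h1.comp (hu.comp_contMDiffOn he.contMDiffOn_symm)
    (fun z hz => e.map_target hz)
  have h3 := (contMDiff_snd_tangentBundle_modelSpace R4 𝓘(ℝ, R4)).comp_contMDiffOn h2
  refine contMDiffOn_iff_contDiffOn.1 (h3.congr fun z hz => ?_)
  change _ = mfderivWithin 𝓘(ℝ, R4) 𝓘(ℝ, R4) e e.source (e.symm z) (u (e.symm z))
  rw [mfderivWithin_of_isOpen e.open_source (e.map_target hz)]
  rfl

theorem comp_symm_smooth (he : IsChart e) {f : M → ℝ} (hf : ContMDiff 𝓘(ℝ, R4) 𝓘(ℝ) ∞ f) :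
    ContDiffOn ℝ ∞ (fun z => f (e.symm z)) e.target :=
  contMDiffOn_iff_contDiffOn.1 (hf.comp_contMDiffOn he.contMDiffOn_symm)

end IsChart

/-! ### Metric components -/

namespace LorentzMetric

variable {e e' : OpenPartialHomeomorph M R4} {z : R4} (g : LorentzMetric M)

/-- The metric as a family of bilinear forms on the model space. -/
noncomputable def form (x : M) : R4 →L[ℝ] R4 →L[ℝ] ℝ := g.val x

theorem coord_smooth (he : IsChart e) : SmoothComp e.target (g.coord e) := by
  intro i j
  have h1 : ContMDiffOn 𝓘(ℝ, R4) (𝓘(ℝ, R4).prod 𝓘(ℝ, R4 →L[ℝ] R4 →L[ℝ] ℝ)) ∞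
      (fun z => TotalSpace.mk' (R4 →L[ℝ] R4 →L[ℝ] ℝ)
      (E := fun x : M => TangentSpace 𝓘(ℝ, R4) x →L[ℝ] TangentSpace 𝓘(ℝ, R4) x →L[ℝ] ℝ)
      (e.symm z) (g.val (e.symm z))) e.target := g.smooth.comp_contMDiffOn he.contMDiffOn_symm
  have h2 : ContMDiffOn 𝓘(ℝ, R4) (𝓘(ℝ, R4).prod 𝓘(ℝ, ℝ)) ∞
      (fun z => TotalSpace.mk' ℝ (E := Bundle.Trivial M ℝ) (e.symm z)
        (g.val (e.symm z) (frame e i z) (frame e j z))) e.target := by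
    apply ContMDiffOn.clm_bundle_apply₂ (F₁ := R4) (F₂ := R4)
    · exact h1
    · exact he.frame_smooth i
    · exact he.frame_smooth j
  intro z hz
  have h3 := h2 z hz
  simp only [Bundle.contMDiffWithinAt_totalSpace] at h3
  exact contMDiffWithinAt_iff_contDiffWithinAt.1 h3.2

theorem form_symm (x : M) (v w : R4) : g.form x v w = g.form x w v := g.symm x v w

theorem coord_apply (e : OpenPartialHomeomorph M R4) (z : R4) (i j : Fin 4) :
    g.coord e z i j = g.form (e.symm z) (frameVec e i z) (frameVec e j z) := rfl

theorem exists_basis (x : M) : ∃ b : Module.Basis (Fin 4) ℝ R4,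
    ∀ i j, g.form x (b i) (b j) = minkowski i j := g.signature x

theorem form_sum_sum (x : M) (a c : Fin 4 → ℝ) (b d : Fin 4 → R4) :
    g.form x (∑ i, a i • b i) (∑ j, c j • d j) =
      ∑ i, ∑ j, g.form x (b i) (d j) * a i * c j := by
  rw [map_sum (g.form x), sum_apply]
  refine Finset.sum_congr rfl fun i _ => ?_
  rw [map_sum]
  refine Finset.sum_congr rfl fun j _ => ?_
  rw [map_smul, map_smul, smul_apply, smul_eq_mul, smul_eq_mul]
  ring

theorem form_eq_sum {x : M} {b : Module.Basis (Fin 4) ℝ R4}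
    (hb : ∀ i j, g.form x (b i) (b j) = minkowski i j) (v w : R4) :
    g.form x v w = -(b.repr v 0 * b.repr w 0) + b.repr v 1 * b.repr w 1 +
      b.repr v 2 * b.repr w 2 + b.repr v 3 * b.repr w 3 := by
  conv_lhs => rw [← b.sum_repr v, ← b.sum_repr w, form_sum_sum]
  simp only [hb, minkowski, Fin.sum_univ_four, Matrix.diagonal_apply]
  simp

theorem form_nondegenerate (x : M) {v : R4} (hv : ∀ w, g.form x v w = 0) : v = 0 := by
  obtain ⟨b, hb⟩ := g.exists_basis x
  have h : ∀ j, b.repr v j = 0 := by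
    intro j
    have h1 := hv (b j)
    rw [g.form_eq_sum hb] at h1
    fin_cases j <;> simpa [Finsupp.single_apply] using h1
  exact b.repr.map_eq_zero_iff.1 (Finsupp.ext h)

/-- The reversed Cauchy-Schwarz inequality: the orthogonal complement of a timelike vector is
spacelike. -/
theorem form_pos {x : M} {v w : R4} (hv : g.form x v v = -1) (hvw : g.form x v w = 0)
    (hw : w ≠ 0) : 0 < g.form x w w := by
  obtain ⟨b, hb⟩ := g.exists_basis x
  have hw' : ∃ i, b.repr w i ≠ 0 := by
    by_contra! h
    exact hw (b.repr.map_eq_zero_iff.1 (Finsupp.ext h))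
  rw [g.form_eq_sum hb] at hv hvw ⊢
  generalize b.repr v 0 = v0, b.repr v 1 = v1, b.repr v 2 = v2, b.repr v 3 = v3 at hv hvw
  obtain ⟨w0, h0⟩ : ∃ y, b.repr w 0 = y := ⟨_, rfl⟩
  obtain ⟨w1, h1⟩ : ∃ y, b.repr w 1 = y := ⟨_, rfl⟩
  obtain ⟨w2, h2⟩ : ∃ y, b.repr w 2 = y := ⟨_, rfl⟩
  obtain ⟨w3, h3⟩ : ∃ y, b.repr w 3 = y := ⟨_, rfl⟩
  rw [h0, h1, h2, h3] at hvw ⊢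
  have hv0 : 1 ≤ v0 ^ 2 := by nlinarith [sq_nonneg v1, sq_nonneg v2, sq_nonneg v3]
  -- Cauchy–Schwarz for the spatial components: orthogonality gives `v0 w0` as their inner product,
  -- and normalisation gives `v0² - 1` as the squared length of the spatial part of `v`.
  have hcs : v0 ^ 2 * w0 ^ 2 ≤ (v0 ^ 2 - 1) * (w1 ^ 2 + w2 ^ 2 + w3 ^ 2) := by
    have e1 : v0 * w0 = v1 * w1 + v2 * w2 + v3 * w3 := by linarith
    have e2 : v0 ^ 2 - 1 = v1 ^ 2 + v2 ^ 2 + v3 ^ 2 := by linarith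
    rw [← mul_pow, e1, e2]
    nlinarith [sq_nonneg (v1 * w2 - v2 * w1), sq_nonneg (v1 * w3 - v3 * w1),
      sq_nonneg (v2 * w3 - v3 * w2)]
  have hpos : 0 < w1 ^ 2 + w2 ^ 2 + w3 ^ 2 := by
    rcases (show 0 ≤ w1 ^ 2 + w2 ^ 2 + w3 ^ 2 by positivity).lt_or_eq with h | h
    · exact h
    · exfalso
      have e1 : w1 = 0 := by nlinarith [sq_nonneg w1, sq_nonneg w2, sq_nonneg w3]
      have e2 : w2 = 0 := by nlinarith [sq_nonneg w1, sq_nonneg w2, sq_nonneg w3]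
      have e3 : w3 = 0 := by nlinarith [sq_nonneg w1, sq_nonneg w2, sq_nonneg w3]
      have e0 : w0 = 0 := by
        rw [← h] at hcs
        nlinarith [sq_nonneg w0]
      obtain ⟨i, hi⟩ := hw'
      fin_cases i
      · exact hi (h0.trans e0)
      · exact hi (h1.trans e1)
      · exact hi (h2.trans e2)
      · exact hi (h3.trans e3)
  -- By `hcs` this quantity is at least `w1² + w2² + w3²`.
  have : 0 < v0 ^ 2 * (w1 ^ 2 + w2 ^ 2 + w3 ^ 2 - w0 ^ 2) := by nlinarith
  have := (mul_pos_iff_of_pos_left (by linarith)).1 this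
  linarith

theorem form_symmDeriv (e : OpenPartialHomeomorph M R4) (z v w : R4) :
    g.form (e.symm z) (symmDeriv e z v) (symmDeriv e z w) =
      ∑ i, ∑ j, g.coord e z i j * v i * w j := by
  rw [symmDeriv_apply, symmDeriv_apply, form_sum_sum]
  rfl

theorem isMetricOn (he : IsChart e) : IsMetricOn (g.coord e) e.target where
  isOpen := e.open_target
  smooth := g.coord_smooth he
  symm z _ := by
    ext i j
    rw [Matrix.transpose_apply, coord_apply, coord_apply, form_symm]
  unit z hz := by
    rw [isUnit_iff_ne_zero]
    intro h0
    -- A null vector of the component matrix would represent a tangent vector orthogonal to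
    -- everything.
    obtain ⟨v, hv, hv0⟩ := Matrix.exists_vecMul_eq_zero_iff.2 h0
    apply hv
    have h1 : symmDeriv e z (WithLp.toLp 2 v) = 0 := by
      refine g.form_nondegenerate (e.symm z) fun w => ?_
      rw [← he.symmDeriv_toDeriv hz w, form_symmDeriv, Finset.sum_comm]
      refine Finset.sum_eq_zero fun j _ => ?_
      rw [← Finset.sum_mul]
      have := congrFun hv0 j
      simp only [Matrix.vecMul, dotProduct, Pi.zero_apply] at this
      simp only [mul_comm (g.coord e z _ j)]
      rw [this, zero_mul]
    have h2 := he.toDeriv_symmDeriv hz (WithLp.toLp 2 v)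
    rw [h1, map_zero] at h2
    exact congrArg WithLp.ofLp h2.symm

theorem lower_vecCoord (he : IsChart e) (hz : z ∈ e.target)
    (u : (x : M) → TangentSpace 𝓘(ℝ, R4) x) (i : Fin 4) :
    lower (g.coord e) (vecCoord u e) i z =
      g.form (e.symm z) (frameVec e i z) (toModel u (e.symm z)) := by
  conv_rhs => rw [← he.symmDeriv_toDeriv hz (toModel u (e.symm z)), ← vecCoord_eq]
  simp only [symmDeriv_apply e z (vecCoord u e z), map_sum, map_smul, smul_eq_mul, lower,
    coord_apply, mul_comm]

theorem sum_lower_mul (he : IsChart e) (hz : z ∈ e.target)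
    {u : (x : M) → TangentSpace 𝓘(ℝ, R4) x} (hu : g.UnitTimelike u) :
    ∑ k, lower (g.coord e) (vecCoord u e) k z * vecCoord u e z k = -1 := by
  have h : g.form (e.symm z) (toModel u (e.symm z)) (toModel u (e.symm z)) = -1 :=
    hu.2 (e.symm z)
  simp only [g.lower_vecCoord he hz]
  rw [← h]
  have hw : toModel u (e.symm z) = ∑ k, vecCoord u e z k • frameVec e k z := by
    rw [← symmDeriv_apply, vecCoord_eq, he.symmDeriv_toDeriv hz]
  generalize hy : toModel u (e.symm z) = y at hw
  conv_rhs => arg 1; rw [hw]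
  rw [map_sum, sum_apply]
  refine Finset.sum_congr rfl fun k _ => ?_
  rw [map_smul, smul_apply, smul_eq_mul, mul_comm]

/-! #### Change of charts -/

theorem form_congr {x y : M} (h : x = y) : g.form x = g.form y := by rw [h]

/-- The transition map of two charts is a change of coordinates. -/
theorem isCoordChange (he : IsChart e) (he' : IsChart e') :
    IsCoordChange (e' ∘ e.symm) (g.coord e) (g.coord e') (e.symm.trans e').source e'.target where
  source := by
    have h := g.isMetricOn he
    have hs : (e.symm.trans e').source ⊆ e.target := fun z hz => hz.1
    exact ⟨(e.symm.trans e').open_source, fun i j => (h.smooth i j).mono hs,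
      fun z hz => h.symm z (hs hz), fun z hz => h.unit z (hs hz)⟩
  target := g.isMetricOn he'
  mapsTo z hz := e'.map_source hz.2
  smooth := contMDiffOn_iff_contDiffOn.1 (he'.contMDiffOn.comp
    (he.contMDiffOn_symm.mono fun z hz => hz.1) fun z hz => hz.2)
  pullback z hz := by
    have hzt : z ∈ e.target := hz.1
    have hzs : e.symm z ∈ e'.source := hz.2
    have hd : DifferentiableAt ℝ (e' ∘ e.symm) z :=
      ((contMDiffOn_iff_contDiffOn.1 (he'.contMDiffOn.comp
        (he.contMDiffOn_symm.mono fun z hz => hz.1) fun z hz => hz.2)).contDiffAt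
        ((e.symm.trans e').open_source.mem_nhds hz)).differentiableAt (by simp)
    -- The chain rule for `e.symm = e'.symm ∘ (e' ∘ e.symm)`, valid near `z`.
    have hsd : symmDeriv e z = (symmDeriv e' ((e' ∘ e.symm) z)).comp
        (fderiv ℝ (e' ∘ e.symm) z) := by
      have h1 : HasMFDerivAt 𝓘(ℝ, R4) 𝓘(ℝ, R4) (e'.symm ∘ (e' ∘ e.symm)) z _ :=
        (he'.mdifferentiableAt_symm (z := (e' ∘ e.symm) z)
          (e'.map_source hzs)).hasMFDerivAt.comp z
          hd.hasFDerivAt.hasMFDerivAt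
      have h2 : HasMFDerivAt 𝓘(ℝ, R4) 𝓘(ℝ, R4) e.symm z _ := h1.congr_of_eventuallyEq (by
        filter_upwards [(e.symm.trans e').open_source.mem_nhds hz] with y hy
        exact (e'.left_inv hy.2).symm)
      exact h2.mfderiv
    have hx : e'.symm ((e' ∘ e.symm) z) = e.symm z := e'.left_inv hzs
    ext i j
    rw [coord_apply, frameVec, frameVec, hsd, ContinuousLinearMap.comp_apply,
      ContinuousLinearMap.comp_apply, ← g.form_congr hx, form_symmDeriv, mul_assoc,
      Matrix.mul_apply]
    refine Finset.sum_congr rfl fun a _ => ?_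
    rw [Matrix.transpose_apply, Matrix.mul_apply, Finset.mul_sum]
    refine Finset.sum_congr rfl fun b _ => ?_
    rw [jac_apply hd, jac_apply hd]
    ring

/-- The Ricci scalar may be computed in any chart. -/
theorem scalar_coord (he : IsChart e) (hz : z ∈ e.target) :
    scalar (g.coord e) z = g.ricciScalar (e.symm z) := by
  have hc : IsChart (chartAt R4 (e.symm z)) := IsManifold.chart_mem_maximalAtlas _
  exact (g.isCoordChange he hc).scalar_comp ⟨hz, mem_chart_source R4 (e.symm z)⟩

end LorentzMetric

/-! ### Flow boxes adapted to a closed one-form -/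

/-- The field is multiplied by a bump function supported in `U` to make it global. For `δ` small the
flow stays in the ball of radius `R / 4`, where the bump function is `1`, so it is a flow of `v`
itself. -/
theorem exists_smooth_flow_on {v : R4 → R4} {U : Set R4} (hU : IsOpen U) {x₀ : R4} (hx₀ : x₀ ∈ U)
    (hv : ContDiffOn ℝ ∞ v U) :
    ∃ δ > 0, ∃ Φ : R4 × ℝ → R4, ContDiffOn ℝ ∞ Φ (Metric.ball x₀ δ ×ˢ Ioo (-δ) δ) ∧
      MapsTo Φ (Metric.ball x₀ δ ×ˢ Ioo (-δ) δ) U ∧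
      (∀ x ∈ Metric.ball x₀ δ, Φ (x, 0) = x) ∧
      ∀ x ∈ Metric.ball x₀ δ, ∀ s ∈ Ioo (-δ) δ,
        HasDerivAt (fun s => Φ (x, s)) (v (Φ (x, s))) s := by
  obtain ⟨R, hR, hRU⟩ := Metric.isOpen_iff.1 hU x₀ hx₀
  let χ : ContDiffBump x₀ := ⟨R / 4, R / 2, by positivity, by linarith⟩
  have hV : ContDiff ℝ ∞ (fun x => χ x • v x) := by
    rw [contDiff_iff_contDiffAt]
    intro x
    by_cases hx : x ∈ U
    · exact χ.contDiffAt.smul (hv.contDiffAt (hU.mem_nhds hx))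
    · have hx' : x ∉ tsupport χ := by
        rw [χ.tsupport_eq]
        exact fun h => hx (hRU (Metric.closedBall_subset_ball (by simp [χ]; linarith) h))
      have h0 : (fun x => χ x • v x) =ᶠ[nhds x] fun _ => 0 := by
        filter_upwards [(isClosed_tsupport χ).isOpen_compl.mem_nhds hx'] with y hy
        rw [image_eq_zero_of_notMem_tsupport hy, zero_smul]
      exact contDiffAt_const.congr_of_eventuallyEq h0
  obtain ⟨δ₁, hδ₁, Φ, hΦ, hΦ0, hΦd⟩ := exists_smooth_flow hV x₀
  have hO : Metric.ball x₀ δ₁ ×ˢ Ioo (-δ₁) δ₁ ∈ nhds (x₀, (0 : ℝ)) :=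
    (Metric.isOpen_ball.prod isOpen_Ioo).mem_nhds
      ⟨Metric.mem_ball_self hδ₁, by constructor <;> linarith⟩
  have hc : ContinuousAt Φ (x₀, 0) := (hΦ.contDiffAt hO).continuousAt
  have hev : ∀ᶠ p in nhds (x₀, (0 : ℝ)), Φ p ∈ Metric.ball x₀ (R / 4) ∧
      p ∈ Metric.ball x₀ δ₁ ×ˢ Ioo (-δ₁) δ₁ := by
    refine Filter.Eventually.and (hc.eventually_mem ?_) hO
    rw [hΦ0 x₀ (Metric.mem_ball_self hδ₁)]
    exact Metric.ball_mem_nhds _ (by positivity)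
  obtain ⟨δ, hδ, hball⟩ := Metric.eventually_nhds_iff_ball.1 hev
  have hsub : ∀ p ∈ Metric.ball x₀ δ ×ˢ Ioo (-δ) δ, p ∈ Metric.ball (x₀, (0 : ℝ)) δ := by
    intro p hp
    rw [← ball_prod_same]
    exact ⟨hp.1, by rw [Real.ball_eq_Ioo]; simpa using hp.2⟩
  refine ⟨δ, hδ, Φ, hΦ.mono fun p hp => (hball p (hsub p hp)).2, fun p hp => ?_,
    fun x hx => ?_, fun x hx s hs => ?_⟩
  · exact hRU (Metric.ball_subset_ball (by linarith) (hball p (hsub p hp)).1)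
  · exact hΦ0 x (hball (x, 0) (hsub (x, 0) ⟨hx, by constructor <;> linarith⟩)).2.1
  · obtain ⟨h1, h2⟩ := hball (x, s) (hsub (x, s) ⟨hx, hs⟩)
    have := hΦd x h2.1 s h2.2
    rwa [χ.one_of_mem_closedBall (Metric.ball_subset_closedBall h1), one_smul] at this

/-- The Poincaré lemma on a convex set. The potential is smooth because its derivative `η` is. -/
theorem exists_potential {U : Set R4} (hU : IsOpen U) (hconv : Convex ℝ U) {w : Fin 4 → R4 → ℝ}
    (hw : ∀ i, ContDiffOn ℝ ∞ (w i) U) (hcl : ∀ z ∈ U, ∀ i j, pd i (w j) z = pd j (w i) z) :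
    ∃ T : R4 → ℝ, ContDiffOn ℝ ∞ T U ∧
      ∀ z ∈ U, ∀ h : R4, fderiv ℝ T z h = ∑ k, w k z * h k := by
  let η : R4 → R4 →L[ℝ] ℝ := fun z => ∑ k, w k z • (EuclideanSpace.proj k : R4 →L[ℝ] ℝ)
  have hη : ContDiffOn ℝ ∞ η U := ContDiffOn.sum fun k _ => (hw k).smul contDiffOn_const
  have hηa : ∀ z h, η z h = ∑ k, w k z * h k := fun z h => by
    simp [η]
  obtain ⟨T, hT⟩ := hconv.exists_forall_hasFDerivAt_of_fderiv_symmetric hU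
    (hη.differentiableOn (by simp)) (fun a ha x y => by
      have hd : ∀ x y : R4, fderiv ℝ η a x y = ∑ k, ∑ i, x i * pd i (w k) a * y k := by
        intro x y
        have h1 : HasFDerivAt η (∑ k, (fderiv ℝ (w k) a).smulRight
            (EuclideanSpace.proj k : R4 →L[ℝ] ℝ)) a :=
          HasFDerivAt.fun_sum fun k _ =>
            (differentiableAt_of_smooth hU (hw k) ha).hasFDerivAt.smul_const
              (EuclideanSpace.proj k : R4 →L[ℝ] ℝ)
        rw [h1.fderiv]
        simp [fderiv_apply_eq_sum, Finset.sum_mul]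
      rw [hd, hd, Finset.sum_comm]
      refine Finset.sum_congr rfl fun i _ => Finset.sum_congr rfl fun k _ => ?_
      rw [hcl a ha i k]
      ring)
  have hfd : ∀ z ∈ U, fderiv ℝ T z = η z := fun z hz => (hT z hz).fderiv
  refine ⟨T, ?_, fun z hz h => by rw [hfd z hz, hηa]⟩
  have h1 : ContDiffOn ℝ (∞ + 1) T U := by
    rw [contDiffOn_succ_iff_fderiv_of_isOpen hU]
    exact ⟨fun z hz => (hT z hz).differentiableAt.differentiableWithinAt, by simp,
      hη.congr hfd⟩
  exact h1.of_le (by simp)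

theorem norm_sq_eq_spatial (z : R4) : ‖z‖ ^ 2 = z 0 ^ 2 + ‖spatial z‖ ^ 2 := by
  rw [EuclideanSpace.norm_sq_eq, EuclideanSpace.norm_sq_eq, Fin.sum_univ_succ]
  simp [spatial]

theorem continuous_spatial : Continuous spatial := by
  unfold spatial
  fun_prop

/-- The product of an interval and a ball. -/
def coordBox (r : ℝ) : Set R4 := {z | z 0 ∈ Ioo (-r) r ∧ spatial z ∈ Metric.ball 0 r}

theorem isOpen_coordBox (r : ℝ) : IsOpen (coordBox r) :=
  (isOpen_Ioo.preimage (by fun_prop : Continuous fun z : R4 => z 0)).inter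
    (Metric.isOpen_ball.preimage continuous_spatial)

theorem coordBox_subset_ball (r : ℝ) : coordBox r ⊆ Metric.ball 0 (2 * r) := by
  rintro z ⟨h1, h2⟩
  rw [mem_ball_zero_iff] at h2 ⊢
  have hr : 0 < r := (norm_nonneg _).trans_lt h2
  refine lt_of_pow_lt_pow_left₀ 2 (by linarith) ?_
  rw [norm_sq_eq_spatial]
  nlinarith [h1.1, h1.2, norm_nonneg (spatial z)]

theorem zero_mem_coordBox {r : ℝ} (hr : 0 < r) : (0 : R4) ∈ coordBox r := by
  have h : spatial 0 = 0 := by ext i; simp [spatial]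
  exact ⟨by simp [hr], by rw [h]; exact Metric.mem_ball_self hr⟩

/-- A vector field `v` and a closed one-form `w` with `w(v) = -1` can be brought simultaneously to
the form `∂_0` and `-dz⁰`. -/
theorem exists_flowBox {U : Set R4} (hU : IsOpen U) {z₀ : R4} (hz₀ : z₀ ∈ U) {v : R4 → R4}
    {w : Fin 4 → R4 → ℝ} (hv : ContDiffOn ℝ ∞ v U) (hw : ∀ i, ContDiffOn ℝ ∞ (w i) U)
    (hwv : ∀ z ∈ U, ∑ k, w k z * v z k = -1)
    (hcl : ∀ z ∈ U, ∀ i j, pd i (w j) z = pd j (w i) z) :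
    ∃ (Θ : OpenPartialHomeomorph R4 R4) (r : ℝ), 0 < r ∧ Θ.source = coordBox r ∧ Θ.target ⊆ U ∧
      z₀ ∈ Θ.target ∧ ContDiffOn ℝ ∞ Θ Θ.source ∧ ContDiffOn ℝ ∞ Θ.symm Θ.target ∧
      ∀ z ∈ Θ.source, fderiv ℝ Θ z (EuclideanSpace.single 0 1) = v (Θ z) ∧
        ∀ h, ∑ k, w k (Θ z) * fderiv ℝ Θ z h k = -h 0 := by
  obtain ⟨R, hR, hRU⟩ := Metric.isOpen_iff.1 hU z₀ hz₀
  have hB : IsOpen (Metric.ball z₀ R) := Metric.isOpen_ball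
  have hzB : z₀ ∈ Metric.ball z₀ R := Metric.mem_ball_self hR
  -- `T` is a potential of `-w`, so that `T` grows at unit rate along `v`; `hTΦ` integrates this
  -- along the flow.
  obtain ⟨T, hT, hTd⟩ := exists_potential hB (convex_ball z₀ R) (w := fun k z => -w k z)
    (fun k => ((hw k).mono hRU).neg) (fun z hz i j => by
      have : ∀ a b, pd a (fun y => -w b y) z = -pd a (w b) z := fun a b => by simp [pd]
      rw [this, this, hcl z (hRU hz)])
  have hTv : ∀ z ∈ Metric.ball z₀ R, fderiv ℝ T z (v z) = 1 := fun z hz => by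
    rw [hTd z hz]
    simp only [neg_mul, Finset.sum_neg_distrib, hwv z (hRU hz), neg_neg]
  have hTdiff : ∀ z ∈ Metric.ball z₀ R, DifferentiableAt ℝ T z :=
    fun z hz => differentiableAt_of_smooth hB hT hz
  obtain ⟨δ, hδ, Φ, hΦ, hΦB, hΦ0, hΦd⟩ := exists_smooth_flow_on hB hzB (hv.mono hRU)
  have hIδ : (0 : ℝ) ∈ Ioo (-δ) δ := by constructor <;> linarith
  have hzδ : z₀ ∈ Metric.ball z₀ δ := Metric.mem_ball_self hδ
  have hδB : ∀ x ∈ Metric.ball z₀ δ, x ∈ Metric.ball z₀ R := fun x hx => by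
    have := hΦB (⟨hx, hIδ⟩ : (x, (0 : ℝ)) ∈ Metric.ball z₀ δ ×ˢ Ioo (-δ) δ)
    rwa [hΦ0 x hx] at this
  have hTΦ : ∀ x ∈ Metric.ball z₀ δ, ∀ s ∈ Ioo (-δ) δ, T (Φ (x, s)) = T x + s := by
    intro x hx s hs
    have hd : ∀ t ∈ Ioo (-δ) δ, HasDerivAt (fun t => T (Φ (x, t)) - t) 0 t := by
      intro t ht
      have h1 := (hTdiff _ (hΦB (⟨hx, ht⟩ : (x, t) ∈ _ ×ˢ _))).hasFDerivAt.comp_hasDerivAt t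
        (hΦd x hx t ht)
      rw [hTv _ (hΦB (⟨hx, ht⟩ : (x, t) ∈ _ ×ˢ _))] at h1
      have h2 := h1.sub (hasDerivAt_id t)
      rw [sub_self] at h2
      exact h2
    have h := isOpen_Ioo.is_const_of_deriv_eq_zero isPreconnected_Ioo
      (fun t ht => (hd t ht).differentiableAt.differentiableWithinAt)
      (fun t ht => (hd t ht).deriv) hs hIδ
    simp only [hΦ0 x hx, sub_zero] at h
    linarith
  have hv0 : v z₀ ≠ 0 := by
    intro h
    have := hwv z₀ hz₀
    simp [h] at this
  have he0 : (EuclideanSpace.single 0 1 : R4) ≠ 0 := by simp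
  -- `L` sends `e_0` to `v z₀`. Hence `σ = z₀ + L ∘ P`, where `P` deletes the coordinate `z⁰`,
  -- parametrises a hyperplane through `z₀` transversal to `v`.
  obtain ⟨L, hL⟩ := SeparatingDual.exists_continuousLinearEquiv_apply_eq (R := ℝ) he0 hv0
  let P : R4 →L[ℝ] R4 := ContinuousLinearMap.id ℝ R4 -
    (EuclideanSpace.proj 0 : R4 →L[ℝ] ℝ).smulRight (EuclideanSpace.single 0 1)
  have hP : ∀ z, P z = z - z 0 • EuclideanSpace.single 0 (1 : ℝ) := fun z => by simp [P]
  have hPe : P (EuclideanSpace.single 0 1) = 0 := by rw [hP]; simp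
  let σ : R4 → R4 := fun z => z₀ + L (P z)
  have hσ : ContDiff ℝ ∞ σ := contDiff_const.add (L.contDiff.comp P.contDiff)
  have hσ0 : σ 0 = z₀ := by simp [σ]
  have hσe : ∀ (z : R4) (t : ℝ), σ (z + t • EuclideanSpace.single 0 1) = σ z := fun z t => by
    simp only [σ, map_add, map_smul, hPe, smul_zero, add_zero]
  -- The flow time is corrected by the value of `T` on the slice, which makes `T (f z) = T z₀ + z⁰`.
  -- Since `σ` ignores `z⁰`, moving in the `z⁰` direction is still moving along the flow.
  let τ : R4 → ℝ := fun z => z 0 - (T (σ z) - T z₀)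
  let W₁ : Set R4 := σ ⁻¹' Metric.ball z₀ δ
  have hW₁ : IsOpen W₁ := Metric.isOpen_ball.preimage hσ.continuous
  have hτ : ContDiffOn ℝ ∞ τ W₁ := by
    have h1 : ContDiff ℝ ∞ (fun z : R4 => z 0) := by fun_prop
    exact h1.contDiffOn.sub
      ((hT.comp hσ.contDiffOn fun z hz => hδB _ hz).sub contDiffOn_const)
  let W : Set R4 := W₁ ∩ τ ⁻¹' Ioo (-δ) δ
  have hW : IsOpen W := hτ.continuousOn.isOpen_inter_preimage hW₁ isOpen_Ioo
  have hτ0 : τ 0 = 0 := by simp [τ, hσ0]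
  have h0W : (0 : R4) ∈ W := by
    refine ⟨?_, ?_⟩
    · change σ 0 ∈ Metric.ball z₀ δ
      rw [hσ0]
      exact hzδ
    · change τ 0 ∈ Ioo (-δ) δ
      rw [hτ0]
      exact hIδ
  have hmaps : ∀ z ∈ W, (σ z, τ z) ∈ Metric.ball z₀ δ ×ˢ Ioo (-δ) δ := fun z hz => ⟨hz.1, hz.2⟩
  let f : R4 → R4 := fun z => Φ (σ z, τ z)
  have hf : ContDiffOn ℝ ∞ f W :=
    hΦ.comp (hσ.contDiffOn.prodMk (hτ.mono inter_subset_left)) hmaps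
  have hfd : ∀ z ∈ W, HasFDerivAt f (fderiv ℝ f z) z := fun z hz =>
    ((hf.contDiffAt (hW.mem_nhds hz)).differentiableAt (by simp)).hasFDerivAt
  have hfB : ∀ z ∈ W, f z ∈ Metric.ball z₀ R := fun z hz => hΦB (hmaps z hz)
  have hTf : ∀ z ∈ W, T (f z) = T z₀ + z 0 := fun z hz => by
    rw [hTΦ _ (hmaps z hz).1 _ (hmaps z hz).2]
    simp only [τ]
    ring
  have hD2 : ∀ z ∈ W, ∀ h, ∑ k, w k (f z) * fderiv ℝ f z h k = -h 0 := by
    intro z hz h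
    have h1 : HasFDerivAt (fun z => T (f z)) ((fderiv ℝ T (f z)).comp (fderiv ℝ f z)) z :=
      (hTdiff _ (hfB z hz)).hasFDerivAt.comp z (hfd z hz)
    have h2 : HasFDerivAt (fun z => T (f z)) (EuclideanSpace.proj 0 : R4 →L[ℝ] ℝ) z := by
      refine (((EuclideanSpace.proj 0 : R4 →L[ℝ] ℝ).hasFDerivAt.const_add
        (T z₀)).congr_of_eventuallyEq ?_)
      filter_upwards [hW.mem_nhds hz] with y hy
      exact hTf y hy
    have h3 := congrFun (congrArg DFunLike.coe (h1.unique h2)) h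
    rw [ContinuousLinearMap.comp_apply, hTd _ (hfB z hz)] at h3
    simp only [neg_mul, Finset.sum_neg_distrib] at h3
    rw [← neg_eq_iff_eq_neg, h3]
    rfl
  have hD1 : ∀ z ∈ W, fderiv ℝ f z (EuclideanSpace.single 0 1) = v (f z) := by
    intro z hz
    have hline : HasDerivAt (fun t : ℝ => z + t • (EuclideanSpace.single 0 1 : R4))
        (EuclideanSpace.single 0 1) 0 := by
      simpa using ((hasDerivAt_id (0 : ℝ)).smul_const (EuclideanSpace.single 0 1 : R4)).const_add z
    have h1 : HasDerivAt (fun t : ℝ => f (z + t • (EuclideanSpace.single 0 1 : R4)))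
        (fderiv ℝ f z (EuclideanSpace.single 0 1)) 0 := by
      refine HasFDerivAt.comp_hasDerivAt (0 : ℝ) (l := f) ?_ hline
      simpa using hfd z hz
    have h2 : HasDerivAt (fun t : ℝ => f (z + t • (EuclideanSpace.single 0 1 : R4)))
        (v (f z)) 0 := by
      have h3 : (fun t : ℝ => f (z + t • (EuclideanSpace.single 0 1 : R4))) =
          fun t => Φ (σ z, τ z + t) := by
        funext t
        simp only [f, τ, hσe]
        congr 2
        simp
        ring
      rw [h3]
      have h4 := hΦd _ (hmaps z hz).1 _ (hmaps z hz).2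
      rw [← add_zero (τ z)] at h4
      have h5 := h4.comp_const_add (τ z) 0
      simpa [f] using h5
    exact h1.unique h2
  -- A kernel vector `h` has `h⁰ = 0` by `hD2`, so `P h = h`. The chain rule then gives `L (h +
  -- dτ(h) e_0) = 0`, hence `h = -dτ(h) e_0`, and `h⁰ = 0` forces `h = 0`.
  have hinj : Function.Injective (fderiv ℝ f 0) := by
    rw [injective_iff_map_eq_zero]
    intro h hh
    have hh0 : h 0 = 0 := by
      have := hD2 0 h0W h
      rw [hh] at this
      simpa using this
    have hPh : P h = h := by rw [hP, hh0, zero_smul, sub_zero]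
    have hO : Metric.ball z₀ δ ×ˢ Ioo (-δ) δ ∈ nhds (z₀, (0 : ℝ)) :=
      (Metric.isOpen_ball.prod isOpen_Ioo).mem_nhds ⟨hzδ, hIδ⟩
    have hΦf : HasFDerivAt Φ (fderiv ℝ Φ (z₀, 0)) (z₀, 0) :=
      ((hΦ.contDiffAt hO).differentiableAt (by simp)).hasFDerivAt
    have hx : ∀ y : R4, fderiv ℝ Φ (z₀, 0) (y, 0) = y := by
      intro y
      have h1 : HasFDerivAt (fun x : R4 => Φ (x, 0)) ((fderiv ℝ Φ (z₀, 0)).comp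
          (ContinuousLinearMap.inl ℝ R4 ℝ)) z₀ :=
        hΦf.comp z₀ (hasFDerivAt_prodMk_left z₀ (0 : ℝ))
      have h2 : HasFDerivAt (fun x : R4 => Φ (x, 0)) (ContinuousLinearMap.id ℝ R4) z₀ := by
        refine (hasFDerivAt_id z₀).congr_of_eventuallyEq ?_
        filter_upwards [Metric.ball_mem_nhds z₀ hδ] with x hx
        exact hΦ0 x hx
      exact congrFun (congrArg DFunLike.coe (h1.unique h2)) y
    have ht : ∀ c : ℝ, fderiv ℝ Φ (z₀, 0) (0, c) = c • v z₀ := by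
      intro c
      have h1 : HasFDerivAt (fun s : ℝ => Φ (z₀, s)) ((fderiv ℝ Φ (z₀, 0)).comp
          (ContinuousLinearMap.inr ℝ R4 ℝ)) 0 :=
        hΦf.comp (0 : ℝ) (hasFDerivAt_prodMk_right z₀ (0 : ℝ))
      have h2 := hΦd z₀ hzδ 0 hIδ
      rw [hΦ0 z₀ hzδ] at h2
      have := congrFun (congrArg DFunLike.coe (h1.unique h2.hasFDerivAt)) c
      simpa using this
    have hτd : HasFDerivAt τ (fderiv ℝ τ 0) 0 :=
      ((hτ.contDiffAt (hW₁.mem_nhds h0W.1)).differentiableAt (by simp)).hasFDerivAt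
    have hσd : HasFDerivAt σ ((L : R4 →L[ℝ] R4).comp P) 0 :=
      ((L : R4 →L[ℝ] R4).comp P).hasFDerivAt.const_add z₀
    have h1 : HasFDerivAt f ((fderiv ℝ Φ (z₀, 0)).comp
        (((L : R4 →L[ℝ] R4).comp P).prod (fderiv ℝ τ 0))) 0 := by
      refine HasFDerivAt.comp (g := Φ) (0 : R4) ?_ (hσd.prodMk hτd)
      rw [hσ0, hτ0]
      exact hΦf
    have h2 := congrFun (congrArg DFunLike.coe ((hfd 0 h0W).unique h1)) h
    have hsplit : ((L (P h), fderiv ℝ τ 0 h) : R4 × ℝ) = (L (P h), 0) + (0, fderiv ℝ τ 0 h) := by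
      simp
    rw [hh] at h2
    change 0 = fderiv ℝ Φ (z₀, 0) (L (P h), fderiv ℝ τ 0 h) at h2
    rw [hsplit, map_add, hx, ht, ← hL, hPh, ← map_smul, ← map_add] at h2
    have h3 : h + fderiv ℝ τ 0 h • EuclideanSpace.single 0 1 = 0 := by
      apply L.injective
      rw [map_zero]
      exact h2.symm
    have h4 := congrArg (fun y : R4 => y 0) h3
    simp [hh0] at h4
    rw [h4, zero_smul, add_zero] at h3
    exact h3
  let D : R4 ≃L[ℝ] R4 :=
    (LinearEquiv.ofInjectiveEndo (fderiv ℝ f 0).toLinearMap hinj).toContinuousLinearEquiv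
  have hD : HasFDerivAt f (D : R4 →L[ℝ] R4) 0 := hfd 0 h0W
  obtain ⟨e, he, h0e, heW, -, hes⟩ := exists_smooth_openPartialHomeomorph hW h0W hf D hD
  obtain ⟨r, hr, hre⟩ := Metric.isOpen_iff.1 e.open_source 0 h0e
  -- The box is halved because `coordBox s` is only contained in the ball of radius `2 s`.
  have hbox : coordBox (r / 2) ⊆ e.source :=
    (coordBox_subset_ball _).trans (by rwa [mul_div_cancel₀ r two_ne_zero])
  let Θ := e.restrOpen (coordBox (r / 2)) (isOpen_coordBox _)
  have hsrc : Θ.source = coordBox (r / 2) := inter_eq_right.2 hbox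
  have hΘ : ∀ z, Θ z = f z := he
  have hΘf : (Θ : R4 → R4) = f := funext hΘ
  have hsW : ∀ z ∈ Θ.source, z ∈ W := fun z hz => heW hz.1
  refine ⟨Θ, r / 2, by positivity, hsrc, ?_, ?_, ?_, ?_, ?_⟩
  · intro y hy
    have h1 := Θ.map_target hy
    rw [← Θ.right_inv hy, hΘ]
    exact hRU (hfB _ (hsW _ h1))
  · have h1 : (0 : R4) ∈ Θ.source := by rw [hsrc]; exact zero_mem_coordBox (by positivity)
    have h2 := Θ.map_source h1
    have h3 : Θ 0 = z₀ := by
      rw [hΘ]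
      simp only [f, hσ0, hτ0]
      exact hΦ0 z₀ hzδ
    rwa [h3] at h2
  · rw [hΘf]
    exact hf.mono hsW
  · exact hes.mono fun y hy => hy.1
  · intro z hz
    rw [hΘf]
    exact ⟨hD1 z (hsW z hz), hD2 z (hsW z hz)⟩

/-! ### Functions with prescribed partial derivatives -/

/-- The function is constant along the segment from `y` to `z`. Only the derivative in the direction
`z - y` enters, which serves both for functions of time alone and for functions of the spatial
coordinates alone. -/
theorem eq_of_sum_mul_pd_eq_zero {U : Set R4} (hc : Convex ℝ U) {f : R4 → ℝ}
    (hf : ∀ z ∈ U, DifferentiableAt ℝ f z) {y z : R4} (hy : y ∈ U) (hz : z ∈ U)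
    (h : ∀ x ∈ U, ∑ i, (z i - y i) * pd i f x = 0) : f z = f y := by
  have hm : ∀ t ∈ Icc (0 : ℝ) 1, y + t • (z - y) ∈ U := fun t ht =>
    hc.add_smul_sub_mem hy hz ht
  have hd : ∀ t ∈ Icc (0 : ℝ) 1, HasDerivAt (fun t : ℝ => f (y + t • (z - y))) 0 t := by
    intro t ht
    have h1 : HasDerivAt (fun t : ℝ => y + t • (z - y)) (z - y) t := by
      simpa using ((hasDerivAt_id t).smul_const (z - y)).const_add y
    have h2 := (hf _ (hm t ht)).hasFDerivAt.comp_hasDerivAt t h1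
    rw [fderiv_apply_eq_sum] at h2
    simp only [PiLp.sub_apply, h _ (hm t ht)] at h2
    exact h2
  have h1 := constant_of_has_deriv_right_zero (a := (0 : ℝ)) (b := 1)
    (fun t ht => (hd t ht).continuousAt.continuousWithinAt)
    (fun t ht => (hd t ⟨ht.1, ht.2.le⟩).hasDerivWithinAt) 1 (right_mem_Icc.2 zero_le_one)
  simpa using h1

/-- Along each segment from `z₀` inside a small closed ball, where the coefficients are bounded by
compactness, `f` satisfies a linear differential inequality with zero initial value, so Grönwall's
inequality applies. -/
theorem eventually_eq_zero_of_pd_eq_mul {U : Set R4} (hU : IsOpen U) {f : R4 → ℝ}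
    (hf : ∀ z ∈ U, DifferentiableAt ℝ f z) {c : Fin 4 → R4 → ℝ} (hc : ∀ k, ContinuousOn (c k) U)
    (hp : ∀ z ∈ U, ∀ k, pd k f z = c k z * f z) {z₀ : R4} (hz₀ : z₀ ∈ U) (h0 : f z₀ = 0) :
    ∀ᶠ z in nhds z₀, f z = 0 := by
  obtain ⟨r, hr, hrU⟩ := Metric.nhds_basis_closedBall.mem_iff.1 (hU.mem_nhds hz₀)
  have hb : ∀ k, ∃ C, ∀ z ∈ Metric.closedBall z₀ r, ‖c k z‖ ≤ C := fun k =>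
    (isCompact_closedBall z₀ r).exists_bound_of_continuousOn ((hc k).mono hrU)
  choose C hC using hb
  filter_upwards [Metric.closedBall_mem_nhds z₀ hr] with z hz
  have hm : ∀ t ∈ Icc (0 : ℝ) 1, z₀ + t • (z - z₀) ∈ Metric.closedBall z₀ r := fun t ht =>
    (convex_closedBall z₀ r).add_smul_sub_mem (Metric.mem_closedBall_self hr.le) hz ht
  have hd : ∀ t ∈ Icc (0 : ℝ) 1, HasDerivAt (fun t : ℝ => f (z₀ + t • (z - z₀)))
      ((∑ k, (z k - z₀ k) * c k (z₀ + t • (z - z₀))) * f (z₀ + t • (z - z₀))) t := by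
    intro t ht
    have h1 : HasDerivAt (fun t : ℝ => z₀ + t • (z - z₀)) (z - z₀) t := by
      simpa using ((hasDerivAt_id t).smul_const (z - z₀)).const_add z₀
    have h2 := (hf _ (hrU (hm t ht))).hasFDerivAt.comp_hasDerivAt t h1
    rw [fderiv_apply_eq_sum] at h2
    simp only [PiLp.sub_apply, hp _ (hrU (hm t ht)), ← mul_assoc, ← Finset.sum_mul] at h2
    exact h2
  have h1 := eq_zero_of_abs_deriv_le_mul_abs_self_of_eq_zero_right (a := (0 : ℝ)) (b := 1)
    (K := ∑ k, |z k - z₀ k| * C k)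
    (fun t ht => (hd t ht).continuousAt.continuousWithinAt)
    (fun t ht => (hd t ⟨ht.1, ht.2.le⟩).hasDerivWithinAt) (by simpa using h0)
    (fun t ht => by
      rw [norm_mul]
      refine mul_le_mul_of_nonneg_right ((norm_sum_le _ _).trans ?_) (norm_nonneg _)
      refine Finset.sum_le_sum fun k _ => ?_
      rw [norm_mul, Real.norm_eq_abs]
      exact mul_le_mul_of_nonneg_left (hC k _ (hm t ⟨ht.1, ht.2.le⟩)) (abs_nonneg _))
    1 (right_mem_Icc.2 zero_le_one)
  simpa using h1

theorem isChart_chartAt (x : M) : IsChart (chartAt R4 x) := IsManifold.chart_mem_maximalAtlas _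

theorem continuous_of_charts {f : M → ℝ} (hf : ∀ e : OpenPartialHomeomorph M R4, IsChart e →
    ∀ z ∈ e.target, DifferentiableAt ℝ (fun y => f (e.symm y)) z) : Continuous f := by
  rw [continuous_iff_continuousAt]
  intro x
  have hx := mem_chart_source R4 x
  have h1 := (hf _ (isChart_chartAt x) _ (mem_chart_target R4 x)).continuousAt.comp
    ((chartAt R4 x).continuousAt hx)
  refine h1.congr ?_
  filter_upwards [(chartAt R4 x).open_source.mem_nhds hx] with y hy
  simp [(chartAt R4 x).left_inv hy]

/-- A function satisfying `∂_k f = c_k f` in each chart vanishes identically if it vanishes at one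
point of a connected manifold. -/
theorem eq_zero_of_pd_eq_mul [PreconnectedSpace M] {f : M → ℝ}
    (hf : ∀ e : OpenPartialHomeomorph M R4, IsChart e →
      ∀ z ∈ e.target, DifferentiableAt ℝ (fun y => f (e.symm y)) z)
    (hc : ∀ e : OpenPartialHomeomorph M R4, IsChart e → ∃ c : Fin 4 → R4 → ℝ,
      (∀ k, ContinuousOn (c k) e.target) ∧
      ∀ z ∈ e.target, ∀ k, pd k (fun y => f (e.symm y)) z = c k z * f (e.symm z))
    {x₀ : M} (h0 : f x₀ = 0) (x : M) : f x = 0 := by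
  -- The zero set is closed by continuity and open by uniqueness for the linear system; it is
  -- nonempty, hence everything.
  have hcl : IsClosed {x | f x = 0} := isClosed_eq (continuous_of_charts hf) continuous_const
  have hop : IsOpen {x | f x = 0} := by
    rw [isOpen_iff_mem_nhds]
    intro x hx
    obtain ⟨c, hc1, hc2⟩ := hc _ (isChart_chartAt x)
    have hxs := mem_chart_source R4 x
    have h1 := eventually_eq_zero_of_pd_eq_mul (chartAt R4 x).open_target
      (hf _ (isChart_chartAt x)) hc1 hc2 (mem_chart_target R4 x)
      (by rw [(chartAt R4 x).left_inv hxs]; exact hx)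
    filter_upwards [((chartAt R4 x).continuousAt hxs).eventually h1,
      (chartAt R4 x).open_source.mem_nhds hxs] with y hy hys
    rwa [(chartAt R4 x).left_inv hys] at hy
  have h := IsClopen.eq_univ ⟨hcl, hop⟩ ⟨x₀, h0⟩
  exact (h ▸ mem_univ x : x ∈ {x | f x = 0})

theorem eq_of_pd_eq_zero [PreconnectedSpace M] {f : M → ℝ}
    (hf : ∀ e : OpenPartialHomeomorph M R4, IsChart e →
      ∀ z ∈ e.target, DifferentiableAt ℝ (fun y => f (e.symm y)) z)
    (hp : ∀ e : OpenPartialHomeomorph M R4, IsChart e →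
      ∀ z ∈ e.target, ∀ k, pd k (fun y => f (e.symm y)) z = 0) (x x₀ : M) : f x = f x₀ := by
  refine sub_eq_zero.1 (eq_zero_of_pd_eq_mul (f := fun x => f x - f x₀)
    (fun e he z hz => (hf e he z hz).sub_const _) (fun e he => ⟨fun _ _ => 0,
      fun _ => continuousOn_const, fun z hz k => ?_⟩) (sub_self (f x₀)) x)
  rw [pd_sub (hf e he z hz) (by fun_prop), hp e he z hz, pd_const, sub_zero, zero_mul]

/-! ### The box of a time coordinate and three spatial coordinates -/

/-- The point with time coordinate `t` and spatial coordinates `y`. -/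
noncomputable def spacetimePoint (t : ℝ) (y : EuclideanSpace ℝ (Fin 3)) : R4 :=
  WithLp.toLp 2 (Fin.cons t y)

@[simp] theorem spacetimePoint_zero (t : ℝ) (y : EuclideanSpace ℝ (Fin 3)) :
    spacetimePoint t y 0 = t := rfl

@[simp] theorem spacetimePoint_succ (t : ℝ) (y : EuclideanSpace ℝ (Fin 3)) (α : Fin 3) :
    spacetimePoint t y α.succ = y α := rfl

@[simp] theorem spatial_spacetimePoint (t : ℝ) (y : EuclideanSpace ℝ (Fin 3)) :
    spatial (spacetimePoint t y) = y := rfl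

@[simp] theorem spatial_apply (z : R4) (α : Fin 3) : spatial z α = z α.succ := rfl

theorem contDiff_spacetimePoint :
    ContDiff ℝ ∞ fun q : ℝ × EuclideanSpace ℝ (Fin 3) => spacetimePoint q.1 q.2 := by
  refine contDiff_euclidean.2 fun i => ?_
  refine Fin.cases ?_ (fun α => ?_) i
  · exact contDiff_fst
  · exact (contDiff_euclidean.1 contDiff_snd) α

theorem convex_coordBox (r : ℝ) : Convex ℝ (coordBox r) := by
  have h1 : Convex ℝ {z : R4 | z 0 ∈ Ioo (-r) r} :=
    (convex_Ioo (-r) r).is_linear_preimage (f := fun z : R4 => z 0)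
      ⟨fun _ _ => rfl, fun _ _ => rfl⟩
  have h2 : Convex ℝ {z : R4 | spatial z ∈ Metric.ball 0 r} :=
    (convex_ball _ r).is_linear_preimage (f := spatial) ⟨fun _ _ => rfl, fun _ _ => rfl⟩
  exact h1.inter h2

/-- A function on a box with vanishing time derivative depends on the spatial coordinates only. -/
theorem eq_of_pd_time_eq_zero {r : ℝ} {f : R4 → ℝ}
    (hf : ∀ z ∈ coordBox r, DifferentiableAt ℝ f z) (h : ∀ z ∈ coordBox r, pd 0 f z = 0)
    {z : R4} (hz : z ∈ coordBox r) : f z = f (spacetimePoint 0 (spatial z)) := by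
  have hr : 0 < r := by linarith [hz.1.1, hz.1.2]
  refine eq_of_sum_mul_pd_eq_zero (convex_coordBox r) hf ?_ hz fun x hx => ?_
  · exact ⟨by simp [hr], hz.2⟩
  · rw [Fin.sum_univ_succ, h x hx]
    simp

/-- A function on a box with vanishing spatial derivatives depends on the time only. -/
theorem eq_of_pd_spatial_eq_zero {r : ℝ} {f : R4 → ℝ}
    (hf : ∀ z ∈ coordBox r, DifferentiableAt ℝ f z)
    (h : ∀ z ∈ coordBox r, ∀ α : Fin 3, pd α.succ f z = 0)
    {z : R4} (hz : z ∈ coordBox r) : f z = f (spacetimePoint (z 0) 0) := by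
  have hr : 0 < r := by linarith [hz.1.1, hz.1.2]
  refine eq_of_sum_mul_pd_eq_zero (convex_coordBox r) hf ?_ hz fun x hx => ?_
  · exact ⟨hz.1, by simpa using hr⟩
  · rw [Fin.sum_univ_succ]
    simp [h x hx]

/-! ### Charts adapted to a velocity field -/

/-- A unit timelike vector field whose lowered components form a closed one-form is the time
coordinate field of a chart, in which the lowered components are constant. -/
theorem LorentzMetric.exists_adapted_chart (g : LorentzMetric M)
    {u : (x : M) → TangentSpace 𝓘(ℝ, R4) x} (hu : g.UnitTimelike u)
    (hcl : ∀ e : OpenPartialHomeomorph M R4, IsChart e → ∀ z ∈ e.target, ∀ i j,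
      pd i (lower (g.coord e) (vecCoord u e) j) z = pd j (lower (g.coord e) (vecCoord u e) i) z)
    (x : M) :
    ∃ (e : OpenPartialHomeomorph M R4) (r : ℝ), IsChart e ∧ x ∈ e.source ∧ 0 < r ∧
      e.target = coordBox r ∧
      ∀ z ∈ e.target, vecCoord u e z = EuclideanSpace.single 0 1 ∧
        ∀ i, lower (g.coord e) (vecCoord u e) i z = if i = 0 then -1 else 0 := by
  let φ := chartAt R4 x
  have hφ : IsChart φ := isChart_chartAt x
  have hv := hφ.vecCoord_smooth hu.1
  obtain ⟨Θ, r, hr, hsrc, htgt, hx, hΘ, hΘs, hΘd⟩ := exists_flowBox φ.open_target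
    (mem_chart_target R4 x) hv (fun i => (g.isMetricOn hφ).smooth_lower hv i)
    (fun z hz => g.sum_lower_mul hφ hz hu) (hcl φ hφ)
  let e := φ.trans Θ.symm
  have het : e.target = coordBox r := by
    rw [← hsrc]
    refine inter_eq_left.2 fun z hz => htgt (Θ.map_source hz)
  have he : IsChart e := by
    refine OpenPartialHomeomorph.mem_maximalAtlas_of_contMDiffOn e ?_ ?_
    · exact (contMDiffOn_iff_contDiffOn.2 hΘs).comp (hφ.contMDiffOn.mono fun y hy => hy.1)
        fun y hy => hy.2
    · exact hφ.contMDiffOn_symm.comp ((contMDiffOn_iff_contDiffOn.2 hΘ).mono fun y hy => hy.1)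
        fun y hy => hy.2
  have hsd : ∀ z ∈ e.target, symmDeriv e z = (symmDeriv φ (Θ z)).comp (fderiv ℝ Θ z) := by
    intro z hz
    have hd : DifferentiableAt ℝ Θ z :=
      (hΘ.contDiffAt (Θ.open_source.mem_nhds hz.1)).differentiableAt (by simp)
    have h1 : HasMFDerivAt 𝓘(ℝ, R4) 𝓘(ℝ, R4) (φ.symm ∘ Θ) z _ :=
      (hφ.mdifferentiableAt_symm hz.2).hasMFDerivAt.comp z hd.hasFDerivAt.hasMFDerivAt
    exact h1.mfderiv
  refine ⟨e, r, he, ⟨mem_chart_source R4 x, hx⟩, hr, het, fun z hz => ?_⟩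
  have hz1 : z ∈ Θ.source := hz.1
  have hz2 : Θ z ∈ φ.target := hz.2
  have hu0 : symmDeriv φ (Θ z) (vecCoord u φ (Θ z)) = toModel u (e.symm z) := by
    rw [vecCoord_eq, hφ.symmDeriv_toDeriv hz2]
    rfl
  constructor
  · have h1 : symmDeriv e z (EuclideanSpace.single 0 1) = toModel u (e.symm z) := by
      rw [← hu0, ← (hΘd z hz1).1, hsd z hz]
      rfl
    rw [vecCoord_eq, ← h1, he.toDeriv_symmDeriv hz]
  · intro i
    rw [g.lower_vecCoord he hz, ← hu0, frameVec, hsd z hz, ContinuousLinearMap.comp_apply]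
    refine (g.form_symmDeriv φ (Θ z) _ _).trans ?_
    have h1 := (hΘd z hz1).2 (EuclideanSpace.single i 1)
    have h2 : ∀ a, ∑ j, g.coord φ (Θ z) a j * fderiv ℝ Θ z (EuclideanSpace.single i 1) a *
        vecCoord u φ (Θ z) j = lower (g.coord φ) (vecCoord u φ) a (Θ z) *
          fderiv ℝ Θ z (EuclideanSpace.single i 1) a := fun a => by
      rw [lower, Finset.sum_mul]
      exact Finset.sum_congr rfl fun j _ => by ring
    simp only [h2, h1]
    by_cases hi : i = 0
    · simp [hi]
    · simp [hi, Ne.symm hi]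

/-! ### Warped products -/

/-- Both `h_ji` and `Γ^l_ji` are symmetric in `i` and `j`, so the lowered field is a closed
one-form. -/
theorem IsMetricOn.pd_lower_symm {g : Comp} {U : Set R4} {z : R4} {v : R4 → R4} {φ : ℝ}
    (hg : IsMetricOn g U) (hz : z ∈ U) (hN : ∀ j i, nabla g v j i z = φ * proj g v j i z)
    (i j : Fin 4) : pd i (lower g v j) z = pd j (lower g v i) z := by
  have h1 := hN i j
  have h2 := hN j i
  have h3 : proj g v i j z = proj g v j i z := by
    simp only [proj, hg.apply_symm hz i j]; ring
  have h4 : ∀ l, christoffel g l i j z = christoffel g l j i z :=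
    fun l => hg.christoffel_symm hz l i j
  simp only [nabla, h4] at h1 h2
  rw [h3] at h1
  linarith

/-- In comoving coordinates a purely expanding velocity field rescales the spatial metric. -/
theorem IsMetricOn.pd_time_metric {g : Comp} {U : Set R4} {z : R4} {v : R4 → R4} {φ : ℝ}
    (hg : IsMetricOn g U) (hz : z ∈ U) (hN : ∀ j i, nabla g v j i z = φ * proj g v j i z)
    (hv : ∀ z ∈ U, v z = EuclideanSpace.single 0 1)
    (hw : ∀ z ∈ U, ∀ i, lower g v i z = if i = 0 then -1 else 0) (α β : Fin 3) :
    pd 0 (fun y => g y α.succ β.succ) z = 2 * φ * g z α.succ β.succ := by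
  have h0 : ∀ y ∈ U, ∀ i, g y i 0 = if i = 0 then -1 else 0 := fun y hy i => by
    rw [← hw y hy i, lower, hv y hy]
    simp
  have h0' : ∀ y ∈ U, ∀ i, g y 0 i = if i = 0 then -1 else 0 := fun y hy i => by
    rw [hg.apply_symm hy, h0 y hy]
  have hp : ∀ j i, pd j (fun y => g y 0 i) z = 0 := fun j i => by
    rw [pd_congr hg.isOpen (f' := fun _ => if i = 0 then -1 else 0) (fun y hy => h0' y hy i) hz,
      pd_const]
  -- The components `g_0i` are constant, so `Γ^0_αβ = ½ ∂_0 g_αβ`. The components of the lowered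
  -- field are constant too, so `∇_α v_β = Γ^0_αβ`, which by `hN` equals `φ g_αβ`.
  have h1 := hg.mul_conn_apply hz α.succ 0 β.succ
  have h2 := hN α.succ β.succ
  have h3 : pd α.succ (lower g v β.succ) z = 0 := by
    rw [pd_congr hg.isOpen (f' := fun _ => if β.succ = 0 then -1 else 0)
      (fun y hy => hw y hy β.succ) hz, pd_const]
  rw [hp, hp, Matrix.mul_apply] at h1
  simp only [h0' z hz, conn, Matrix.of_apply] at h1
  simp only [nabla, proj, h3, hw z hz] at h2
  simp at h1 h2
  linarith

namespace LorentzMetric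

variable (g : LorentzMetric M) {u : (x : M) → TangentSpace 𝓘(ℝ, R4) x}

/-- A spacetime with a velocity field `u` satisfying `∇_j u_i = (θ / 3) h_ji` is locally a warped
product, if the expansion `θ` is three times the logarithmic derivative along `u` of a function `a`
that is constant on the orthogonal complement of `u`. -/
theorem isGRW_of_nabla (hu : g.UnitTimelike u) {a : M → ℝ} (ha : ∀ x, 0 < a x)
    (hs : ∀ e : OpenPartialHomeomorph M R4, IsChart e →
      ContDiffOn ℝ ∞ (fun z => a (e.symm z)) e.target)
    (hd : ∀ e : OpenPartialHomeomorph M R4, IsChart e → ∀ z ∈ e.target, ∀ k,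
      pd k (fun z => a (e.symm z)) z = -(expansion (g.coord e) (vecCoord u e) z / 3 *
        a (e.symm z) * lower (g.coord e) (vecCoord u e) k z))
    (hN : ∀ e : OpenPartialHomeomorph M R4, IsChart e → ∀ z ∈ e.target, ∀ j i,
      nabla (g.coord e) (vecCoord u e) j i z = expansion (g.coord e) (vecCoord u e) z / 3 *
        proj (g.coord e) (vecCoord u e) j i z) : g.IsGRW u a := by
  intro x
  obtain ⟨e, r, he, hx, hr, het, hew⟩ := g.exists_adapted_chart hu
    (fun e he z hz i j => (g.isMetricOn he).pd_lower_symm hz (hN e he z hz) i j) x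
  have hg := g.isMetricOn he
  have hv : ∀ z ∈ e.target, vecCoord u e z = EuclideanSpace.single 0 1 := fun z hz => (hew z hz).1
  have hw : ∀ z ∈ e.target, ∀ i, lower (g.coord e) (vecCoord u e) i z = if i = 0 then -1 else 0 :=
    fun z hz => (hew z hz).2
  have h0 : ∀ z ∈ e.target, ∀ i, g.coord e z i 0 = if i = 0 then -1 else 0 := fun z hz i => by
    rw [← hw z hz i, lower, hv z hz]
    simp
  have h0' : ∀ z ∈ e.target, ∀ i, g.coord e z 0 i = if i = 0 then -1 else 0 := fun z hz i => by
    rw [hg.apply_symm hz, h0 z hz]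
  let b : R4 → ℝ := fun z => a (e.symm z)
  have hb : ContDiffOn ℝ ∞ b e.target := hs e he
  have hbpos : ∀ z, 0 < b z := fun z => ha _
  have hbd : ∀ z ∈ e.target, DifferentiableAt ℝ b z :=
    fun z hz => differentiableAt_of_smooth hg.isOpen hb hz
  have hb0 : ∀ z ∈ e.target, pd 0 b z = expansion (g.coord e) (vecCoord u e) z / 3 * b z := by
    intro z hz
    rw [hd e he z hz, hw z hz]
    simp [b]
  have hbα : ∀ z ∈ e.target, ∀ α : Fin 3, pd α.succ b z = 0 := by
    intro z hz α
    rw [hd e he z hz, hw z hz]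
    simp
  -- The candidate for the spatial metric `γ`. Numerator and denominator have the same logarithmic
  -- time derivative, so it does not depend on time.
  let G : Fin 3 → Fin 3 → R4 → ℝ := fun α β z => g.coord e z α.succ β.succ / b z ^ 2
  have hG : ∀ α β, ContDiffOn ℝ ∞ (G α β) e.target := fun α β =>
    (hg.smooth _ _).div (hb.pow 2) fun z _ => (pow_pos (hbpos z) 2).ne'
  have hGd : ∀ α β, ∀ z ∈ e.target, DifferentiableAt ℝ (G α β) z :=
    fun α β z hz => differentiableAt_of_smooth hg.isOpen (hG α β) hz
  have hG0 : ∀ α β, ∀ z ∈ e.target, pd 0 (G α β) z = 0 := by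
    intro α β z hz
    have h1 := hg.pd_time_metric hz (hN e he z hz) hv hw α β
    have h2 : pd 0 (fun y => G α β y * (b y * b y)) z =
        pd 0 (fun y => g.coord e y α.succ β.succ) z := by
      congr 1
      funext y
      have := (hbpos y).ne'
      simp only [G]
      field_simp
    rw [pd_mul (hGd α β z hz) ((hbd z hz).fun_mul (hbd z hz)), pd_mul (hbd z hz) (hbd z hz), h1,
      hb0 z hz] at h2
    have h3 : G α β z * (b z * b z) = g.coord e z α.succ β.succ := by
      have := (hbpos z).ne'
      simp only [G]
      field_simp
    have h4 : pd 0 (G α β) z * (b z * b z) = 0 := by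
      rw [← h3] at h2
      linear_combination h2
    exact (mul_eq_zero.1 h4).resolve_right (mul_pos (hbpos z) (hbpos z)).ne'
  have hst : ∀ z ∈ e.target, b z = b (spacetimePoint (z 0) 0) := fun z hz => by
    rw [het] at hbd hbα hz
    exact eq_of_pd_spatial_eq_zero hbd hbα hz
  have hγ : ∀ α β, ∀ z ∈ e.target, G α β z = G α β (spacetimePoint 0 (spatial z)) :=
    fun α β z hz => by
      rw [het] at hGd hG0 hz
      exact eq_of_pd_time_eq_zero (hGd α β) (hG0 α β) hz
  have hmt : ∀ t ∈ Ioo (-r) r, spacetimePoint t 0 ∈ e.target := fun t ht => by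
    rw [het]
    exact ⟨ht, by simpa using hr⟩
  have hmy : ∀ y ∈ Metric.ball (0 : EuclideanSpace ℝ (Fin 3)) r,
      spacetimePoint 0 y ∈ e.target := fun y hy => by
    rw [het]
    exact ⟨by simpa using hr, hy⟩
  refine ⟨e, hx, he, -r, r, Metric.ball 0 r, fun t => b (spacetimePoint t 0),
    fun y => Matrix.of fun α β => G α β (spacetimePoint 0 y), Metric.isOpen_ball,
    Metric.isConnected_ball hr, ?_, fun t _ => hbpos _, fun α β => ?_, fun y hy => ?_, het,
    fun z hz => ⟨?_, fun α => ⟨?_, ?_⟩, fun α β => ?_, hv z hz, hst z hz⟩⟩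
  · exact hb.comp (contDiff_spacetimePoint.comp (contDiff_id.prodMk contDiff_const)).contDiffOn hmt
  · exact (hG α β).comp (contDiff_spacetimePoint.comp
      (contDiff_const.prodMk contDiff_id)).contDiffOn hmy
  · have hz := hmy y hy
    set z := spacetimePoint 0 y
    refine Matrix.PosDef.of_dotProduct_mulVec_pos ?_ fun c hc => ?_
    · ext α β
      simp only [Matrix.conjTranspose_apply, Matrix.of_apply, star_trivial, G]
      rw [hg.apply_symm hz]
    -- A nonzero spatial vector corresponds to a nonzero tangent vector orthogonal to `u`, on which
    -- the metric is positive by `form_pos`.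
    · let c' : R4 := spacetimePoint 0 (WithLp.toLp 2 c)
      have hT : symmDeriv e z (EuclideanSpace.single 0 1) = toModel u (e.symm z) := by
        rw [← hv z hz, vecCoord_eq, he.symmDeriv_toDeriv hz]
      have h1 : g.form (e.symm z) (toModel u (e.symm z)) (symmDeriv e z c') = 0 := by
        rw [← hT, form_symmDeriv, Fin.sum_univ_succ]
        simp [h0' z hz, c']
      have h2 : symmDeriv e z c' ≠ 0 := by
        intro h
        apply hc
        have h3 := he.toDeriv_symmDeriv hz c'
        rw [h, map_zero] at h3
        funext α
        have := congrArg (fun w : R4 => w α.succ) h3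
        exact this.symm
      have h3 := g.form_pos (hu.2 (e.symm z)) h1 h2
      have h4 : g.form (e.symm z) (symmDeriv e z c') (symmDeriv e z c') =
          b z ^ 2 * (star c ⬝ᵥ (Matrix.of fun α β => G α β z) *ᵥ c) := by
        have hb1 := (hbpos z).ne'
        rw [form_symmDeriv, Fin.sum_univ_succ]
        simp only [Fin.sum_univ_succ (n := 3), c', spacetimePoint_zero, spacetimePoint_succ,
          mul_zero, zero_mul, zero_add, add_zero, Finset.sum_const_zero, dotProduct,
          Matrix.mulVec, Finset.mul_sum, Matrix.of_apply, star_trivial, Pi.star_apply]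
        refine Finset.sum_congr rfl fun α _ => Finset.sum_congr rfl fun β _ => ?_
        simp only [G]
        field_simp
      rw [h4] at h3
      exact (mul_pos_iff_of_pos_left (pow_pos (hbpos z) 2)).1 h3
  · simp [h0 z hz]
  · simp [h0' z hz]
  · simp [h0 z hz]
  · change _ = b (spacetimePoint (z 0) 0) ^ 2 * G α β (spacetimePoint 0 (spatial z))
    rw [← hγ α β z hz, ← hst z hz]
    have := (hbpos z).ne'
    simp only [G]
    field_simp

end LorentzMetric

/-! ### Perfect-fluid solutions with constant Ricci scalar -/

theorem IsMetricOn.smooth_nabla {g : Comp} {U : Set R4} {v : R4 → R4} (hg : IsMetricOn g U)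
    (hv : ContDiffOn ℝ ∞ v U) (j i : Fin 4) : ContDiffOn ℝ ∞ (nabla g v j i) U :=
  (smooth_pd hg.isOpen (hg.smooth_lower hv i) j).sub
    (ContDiffOn.sum fun l _ => (hg.smooth_conn j l i).mul (hg.smooth_lower hv l))

theorem IsMetricOn.smooth_expansion {g : Comp} {U : Set R4} {v : R4 → R4} (hg : IsMetricOn g U)
    (hv : ContDiffOn ℝ ∞ v U) : ContDiffOn ℝ ∞ (expansion g v) U :=
  ContDiffOn.sum fun k _ => ContDiffOn.sum fun l _ => (hg.smooth_inv k l).mul (hg.smooth_nabla hv k l)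

theorem hess_of_eqOn_const {g : Comp} {U : Set R4} (hU : IsOpen U) {f : R4 → ℝ} {c : ℝ}
    (hf : ∀ z ∈ U, f z = c) {z : R4} (hz : z ∈ U) (i j : Fin 4) : hess g f i j z = 0 := by
  have h1 : ∀ y ∈ U, ∀ k, pd k f y = 0 := fun y hy k => by
    rw [pd_congr hU (f' := fun _ => c) hf hy, pd_const]
  rw [hess, pd_congr hU (f' := fun _ => 0) (fun y hy => h1 y hy j) hz, pd_const]
  simp [h1 z hz]

namespace LorentzMetric

variable {g : LorentzMetric M} {u : (x : M) → TangentSpace 𝓘(ℝ, R4) x} {p ρ : M → ℝ} {F : ℝ → ℝ} {κ K : ℝ}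
  {e : OpenPartialHomeomorph M R4} {z : R4}

/-- The Ricci tensor of a projectively harmonic metric is a Codazzi tensor. -/
theorem ProjectivelyHarmonic.covRicci_comm (h : g.ProjectivelyHarmonic) (he : IsChart e)
    (hz : z ∈ e.target) (i j k : Fin 4) :
    covRicci (g.coord e) j i k z = covRicci (g.coord e) k i j z := by
  have h1 := h e he z hz i j k
  rw [(g.isMetricOn he).divProjCurv_eq hz] at h1
  linarith

/-- A projectively harmonic metric has constant Ricci scalar. -/
theorem ProjectivelyHarmonic.ricciScalar_eq [PreconnectedSpace M] (h : g.ProjectivelyHarmonic)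
    (x y : M) : g.ricciScalar x = g.ricciScalar y := by
  have hc : ∀ e : OpenPartialHomeomorph M R4, IsChart e →
      EqOn (fun z => g.ricciScalar (e.symm z)) (scalar (g.coord e)) e.target :=
    fun e he z hz => (g.scalar_coord he hz).symm
  refine eq_of_pd_eq_zero (fun e he z hz => ?_) (fun e he z hz k => ?_) x y
  · exact differentiableAt_of_smooth e.open_target
      ((g.isMetricOn he).smooth_scalar.congr (hc e he)) hz
  · rw [pd_congr e.open_target (hc e he) hz]
    exact (g.isMetricOn he).pd_scalar_eq_zero hz (h.covRicci_comm he hz) k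

/-- The field equations at constant Ricci scalar. -/
theorem FieldEquations.of_const (h : g.FieldEquations F κ u p ρ) (hK : ∀ x, g.ricciScalar x = K)
    (he : IsChart e) (hz : z ∈ e.target) (i j : Fin 4) :
    deriv F K * ricci (g.coord e) i j z = (F K / 2 + κ ^ 2 * p (e.symm z)) * g.coord e z i j +
      κ ^ 2 * (p (e.symm z) + ρ (e.symm z)) * (lower (g.coord e) (vecCoord u e) i z *
        lower (g.coord e) (vecCoord u e) j z) := by
  have hs : ∀ y ∈ e.target, scalar (g.coord e) y = K := fun y hy => by
    rw [g.scalar_coord he hy, hK]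
  have hh : ∀ i j, hess (g.coord e) (fun y => deriv F (scalar (g.coord e) y)) i j z = 0 :=
    hess_of_eqOn_const e.open_target (c := deriv F K) (fun y hy => by rw [hs y hy]) hz
  have h1 := h e he z hz i j
  simp only [hs z hz, box, hh, mul_zero, Finset.sum_const_zero, sub_zero, add_zero, proj] at h1
  linarith

/-- If `F_R` vanishes at the constant Ricci scalar, the fluid is a cosmological constant. -/
theorem FieldEquations.add_eq_zero (h : g.FieldEquations F κ u p ρ)
    (hK : ∀ x, g.ricciScalar x = K) (hu : g.UnitTimelike u) (hκ : κ ≠ 0) (hF : deriv F K = 0)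
    (x : M) : p x + ρ x = 0 := by
  have he := isChart_chartAt x
  have hz := mem_chart_target R4 x
  have h1 := (g.isMetricOn he).coeff_eq_zero_of_fluid hz (g.sum_lower_mul he hz hu)
    fun i j => (h.of_const hK he hz i j).symm.trans (by rw [hF, zero_mul])
  rw [(chartAt R4 x).left_inv (mem_chart_source R4 x)] at h1
  exact (mul_eq_zero.1 h1).resolve_left (pow_ne_zero 2 hκ)

/-- The trace of the reduced field equations: `F_R R = 4 (F/2 + κ² p) - κ² (p + ρ)`. Consequently
the quantity in the scale factor has a definite sign wherever `p + ρ` has one. -/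
theorem FieldEquations.fluidTerm_eq (h : g.FieldEquations F κ u p ρ)
    (hK : ∀ x, g.ricciScalar x = K) (hu : g.UnitTimelike u) (x : M) :
    g.fluidTerm F κ ρ x = 3 * κ ^ 2 * (p x + ρ x) := by
  have he := isChart_chartAt x
  have hz := mem_chart_target R4 x
  have h1 := (g.isMetricOn he).trace_of_fluid hz (g.sum_lower_mul he hz hu)
    (h.of_const hK he hz)
  have h2 : deriv F K * scalar (g.coord (chartAt R4 x)) (chartAt R4 x x) =
      4 * (F K / 2 + κ ^ 2 * p x) - κ ^ 2 * (p x + ρ x) := by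
    rw [(chartAt R4 x).left_inv (mem_chart_source R4 x)] at h1
    rw [← h1, scalar]
    simp only [Finset.mul_sum]
    exact Finset.sum_congr rfl fun i _ => Finset.sum_congr rfl fun k _ => by ring
  rw [g.scalar_coord he hz, hK] at h2
  rw [fluidTerm, hK]
  linarith

/-- The conservation law of the enthalpy density `p + ρ`, and the covariant derivative of the
velocity. -/
theorem FieldEquations.fluid_equations (h : g.FieldEquations F κ u p ρ)
    (hK : ∀ x, g.ricciScalar x = K) (hF : deriv F K ≠ 0) (hu : g.UnitTimelike u)
    (hharm : g.ProjectivelyHarmonic)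
    (hp : ContMDiff 𝓘(ℝ, R4) 𝓘(ℝ) ∞ p) (hρ : ContMDiff 𝓘(ℝ, R4) 𝓘(ℝ) ∞ ρ) (hκ : κ ≠ 0)
    (he : IsChart e) (hz : z ∈ e.target) :
    (∀ k, pd k (fun y => p (e.symm y) + ρ (e.symm y)) z =
      4 / 3 * expansion (g.coord e) (vecCoord u e) z * (p (e.symm z) + ρ (e.symm z)) *
        lower (g.coord e) (vecCoord u e) k z) ∧
    (p (e.symm z) + ρ (e.symm z) ≠ 0 → ∀ j i, nabla (g.coord e) (vecCoord u e) j i z =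
      expansion (g.coord e) (vecCoord u e) z / 3 * proj (g.coord e) (vecCoord u e) j i z) := by
  have hp' := he.comp_symm_smooth hp
  have hq' := hp'.add (he.comp_symm_smooth hρ)
  -- The constant ratio of the coefficient `β` of the Ricci tensor to `p + ρ`; it is cancelled from
  -- both conclusions of `codazzi_fluid`.
  have hc : κ ^ 2 / deriv F K ≠ 0 := div_ne_zero (pow_ne_zero 2 hκ) hF
  obtain ⟨h1, h2⟩ := (g.isMetricOn he).codazzi_fluid hz (he.vecCoord_smooth hu.1)
    (fun z hz => g.sum_lower_mul he hz hu) (fun z hz => hharm.covRicci_comm he hz)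
    (α := fun y => (F K / 2 + κ ^ 2 * p (e.symm y)) / deriv F K)
    (β := fun y => κ ^ 2 / deriv F K * (p (e.symm y) + ρ (e.symm y)))
    ((contDiffOn_const.add (contDiffOn_const.mul hp')).div_const _) (contDiffOn_const.mul hq')
    (fun z hz i k => by
      have := h.of_const hK he hz i k
      field_simp
      linarith)
  refine ⟨fun k => ?_, fun hq j i => mul_left_cancel₀ (mul_ne_zero hc hq) (h2 j i)⟩
  have h3 := h1 k
  rw [pd_const_mul (differentiableAt_of_smooth e.open_target hq' hz)] at h3
  refine mul_left_cancel₀ hc (h3.trans ?_)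
  ring

/-- A projectively harmonic perfect-fluid solution of `F(R)` gravity has the equation of state
`p + ρ = 0` or is locally a generalized Robertson–Walker spacetime. -/
theorem FieldEquations.add_eq_zero_or_isGRW [ConnectedSpace M] (hfield : g.FieldEquations F κ u p ρ)
    (hharm : g.ProjectivelyHarmonic) (hu : g.UnitTimelike u)
    (hp : ContMDiff 𝓘(ℝ, R4) 𝓘(ℝ) ∞ p) (hρ : ContMDiff 𝓘(ℝ, R4) 𝓘(ℝ) ∞ ρ) (hκ : κ ≠ 0) :
    (∀ x, p x + ρ x = 0) ∨
    ∃ (A : ℝ) (a : M → ℝ),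
      (∀ x, 0 < A / g.fluidTerm F κ ρ x) ∧
      (∀ x, a x = (A / g.fluidTerm F κ ρ x) ^ (1 / 4 : ℝ)) ∧
      g.IsGRW u a ∧
      ∀ e : OpenPartialHomeomorph M R4, IsChart e → ∀ z ∈ e.target,
        (∀ i j, shear (g.coord e) (vecCoord u e) i j z = 0) ∧
        (∀ i j, vorticity (g.coord e) (vecCoord u e) i j z = 0) ∧
        (∀ i, acceleration (g.coord e) (vecCoord u e) i z = 0) ∧
        (∀ j i, nabla (g.coord e) (vecCoord u e) j i z =
          dotCoord u a e z / a (e.symm z) * proj (g.coord e) (vecCoord u e) j i z) := by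
  obtain ⟨x₀⟩ : Nonempty M := inferInstance
  obtain ⟨K, hK⟩ : ∃ K, ∀ x, g.ricciScalar x = K :=
    ⟨g.ricciScalar x₀, fun x => hharm.ricciScalar_eq x x₀⟩
  by_cases hFK : deriv F K = 0
  · exact Or.inl (hfield.add_eq_zero hK hu hκ hFK)
  have hfl : ∀ {e : OpenPartialHomeomorph M R4}, IsChart e → ∀ {z}, z ∈ e.target → _ :=
    fun he _ hz => hfield.fluid_equations hK hFK hu hharm hp hρ hκ he hz
  have hqs : ∀ e : OpenPartialHomeomorph M R4, IsChart e →
      ContDiffOn ℝ ∞ (fun z => p (e.symm z) + ρ (e.symm z)) e.target :=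
    fun e he => (he.comp_symm_smooth hp).add (he.comp_symm_smooth hρ)
  have hqd : ∀ e : OpenPartialHomeomorph M R4, IsChart e → ∀ z ∈ e.target,
      DifferentiableAt ℝ (fun z => p (e.symm z) + ρ (e.symm z)) z :=
    fun e he z hz => differentiableAt_of_smooth e.open_target (hqs e he) hz
  by_cases hzero : ∃ x, p x + ρ x = 0
  · obtain ⟨x₁, hx₁⟩ := hzero
    -- The conservation law is a homogeneous linear first-order system for `p + ρ`, so a single zero
    -- propagates to the whole manifold.
    refine Or.inl (eq_zero_of_pd_eq_mul (f := fun x => p x + ρ x) hqd (fun e he => ?_) hx₁)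
    have hg := g.isMetricOn he
    have hv := he.vecCoord_smooth hu.1
    refine ⟨fun k z => 4 / 3 * expansion (g.coord e) (vecCoord u e) z *
      lower (g.coord e) (vecCoord u e) k z, fun k => ?_, fun z hz k => ?_⟩
    · exact ((contDiffOn_const.mul (hg.smooth_expansion hv)).mul
        (hg.smooth_lower hv k)).continuousOn
    · rw [(hfl he hz).1 k]
      ring
  push Not at hzero
  -- A continuous nowhere vanishing function on a connected space has constant sign. Normalising by
  -- the value at `x₀` handles both signs and gives `A = 3 κ² (p x₀ + ρ x₀)`.
  have hpos : ∀ x, 0 < (p x₀ + ρ x₀) / (p x + ρ x) := by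
    intro x
    have hcont : Continuous fun x => p x + ρ x := hp.continuous.add hρ.continuous
    have hno : (0 : ℝ) ∉ range fun x => p x + ρ x := fun ⟨y, hy⟩ => hzero y hy
    rcases lt_or_gt_of_ne (hzero x₀) with h1 | h1 <;> rcases lt_or_gt_of_ne (hzero x) with h2 | h2
    · exact div_pos_of_neg_of_neg h1 h2
    · exact absurd (mem_range_of_exists_le_of_exists_ge hcont ⟨x₀, h1.le⟩ ⟨x, h2.le⟩) hno
    · exact absurd (mem_range_of_exists_le_of_exists_ge hcont ⟨x, h2.le⟩ ⟨x₀, h1.le⟩) hno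
    · exact div_pos h1 h2
  have hft : ∀ x, 3 * κ ^ 2 * (p x₀ + ρ x₀) / g.fluidTerm F κ ρ x =
      (p x₀ + ρ x₀) / (p x + ρ x) := fun x => by
    rw [hfield.fluidTerm_eq hK hu, mul_div_mul_left _ _ (by positivity)]
  set a : M → ℝ := fun x => ((p x₀ + ρ x₀) / (p x + ρ x)) ^ (1 / 4 : ℝ) with ha
  have hapos : ∀ x, 0 < a x := fun x => Real.rpow_pos_of_pos (hpos x) _
  have ha4 : ∀ x, a x ^ 4 * (p x + ρ x) = p x₀ + ρ x₀ := fun x => by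
    rw [ha, ← Real.rpow_natCast, ← Real.rpow_mul (hpos x).le]
    norm_num
    exact div_mul_cancel₀ _ (hzero x)
  have has : ∀ e : OpenPartialHomeomorph M R4, IsChart e →
      ContDiffOn ℝ ∞ (fun z => a (e.symm z)) e.target := fun e he =>
    (contDiffOn_const.div (hqs e he) fun z _ => hzero _).rpow_const_of_ne fun z _ => (hpos _).ne'
  have had : ∀ e : OpenPartialHomeomorph M R4, IsChart e → ∀ z ∈ e.target, ∀ k,
      pd k (fun z => a (e.symm z)) z = -(expansion (g.coord e) (vecCoord u e) z / 3 *
        a (e.symm z) * lower (g.coord e) (vecCoord u e) k z) := by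
    intro e he z hz k
    have h1 := differentiableAt_of_smooth e.open_target (has e he) hz
    -- The gradient of `a` follows by differentiating `a⁴ (p + ρ) = const` and inserting the
    -- conservation law; the exponent `1/4` turns the factor `4/3` into `1/3`.
    have h2 : pd k (fun y => a (e.symm y) ^ 4 * (p (e.symm y) + ρ (e.symm y))) z = 0 := by
      simp only [ha4, pd_const]
    have h4 : ∀ y : R4, a (e.symm y) ^ 4 = (a (e.symm y) * a (e.symm y)) *
      (a (e.symm y) * a (e.symm y)) := fun y => by ring
    simp only [h4] at h2
    have h5 := h1.fun_mul h1
    rw [pd_mul (h5.fun_mul h5) (hqd e he z hz), pd_mul h5 h5, pd_mul h1 h1,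
      (hfl he hz).1 k] at h2
    have h6 : 4 * a (e.symm z) ^ 3 * (p (e.symm z) + ρ (e.symm z)) ≠ 0 :=
      mul_ne_zero (mul_ne_zero four_ne_zero (pow_ne_zero 3 (hapos _).ne')) (hzero _)
    refine mul_left_cancel₀ h6 ?_
    linear_combination h2
  have hN : ∀ e : OpenPartialHomeomorph M R4, IsChart e → ∀ z ∈ e.target, ∀ j i,
      nabla (g.coord e) (vecCoord u e) j i z = expansion (g.coord e) (vecCoord u e) z / 3 *
        proj (g.coord e) (vecCoord u e) j i z := fun e he z hz => (hfl he hz).2 (hzero _)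
  refine Or.inr ⟨3 * κ ^ 2 * (p x₀ + ρ x₀), a, fun x => by rw [hft]; exact hpos x,
    fun x => by rw [hft], g.isGRW_of_nabla hu hapos has had hN, fun e he z hz => ?_⟩
  have hunit := g.sum_lower_mul he hz hu
  obtain ⟨h1, h2, h3⟩ := (g.isMetricOn he).kinematics_of_nabla hz hunit (hN e he z hz)
  -- Contracting the gradient of `a` with `u` and using `u^k u_k = -1` shows that `θ / 3` is `ȧ /
  -- a`.
  have hdot : dotCoord u a e z = expansion (g.coord e) (vecCoord u e) z / 3 * a (e.symm z) := by
    have : ∀ k, vecCoord u e z k * pd k (fun y => a (e.symm y)) z =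
        -(expansion (g.coord e) (vecCoord u e) z / 3 * a (e.symm z)) *
          (lower (g.coord e) (vecCoord u e) k z * vecCoord u e z k) := fun k => by
      rw [had e he z hz]
      ring
    simp only [dotCoord, this, ← Finset.mul_sum, hunit]
    ring
  refine ⟨h1, h2, h3, fun j i => ?_⟩
  rw [hdot, mul_div_cancel_right₀ _ (hapos _).ne', hN e he z hz]

end LorentzMetric

end Spacetime

/-! ### The main theorem -/

theorem theorem4p2 {M : Type*} [TopologicalSpace M] [ChartedSpace Spacetime.R4 M]
    [IsManifold 𝓘(ℝ, Spacetime.R4) ∞ M] [ConnectedSpace M]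
    (g : Spacetime.LorentzMetric M)
    (u : (x : M) → TangentSpace 𝓘(ℝ, Spacetime.R4) x) (hu : g.UnitTimelike u)
    (p ρ : M → ℝ) (hp : ContMDiff 𝓘(ℝ, Spacetime.R4) 𝓘(ℝ) ∞ p)
    (hρ : ContMDiff 𝓘(ℝ, Spacetime.R4) 𝓘(ℝ) ∞ ρ)
    (F : ℝ → ℝ) (D : Set ℝ) (hD : IsOpen D) (hF : ContDiffOn ℝ 3 F D)
    (hR : ∀ x, g.ricciScalar x ∈ D)
    (κ : ℝ) (hκ : κ ≠ 0)
    (hfield : g.FieldEquations F κ u p ρ)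
    (hharm : g.ProjectivelyHarmonic) :
    (∀ x, p x + ρ x = 0) ∨
    ∃ (A : ℝ) (a : M → ℝ),
      (∀ x, 0 < A / g.fluidTerm F κ ρ x) ∧
      (∀ x, a x = (A / g.fluidTerm F κ ρ x) ^ (1 / 4 : ℝ)) ∧
      g.IsGRW u a ∧
      ∀ e : OpenPartialHomeomorph M Spacetime.R4, Spacetime.IsChart e → ∀ z ∈ e.target,
        (∀ i j, Spacetime.shear (g.coord e) (Spacetime.vecCoord u e) i j z = 0) ∧
        (∀ i j, Spacetime.vorticity (g.coord e) (Spacetime.vecCoord u e) i j z = 0) ∧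
        (∀ i, Spacetime.acceleration (g.coord e) (Spacetime.vecCoord u e) i z = 0) ∧
        (∀ j i, Spacetime.nabla (g.coord e) (Spacetime.vecCoord u e) j i z =
          Spacetime.dotCoord u a e z / a (e.symm z) *
            Spacetime.proj (g.coord e) (Spacetime.vecCoord u e) j i z) := by
  exact hfield.add_eq_zero_or_isGRW hharm hu hp hρ hκ
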